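/- **Setting.** Consider a discounted MDP with an arbitrary measurable state space $\mathcal S$, a finite product action set $\mathcal A=\mathcal A^{(1)}\times\dots\times\mathcal A^{(m)}$ ($m\ge1$), transition kernel $P$, rewards $r:\mathcal S\times\mathcal A\to[0,1]$ and discount factor $\gamma\in[0,1)$; let $V_\pi,Q_\pi$ be the value functions of a stationary randomized policy $\pi$, and $V^*=\sup_\pi V_\pi$. Let $\phi(s,a)=\sum_{i=1}^m\phi_i(s,a^{(i)})$ with measurable $\phi_i:\mathcal S\times\mathcal A^{(i)}\to\mathbb R^d$, $d\ge1$, and assume $\|\phi(s,a)\|_2\le1$ for all $(s,a)$. Let $\varepsilon>0$, $b>0$, $\delta\in(0,1)$, and assume additive realizability: for every stationary policy $\pi$ there is $w_\pi\in\mathbb R^d$ with $\|w_\pi\|_2\le b$ and $|Q_\pi(s,a)-w_\pi^\top\phi(s,a)|\le\varepsilon$ for all $(s,a)$. The simulator, on input $(s,a)$, returns $r(s,a)$ and an independent draw from $P(s,a)$. **Algorithm.** Fix an initial state $\rho$, a default action $\bar a$ and an initial policy $\pi_0$ that can be sampled. For a list $\mathcal C$ of state-action pairs (the core set) let $\Phi_{\mathcal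 C}$ be the matrix with rows $\phi(z)^\top$, $z\in\mathcal C$, and $V_{\mathcal C}=\Phi_{\mathcal C}^\top\Phi_{\mathcal C}+\lambda I$. The *DAV check* at a state $s$ goes in order through all $\tilde a=(a^{(j)},\bar a^{(-j)})$, $j\in[m]$, $a^{(j)}\in\mathcal A^{(j)}$ ($\bar a$ with component $j$ replaced), and returns the first $(s,\tilde a)$ with $\phi(s,\tilde a)^\top V_{\mathcal C}^{-1}\phi(s,\tilde a)>\tau$, if there is one. Confident MC-Politex starts with $\mathcal C=\{(\rho,\bar a)\}$ and adds what the DAV check at $\rho$ returns until it returns nothing. Then it runs policy iteration: for $k=1,\dots,K$, for every $z\in\mathcal C$, it averages the returns $\sum_{t=0}^H\gamma^tr_t$ of $n$ rollouts that start from the pair $z$ and then follow $\pi_{k-1}$, with a DAV check at each of the states at times $1,\dots,H$; if a check returns a pair, that pair is added to $\mathcal C$ and policy iteration restarts from $k=1$. With $q_{\mathcal C}$ the vector of the averages, $w_k=V_{\mathcal C}^{-1}\Phi_{\mathcal C}^\top q_{\mathcal C}$ and $\pi_k(a|s)\propto\exp\big(\alpha\sum_{j=1}^kw_j^\top\phi(s,a)\big)$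 (no clipping). When all $K$ iterations are completed it outputs the uniform mixture $\bar\pi_{K-1}$ of $\pi_0,\dots,\pi_{K-1}$. **Parameters.** Let $\zeta=2m-1$, $A=\max_i|\mathcal A^{(i)}|$, $L=1+\log(1+b^2\varepsilon^{-2}d^{-1})$ and $\kappa=\frac{16\varepsilon\sqrt d\,\zeta}{1-\gamma}\sqrt L$, and take $\tau=1$, $\lambda=\frac{\kappa^2(1-\gamma)^2}{576b^2\zeta^2}$, $C_{\max}=\frac{2e}{e-1}d\big(\log2+\log(1+\tfrac1\lambda)\big)$, $\theta=\frac{\kappa(1-\gamma)}{24\zeta\sqrt{C_{\max}}}$, $H=\max\Big\{0,\Big\lceil\frac{\log(24\sqrt{C_{\max}}\zeta)-\log(\kappa(1-\gamma)^2)}{1-\gamma}-1\Big\rceil\Big\}$, $K=\max\Big\{1,\Big\lceil2m\log A\Big(\frac4{\kappa^2(1-\gamma)^4}+\frac3{\kappa(1-\gamma)^2}+\frac9{16}\Big)\Big\rceil\Big\}$, $n=\Big\lceil\frac{\log(4KC_{\max}^2)-\log\delta}{2\theta^2(1-\gamma)^2}\Big\rceil$, $\eta=\zeta\Big(b\sqrt\lambda+\big(\varepsilon+\tfrac{\gamma^{H+1}}{1-\gamma}+\theta\big)\sqrt{C_{\max}}\Big)+\varepsilon$,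 $\alpha=\frac1{1/(1-\gamma)+2\eta}\sqrt{\frac{2\log|\mathcal A|}K}$. **Theorem (Confident MC-Politex Sub-Optimality).** There are a universal constant $c$ and a universal polynomial $p$ in six variables such that in this setting: 1. For every weight vector $W\in\mathbb R^d$ and state $s$, drawing the components $a^{(i)}$ one at a time with probabilities proportional to $\exp(\alpha W^\top\phi_i(s,a^{(i)}))$ produces a sample from the softmax policy $\propto\exp(\alpha W^\top\phi(s,\cdot))$, with no simulator query and at most $c\,d\sum_i|\mathcal A^{(i)}|$ steps. The algorithm samples its policies $\pi_k$, $k\ge1$, in this way. 2. With probability at least $1-\delta$, $$V^*(\rho)-V_{\bar\pi_{K-1}}(\rho)\le\frac{64\,\varepsilon m\sqrt d}{1-\gamma}\Big(1+\log(1+b^2\varepsilon^{-2}d^{-1})\Big)^{1/2}.$$ 3. Every run terminates after at most $C_{\max}$ passes through each of the two loops that enlarge $\mathcal C$, queries the simulator only at $\rho$ and at states that the simulator has returned before, and makes at most $C_{\max}^2Kn(H+1)$ queries. If $\kappa\le\frac1{1-\gamma}$ (which holds whenever the bound in 2 is below the trivial bound $\frac1{1-\gamma}$), this number of queries is $\tilde{\mathcal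 O}\big(\frac{md}{\varepsilon^4(1-\gamma)^5}\big)$; precisely, it is at most $c\,\ell^4\,\frac{md}{\varepsilon^4(1-\gamma)^5}$, where $$\ell=1+\log(1+m)+\log(1+d)+\log A+\log\tfrac1{1-\gamma}+\log\big(1+\tfrac1\varepsilon\big)+\log\tfrac1\delta+\log(1+b).$$ 4. Every run takes at most $p\big(\sum_i|\mathcal A^{(i)}|,\,d,\,\frac1{1-\gamma},\,\frac1\varepsilon,\,\log\frac1\delta,\,\log(1+b)\big)$ steps. Here a step is an elementary real operation (arithmetic, exponential, comparison), reading one coordinate of a $\phi_i$, setting one component of a joint action, a simulator query, or a draw from $\pi_0$; a draw from an explicit list of $N$ weights counts as $N$ steps. -/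

import Mathlib

open MeasureTheory ProbabilityTheory
open scoped ENNReal

namespace ConfidentPolitex

noncomputable section

universe u v w w₁ w₂

/-! ### Markov decision processes, policies, values -/

/-- A discounted Markov decision process with rewards in `[0, 1]`. -/
structure MDP (S : Type u) [MeasurableSpace S] (Act : Type v) [MeasurableSpace Act] where
  /-- transition kernel -/
  P : Kernel (S × Act) S
  markov : IsMarkovKernel P
  /-- reward function -/
  r : S × Act → ℝ
  measurable_r : Measurable r
  r_mem : ∀ x, r x ∈ Set.Icc (0 : ℝ) 1
  /-- discount factor -/
  γ : ℝ
  γ_nonneg : 0 ≤ γ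
  γ_lt_one : γ < 1

/-- A stationary (randomized) policy. -/
structure Policy (S : Type u) [MeasurableSpace S] (Act : Type v) [MeasurableSpace Act] where
  kernel : Kernel S Act
  markov : IsMarkovKernel kernel

attribute [instance] MDP.markov Policy.markov

namespace MDP

variable {S : Type u} [MeasurableSpace S] {Act : Type v} [MeasurableSpace Act]

/-- One step of the state-action chain: from `(s, a)` draw `s₁ ∼ P(s, a)`, then `a₁ ∼ π(s₁)`. -/
def stepKernel (M : MDP S Act) (π : Policy S Act) : Kernel (S × Act) (S × Act) :=
  M.P ⊗ₖ Kernel.prodMkLeft (S × Act) π.kernel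

instance (M : MDP S Act) (π : Policy S Act) : IsMarkovKernel (M.stepKernel π) := by
  unfold stepKernel; infer_instance

/-- The step kernel as a kernel from histories; it only looks at the last state-action pair. -/
def historyKernel (M : MDP S Act) (π : Policy S Act) (t : ℕ) :
    Kernel (∀ _ : Finset.Iic t, S × Act) (S × Act) :=
  (M.stepKernel π).comap (fun h => h ⟨t, Finset.mem_Iic.2 le_rfl⟩) (measurable_pi_apply _)

instance (M : MDP S Act) (π : Policy S Act) (t : ℕ) : IsMarkovKernel (M.historyKernel π t) := by
  unfold historyKernel; infer_instance

/-- The law of the state-action process `(s_t, a_t)_t` started from `s₀ = s` under `π`. -/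
def trajectoryLaw (M : MDP S Act) (π : Policy S Act) (s : S) : Measure (ℕ → S × Act) :=
  Kernel.trajMeasure (X := fun _ => S × Act)
    ((Measure.dirac s) ⊗ₘ π.kernel) (M.historyKernel π)

/-- Discounted return of a trajectory. -/
def discountedReturn (M : MDP S Act) (x : ℕ → S × Act) : ℝ := ∑' t, M.γ ^ t * M.r (x t)

/-- State value function `V_π`. -/
def value (M : MDP S Act) (π : Policy S Act) (s : S) : ℝ :=
  ∫ x, M.discountedReturn x ∂(M.trajectoryLaw π s)

/-- State-action value function `Q_π`. -/
def qvalue (M : MDP S Act) (π : Policy S Act) (s : S) (a : Act) : ℝ :=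
  M.r (s, a) + M.γ * ∫ y, M.value π y ∂(M.P (s, a))

/-- Optimal value `V^*`. -/
def optValue (M : MDP S Act) (s : S) : ℝ := sSup (Set.range fun π : Policy S Act => M.value π s)

/-- The law of the process under the uniform mixture of a finite list of policies: one member of the
list is drawn uniformly at the beginning and followed forever. -/
def mixtureLaw (M : MDP S Act) (l : List (Policy S Act)) (s : S) : Measure (ℕ → S × Act) :=
  ((l.length : ℝ≥0∞)⁻¹) • (l.map fun π => M.trajectoryLaw π s).sum

/-- Value of the uniform mixture of a finite list of policies. -/
def mixtureValue (M : MDP S Act) (l : List (Policy S Act)) (s : S) : ℝ :=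
  ∫ x, M.discountedReturn x ∂(M.mixtureLaw l s)

end MDP

/-! ### Product action sets and additive features -/

/-- Joint actions: the `i`-th component action set has `N i` elements, listed as `0, …, N i - 1`. -/
abbrev Joint {m : ℕ} (N : Fin m → ℕ) : Type := ∀ i, Fin (N i)

/-- Component feature maps `φ_i : S × A^(i) → ℝ^d`. -/
structure Features (S : Type u) [MeasurableSpace S] (d : ℕ) {m : ℕ} (N : Fin m → ℕ) where
  φ : ∀ i, S → Fin (N i) → Fin d → ℝ
  measurable_φ : ∀ i a, Measurable fun s => φ i s a

section Features

variable {S : Type u} [MeasurableSpace S] {m d : ℕ} {N : Fin m → ℕ}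

/-- The joint feature map `φ(s, a) = ∑ i, φ_i(s, a_i)`. -/
def Features.joint (F : Features S d N) (s : S) (a : Joint N) : Fin d → ℝ := ∑ i, F.φ i s (a i)

/-- Euclidean norm on `ℝ^d`. -/
def euclNorm (x : Fin d → ℝ) : ℝ := ‖WithLp.toLp 2 x‖

/-- Bounded features. -/
def Features.Bounded (F : Features S d N) : Prop := ∀ s a, euclNorm (F.joint s a) ≤ 1

/-- Additive realizability: for every policy, `Q_π` is within `ε` of a linear function of the
additive features, with weight vector of norm at most `b`. -/
def AdditiveRealizable (M : MDP S (Joint N)) (F : Features S d N) (b ε : ℝ) : Prop :=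
  ∀ π : Policy S (Joint N), ∃ θ : Fin d → ℝ, euclNorm θ ≤ b ∧
    ∀ s a, |M.qvalue π s a - θ ⬝ᵥ F.joint s a| ≤ ε

/-- Probability that the (unclipped) softmax policy with inverse temperature `α` and weight vector
`W` plays `a` in `s`. -/
def Features.softmaxProb (F : Features S d N) (α : ℝ) (W : Fin d → ℝ) (s : S) (a : Joint N) : ℝ :=
  Real.exp (α * (W ⬝ᵥ F.joint s a)) / ∑ a₁ : Joint N, Real.exp (α * (W ⬝ᵥ F.joint s a₁))

lemma Features.measurable_softmaxProb (F : Features S d N) (α : ℝ) (W : Fin d → ℝ) (a : Joint N) :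
    Measurable fun s => F.softmaxProb α W s a := by
  have h : ∀ a : Joint N, Measurable fun s => Real.exp (α * (W ⬝ᵥ F.joint s a)) := by
    intro a
    have h1 : ∀ (i : Fin m) (l : Fin d), Measurable fun s => F.φ i s (a i) l := fun i l =>
      (measurable_pi_apply l).comp (F.measurable_φ i (a i))
    simp only [Features.joint, dotProduct, Finset.sum_apply]
    fun_prop
  exact (h a).div (Finset.measurable_fun_sum _ fun a₁ _ => h a₁)

lemma Features.softmaxProb_nonneg (F : Features S d N) (α : ℝ) (W : Fin d → ℝ) (s : S)
    (a : Joint N) : 0 ≤ F.softmaxProb α W s a := by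
  unfold Features.softmaxProb; positivity

lemma Features.sum_softmaxProb [Nonempty (Joint N)] (F : Features S d N) (α : ℝ) (W : Fin d → ℝ)
    (s : S) : ∑ a, F.softmaxProb α W s a = 1 := by
  unfold Features.softmaxProb
  rw [← Finset.sum_div]
  exact div_self (Finset.sum_pos (fun a _ => Real.exp_pos _) Finset.univ_nonempty).ne'

/-- The softmax policy, as a stationary policy. -/
def Features.softmaxPolicy [Nonempty (Joint N)] (F : Features S d N) (α : ℝ) (W : Fin d → ℝ) :
    Policy S (Joint N) where
  kernel :=
    { toFun := fun s => ∑ a, ENNReal.ofReal (F.softmaxProb α W s a) • Measure.dirac a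
      measurable' := by
        refine Measure.measurable_of_measurable_coe _ fun B _ => ?_
        simp only [Measure.coe_finsetSum, Finset.sum_apply, Measure.smul_apply, smul_eq_mul]
        exact Finset.measurable_fun_sum _ fun a _ =>
          (F.measurable_softmaxProb α W a).ennreal_ofReal.mul_const _ }
  markov := ⟨fun s => ⟨by
    change (∑ a, ENNReal.ofReal (F.softmaxProb α W s a) • Measure.dirac a) Set.univ = 1
    simp only [Measure.coe_finsetSum, Finset.sum_apply, Measure.smul_apply, smul_eq_mul,
      measure_univ, mul_one]
    rw [← ENNReal.ofReal_sum_of_nonneg fun a _ => F.softmaxProb_nonneg α W s a,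
      F.sum_softmaxProb, ENNReal.ofReal_one]⟩⟩

end Features

/-! ### Deterministic computations with a count of elementary operations -/

/-- A value together with the number of elementary operations (real arithmetic, exponential,
comparison of reals, reading one coordinate of a component feature, setting one component of a joint
action) spent on computing it. Control flow and passing references are not charged separately. -/
structure Timed (α : Type w) where
  val : α
  cost : ℕ

namespace Timed

def pure {α : Type w} (x : α) : Timed α := ⟨x, 0⟩

def bind {α : Type w₁} {β : Type w₂} (p : Timed α) (f : α → Timed β) : Timed β :=
  ⟨(f p.val).val, p.cost + (f p.val).cost⟩

def add (x y : ℝ) : Timed ℝ := ⟨x + y, 1⟩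
def sub (x y : ℝ) : Timed ℝ := ⟨x - y, 1⟩
def mul (x y : ℝ) : Timed ℝ := ⟨x * y, 1⟩
def div (x y : ℝ) : Timed ℝ := ⟨x / y, 1⟩
def exp (x : ℝ) : Timed ℝ := ⟨Real.exp x, 1⟩
open Classical in
def less (x y : ℝ) : Timed Bool := ⟨decide (x < y), 1⟩
/-- Reading one stored number. -/
def read (x : ℝ) : Timed ℝ := ⟨x, 1⟩

/-- Compute the `n` entries of a vector one after the other. -/
def tabulate {n : ℕ} {α : Type w} (f : Fin n → Timed α) : Timed (Fin n → α) :=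
  ⟨fun i => (f i).val, ∑ i, (f i).cost⟩

/-- Compute `n` numbers one after the other and add them up. -/
def sum {n : ℕ} (f : Fin n → Timed ℝ) : Timed ℝ :=
  ⟨∑ i, (f i).val, ∑ i, ((f i).cost + 1)⟩

/-- Inner product of two vectors. -/
def dot {d : ℕ} (x y : Fin d → ℝ) : Timed ℝ := sum fun i => mul (x i) (y i)

/-- Sum of two vectors. -/
def vecAdd {d : ℕ} (x y : Fin d → ℝ) : Timed (Fin d → ℝ) := tabulate fun i => add (x i) (y i)

/-- Matrix times vector. -/
def matVec {d : ℕ} (A : Matrix (Fin d) (Fin d) ℝ) (x : Fin d → ℝ) : Timed (Fin d → ℝ) :=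
  tabulate fun i => dot (A i) x

/-- The inverse of `Φᵀ Φ + reg • 1`, where the rows of `Φ` are the vectors in the list, computed by
successive rank-one updates. -/
def gramInv {d : ℕ} (reg : ℝ) : List (Fin d → ℝ) → Timed (Matrix (Fin d) (Fin d) ℝ)
  | [] => tabulate fun i => tabulate fun j => if i = j then div 1 reg else read 0
  | x :: L =>
    (gramInv reg L).bind fun B =>
    (matVec B x).bind fun y =>
    (dot x y).bind fun c =>
    (add 1 c).bind fun e =>
    tabulate fun i => tabulate fun j =>
      (mul (y i) (y j)).bind fun p => (div p e).bind fun q => sub (B i j) q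

/-- The vector `Φᵀ q`, from the list of the rows of `Φ` paired with the entries of `q`. -/
def featTargets {d : ℕ} : List ((Fin d → ℝ) × ℝ) → Timed (Fin d → ℝ)
  | [] => tabulate fun _ => read 0
  | (x, q) :: L =>
    (featTargets L).bind fun y => tabulate fun l => (mul q (x l)).bind fun p => add (y l) p

end Timed

/-- `Φᵀ Φ + reg • 1`, where the rows of `Φ` are the vectors in the list. -/
def gram {d : ℕ} (reg : ℝ) (L : List (Fin d → ℝ)) : Matrix (Fin d) (Fin d) ℝ :=
  (L.map fun x => Matrix.vecMulVec x x).sum + reg • (1 : Matrix (Fin d) (Fin d) ℝ)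

lemma gram_posDef {d : ℕ} {reg : ℝ} (h : 0 < reg) (L : List (Fin d → ℝ)) : (gram reg L).PosDef := by
  induction L with
  | nil =>
    simp only [gram, List.map_nil, List.sum_nil, zero_add]
    exact Matrix.PosDef.one.smul h
  | cons x L ih =>
    have e : gram reg (x :: L) = Matrix.vecMulVec x x + gram reg L := by
      simp [gram, add_assoc]
    rw [e]
    have := Matrix.posSemidef_vecMulVec_self_star x
    simp only [star_trivial] at this
    exact Matrix.PosDef.posSemidef_add this ih

/-- The rank-one updates compute the inverse of the regularized Gram matrix. -/
lemma gramInv_val {d : ℕ} {reg : ℝ} (h : 0 < reg) (L : List (Fin d → ℝ)) :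
    (Timed.gramInv reg L).val = (gram reg L)⁻¹ := by
  induction L with
  | nil =>
    symm
    apply Matrix.inv_eq_right_inv
    have : (Timed.gramInv reg ([] : List (Fin d → ℝ))).val = reg⁻¹ • 1 := by
      ext i j
      by_cases hij : i = j
      · subst hij; simp [Timed.gramInv, Timed.tabulate, Timed.div]
      · simp [Timed.gramInv, Timed.tabulate, Timed.read, hij]
    rw [this]
    simp [gram, smul_smul, h.ne']
  | cons x L ih =>
    have e : gram reg (x :: L) = Matrix.vecMulVec x x + gram reg L := by
      simp [gram, add_assoc]
    have hp := gram_posDef h L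
    have hdet : IsUnit (gram reg L).det := (Matrix.isUnit_iff_isUnit_det _).1 hp.isUnit
    set G := gram reg L with hG
    set y := G⁻¹.mulVec x with hy
    have hc : 0 ≤ x ⬝ᵥ y := by
      have := hp.inv.posSemidef.dotProduct_mulVec_nonneg x
      simpa using this
    have hsymm : Matrix.vecMul x G⁻¹ = y := by
      have h1 : (G⁻¹).transpose = G⁻¹ := by
        have := hp.inv.isHermitian
        simpa [Matrix.IsHermitian, Matrix.conjTranspose_eq_transpose_of_trivial] using this
      rw [hy, ← Matrix.vecMul_transpose, h1]
    have hGy : G.mulVec y = x := by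
      rw [hy, Matrix.mulVec_mulVec, Matrix.mul_nonsing_inv _ hdet, Matrix.one_mulVec]
    have hval : (Timed.gramInv reg (x :: L)).val =
        G⁻¹ - (1 + x ⬝ᵥ y)⁻¹ • Matrix.vecMulVec y y := by
      have hmv : ∀ A : Matrix (Fin d) (Fin d) ℝ, (Timed.matVec A x).val = A.mulVec x := fun A => rfl
      have hd : ∀ u v : Fin d → ℝ, (Timed.dot u v).val = u ⬝ᵥ v := fun u v => rfl
      ext i j
      simp only [Timed.gramInv, Timed.bind, Timed.tabulate, Timed.mul, Timed.div, Timed.sub,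
        Timed.add, ih, hmv, hd, Matrix.sub_apply, Matrix.smul_apply, Matrix.vecMulVec_apply,
        smul_eq_mul, ← hy]
      ring
    rw [hval]
    symm
    apply Matrix.inv_eq_right_inv
    have hne : (1 + x ⬝ᵥ y) ≠ 0 := by positivity
    rw [e, Matrix.add_mul, Matrix.mul_sub, Matrix.mul_sub, Matrix.mul_smul, Matrix.mul_smul,
      Matrix.vecMulVec_mul, hsymm, Matrix.vecMulVec_mul_vecMulVec, Matrix.mul_vecMulVec, hGy,
      Matrix.mul_nonsing_inv _ hdet]
    ext i j
    simp only [Matrix.add_apply, Matrix.sub_apply, Matrix.smul_apply, Matrix.vecMulVec_apply,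
      smul_eq_mul, Pi.smul_apply]
    field_simp
    ring

/-! ### Interactive randomized programs -/

/-- A randomized program that talks to a simulator. `work c` performs `c` elementary operations;
`query s a` sends the pair `(s, a)` to the simulator and receives the next state and the reward;
`draw n w` draws an index `i < n` with probability proportional to the explicitly listed weight
`w i`; `initial s` draws an action from the given initial policy in the state `s`. -/
inductive Prog (S : Type u) (Act : Type v) (α : Type w) : Type (max u v w)
  | ret (x : α) : Prog S Act α
  | work (c : ℕ) (p : Prog S Act α) : Prog S Act α
  | query (s : S) (a : Act) (k : S → ℝ → Prog S Act α) : Prog S Act α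
  | draw (n : ℕ) (w : Fin n → ℝ) (k : Fin n → Prog S Act α) : Prog S Act α
  | initial (s : S) (k : Act → Prog S Act α) : Prog S Act α

namespace Prog

section Basic

variable {S : Type u} {Act : Type v}

/-- Sequential composition. -/
def bind {α : Type w₁} {β : Type w₂} : Prog S Act α → (α → Prog S Act β) → Prog S Act β
  | ret x, f => f x
  | work c p, f => work c (p.bind f)
  | query s a k, f => query s a fun y r => (k y r).bind f
  | draw n w k, f => draw n w fun i => (k i).bind f
  | initial s k, f => initial s fun a => (k a).bind f

/-- Run a deterministic computation, charging its elementary operations. -/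
def exec {α : Type w} (x : Timed α) : Prog S Act α := work x.cost (ret x.val)

end Basic

section Semantics

variable {S : Type u} [MeasurableSpace S] {Act : Type v} [MeasurableSpace Act]

/-- Expectation of `f` evaluated at the output of a program, when the simulator is that of `M`
(independent next states `y ∼ P(s, a)`, rewards `r(s, a)`) and the initial policy is `π₀`. For
integrands that are not measurable this is the iterated lower integral, so that lower bounds on
probabilities remain meaningful (and strong). -/
def expect {α : Type w} (M : MDP S Act) (π₀ : Policy S Act) :
    Prog S Act α → (α → ℝ≥0∞) → ℝ≥0∞
  | ret x, f => f x
  | work _ p, f => p.expect M π₀ f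
  | query s a k, f => ∫⁻ y, (k y (M.r (s, a))).expect M π₀ f ∂(M.P (s, a))
  | draw _ w k, f => ∑ i, ENNReal.ofReal (w i / ∑ j, w j) * (k i).expect M π₀ f
  | initial s k, f => ∫⁻ a, (k a).expect M π₀ f ∂(π₀.kernel s)

/-- Probability that the output of a program lies in `E`. -/
def prob {α : Type w} (M : MDP S Act) (π₀ : Policy S Act) (p : Prog S Act α) (E : Set α) : ℝ≥0∞ :=
  p.expect M π₀ (E.indicator 1)

/-- `p.Run M x q t`: some run of `p` on the simulator of `M` outputs `x` after `q` simulator queries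
and `t` steps. Every elementary operation, every query and every call of the initial policy is one
step; drawing from a distribution given by a list of `n` weights takes `n` steps. -/
inductive Run {α : Type w} (M : MDP S Act) : Prog S Act α → α → ℕ → ℕ → Prop
  | ret (x : α) : Run M (.ret x) x 0 0
  | work {c : ℕ} {p : Prog S Act α} {x : α} {q t : ℕ} :
      Run M p x q t → Run M (.work c p) x q (c + t)
  | query {s : S} {a : Act} {k : S → ℝ → Prog S Act α} (y : S) {x : α} {q t : ℕ} :
      Run M (k y (M.r (s, a))) x q t → Run M (.query s a k) x (q + 1) (t + 1)
  | draw {n : ℕ} {w : Fin n → ℝ} {k : Fin n → Prog S Act α} (i : Fin n) {x : α} {q t : ℕ} :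
      Run M (k i) x q t → Run M (.draw n w k) x q (n + t)
  | initial {s : S} {k : Act → Prog S Act α} (a : Act) {x : α} {q t : ℕ} :
      Run M (k a) x q t → Run M (.initial s k) x q (t + 1)

/-- The program only uses states in `V` or states that the simulator has returned before. -/
def LocalAccess {α : Type w} : Prog S Act α → Set S → Prop
  | ret _, _ => True
  | work _ p, V => p.LocalAccess V
  | query s _ k, V => s ∈ V ∧ ∀ y r, (k y r).LocalAccess (insert y V)
  | draw _ _ k, V => ∀ i, (k i).LocalAccess V
  | initial s k, V => s ∈ V ∧ ∀ a, (k a).LocalAccess V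

end Semantics

end Prog

/-! ### The algorithm -/

/-- What the algorithm is given: features, default action, uncertainty threshold, regularization
coefficient, inverse temperature of the softmax, discount factor, number of iterations, number of
rollouts, length of rollouts. -/
structure Input (S : Type u) [MeasurableSpace S] (d : ℕ) {m : ℕ} (N : Fin m → ℕ) where
  feat : Features S d N
  abar : Joint N
  thr : ℝ
  reg : ℝ
  temp : ℝ
  disc : ℝ
  K : ℕ
  n : ℕ
  H : ℕ

/-- An element of the core set: state, action and feature. -/
structure CoreElt (S : Type u) (d : ℕ) {m : ℕ} (N : Fin m → ℕ) where
  state : S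
  act : Joint N
  vec : Fin d → ℝ

section Algorithm

variable {S : Type u} [MeasurableSpace S] {m d : ℕ} {N : Fin m → ℕ}

/-- Compute the joint feature `φ(s, a)`. -/
def jointFeature (F : Features S d N) (s : S) (a : Joint N) : Timed (Fin d → ℝ) :=
  Timed.tabulate fun l => Timed.sum fun i => Timed.read (F.φ i s (a i) l)

/-- The pairs `(j, a)` with `j` a component and `a` an action of that component, in order. -/
def componentActions (N : Fin m → ℕ) : List ((j : Fin m) × Fin (N j)) :=
  (List.finRange m).flatMap fun j => (List.finRange (N j)).map fun a => ⟨j, a⟩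

/-- Go through a list of pairs `(j, a)` and return the first one for which the default action with
its `j`-th component replaced by `a` satisfies `φᵀ B φ > thr`. -/
def davSearch (I : Input S d N) (B : Matrix (Fin d) (Fin d) ℝ) (s : S) :
    List ((j : Fin m) × Fin (N j)) → Timed (Option (CoreElt S d N))
  | [] => Timed.pure none
  | p :: L =>
    (⟨Function.update I.abar p.1 p.2, m⟩ : Timed (Joint N)).bind fun a =>
    (jointFeature I.feat s a).bind fun x =>
    (Timed.matVec B x).bind fun y =>
    (Timed.dot x y).bind fun c =>
    (Timed.less I.thr c).bind fun big =>
    if big then Timed.pure (some ⟨s, a, x⟩) else davSearch I B s L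

/-- Uncertainty check with the default action vector: `some z` means that `z` is uncertain, `none`
means that the state is certain. -/
def davCheck (I : Input S d N) (C : List (CoreElt S d N)) (s : S) :
    Timed (Option (CoreElt S d N)) :=
  (Timed.gramInv I.reg (C.map CoreElt.vec)).bind fun B => davSearch I B s (componentActions N)

/-- Sample a joint action from the softmax policy with weight vector `W`, one component after the
other, the `i`-th component with probabilities proportional to `exp (temp * Wᵀ φ_i(s, ·))`. -/
def sampleSoftmax (I : Input S d N) (W : Fin d → ℝ) (s : S) : Prog S (Joint N) (Joint N) :=
  (List.finRange m).foldl
    (fun p i =>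
      p.bind fun a =>
      (Prog.exec (Timed.tabulate fun c : Fin (N i) =>
        (Timed.tabulate fun l => Timed.read (I.feat.φ i s c l)).bind fun x =>
        (Timed.dot W x).bind fun y =>
        (Timed.mul I.temp y).bind fun e => Timed.exp e)).bind fun ws =>
      Prog.draw (N i) ws fun c => Prog.exec ⟨Function.update a i c, 1⟩)
    (Prog.ret I.abar)

/-- Sample from a policy of the algorithm: `none` stands for the initial policy, `some W` for the
softmax policy with weight vector `W`. -/
def samplePolicy (I : Input S d N) (c : Option (Fin d → ℝ)) (s : S) :
    Prog S (Joint N) (Joint N) :=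
  match c with
  | none => Prog.initial s Prog.ret
  | some W => sampleSoftmax I W s

/-- The policy that is denoted by `none` or by `some W`. -/
def decode (I : Input S d N) (π₀ : Policy S (Joint N)) :
    Option (Fin d → ℝ) → Policy S (Joint N)
  | none => π₀
  | some W =>
    haveI : Nonempty (Joint N) := ⟨I.abar⟩
    I.feat.softmaxPolicy I.temp W

/-- Remaining `h` steps of a single rollout from the current state `s`, with current discount weight
`g` and accumulated return `acc`. -/
def rolloutSteps (I : Input S d N) (c : Option (Fin d → ℝ)) (C : List (CoreElt S d N)) :
    ℕ → ℝ → ℝ → S → Prog S (Joint N) (CoreElt S d N ⊕ ℝ)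
  | 0, _, acc, _ => Prog.ret (Sum.inr acc)
  | h + 1, g, acc, s =>
    (Prog.exec (davCheck I C s)).bind fun
      | some z => Prog.ret (Sum.inl z)
      | none =>
        (samplePolicy I c s).bind fun a =>
        Prog.query s a fun y r =>
        (Prog.exec (Timed.mul g r)).bind fun x =>
        (Prog.exec (Timed.add acc x)).bind fun acc₁ =>
        (Prog.exec (Timed.mul g I.disc)).bind fun g₁ =>
        rolloutSteps I c C h g₁ acc₁ y

/-- Remaining `k` rollouts from the core set element `z`, with sum `tot` of the returns so far. -/
def rolloutLoop (I : Input S d N) (c : Option (Fin d → ℝ)) (C : List (CoreElt S d N))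
    (z : CoreElt S d N) : ℕ → ℝ → Prog S (Joint N) (CoreElt S d N ⊕ ℝ)
  | 0, tot => Prog.ret (Sum.inr tot)
  | k + 1, tot =>
    Prog.query z.state z.act fun y r =>
    (rolloutSteps I c C I.H I.disc r y).bind fun
      | Sum.inl x => Prog.ret (Sum.inl x)
      | Sum.inr g => (Prog.exec (Timed.add tot g)).bind fun tot₁ => rolloutLoop I c C z k tot₁

/-- Rollout: either an uncertain element (left), or the average return of `n` rollouts (right). -/
def rollout (I : Input S d N) (c : Option (Fin d → ℝ)) (C : List (CoreElt S d N))
    (z : CoreElt S d N) : Prog S (Joint N) (CoreElt S d N ⊕ ℝ) :=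
  (rolloutLoop I c C z I.n 0).bind fun
    | Sum.inl x => Prog.ret (Sum.inl x)
    | Sum.inr tot => (Prog.exec (Timed.div tot I.n)).bind fun q => Prog.ret (Sum.inr q)

/-- Rollouts from all elements of a list (a part of the core set `C`): either an uncertain element,
or the list of pairs (feature, value estimate). -/
def evaluate (I : Input S d N) (c : Option (Fin d → ℝ)) (C : List (CoreElt S d N)) :
    List (CoreElt S d N) → Prog S (Joint N) (CoreElt S d N ⊕ List ((Fin d → ℝ) × ℝ))
  | [] => Prog.ret (Sum.inr [])
  | z :: L =>
    (rollout I c C z).bind fun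
      | Sum.inl x => Prog.ret (Sum.inl x)
      | Sum.inr q =>
        (evaluate I c C L).bind fun
          | Sum.inl x => Prog.ret (Sum.inl x)
          | Sum.inr l => Prog.ret (Sum.inr ((z.vec, q) :: l))

/-- Regularized least squares: `(Φᵀ Φ + reg • 1)⁻¹ Φᵀ q`. -/
def leastSquares (I : Input S d N) (l : List ((Fin d → ℝ) × ℝ)) : Timed (Fin d → ℝ) :=
  (Timed.gramInv I.reg (l.map Prod.fst)).bind fun B =>
  (Timed.featTargets l).bind fun y => Timed.matVec B y

lemma leastSquares_val (I : Input S d N) (h : 0 < I.reg) (l : List ((Fin d → ℝ) × ℝ)) :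
    (leastSquares I l).val =
      ((gram I.reg (l.map Prod.fst))⁻¹).mulVec (l.map fun p => p.2 • p.1).sum := by
  have h1 : (Timed.featTargets l).val = (l.map fun p => p.2 • p.1).sum := by
    induction l with
    | nil => rfl
    | cons p l ih =>
      ext i
      simp only [Timed.featTargets, Timed.bind, Timed.tabulate, Timed.mul, Timed.add, ih,
        List.map_cons, List.sum_cons, Pi.add_apply, Pi.smul_apply, smul_eq_mul]
      ring
  rw [← h1, ← gramInv_val h]
  rfl

/-- Remaining `k` policy iterations with the core set `C`, current policy `c` and current sum
`W = w_1 + ⋯ + w_j` of the weight vectors computed so far. The outcome is an uncertain element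
(left), or the list of the policies that were evaluated (right). -/
def iterate (I : Input S d N) (C : List (CoreElt S d N)) :
    ℕ → Option (Fin d → ℝ) → (Fin d → ℝ) →
      Prog S (Joint N) (CoreElt S d N ⊕ List (Option (Fin d → ℝ)))
  | 0, _, _ => Prog.ret (Sum.inr [])
  | k + 1, c, W =>
    (evaluate I c C C).bind fun
      | Sum.inl x => Prog.ret (Sum.inl x)
      | Sum.inr l =>
        (Prog.exec (leastSquares I l)).bind fun w =>
        (Prog.exec (Timed.vecAdd W w)).bind fun W₁ =>
        (iterate I C k (some W₁) W₁).bind fun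
          | Sum.inl x => Prog.ret (Sum.inl x)
          | Sum.inr l₁ => Prog.ret (Sum.inr (c :: l₁))

/-- Initialization of the core set at the initial state `ρ`: add uncertain elements until the check
returns certain; give up (`none`) after `T` passes. -/
def initCore (I : Input S d N) (ρ : S) :
    ℕ → List (CoreElt S d N) → Prog S (Joint N) (Option (List (CoreElt S d N)))
  | 0, _ => Prog.ret none
  | T + 1, C =>
    (Prog.exec (davCheck I C ρ)).bind fun
      | some z => initCore I ρ T (C ++ [z])
      | none => Prog.ret (some C)

/-- The main loop: run the `K` policy iterations; whenever an uncertain element is found, add it to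
the core set and restart; give up (`none`) after `T` passes. -/
def mainLoop (I : Input S d N) :
    ℕ → List (CoreElt S d N) → Prog S (Joint N) (Option (List (Option (Fin d → ℝ))))
  | 0, _ => Prog.ret none
  | T + 1, C =>
    (iterate I C I.K none 0).bind fun
      | Sum.inl z => mainLoop I T (C ++ [z])
      | Sum.inr l => Prog.ret (some l)

/-- Confident MC-Politex with the default-action-vector uncertainty check, started from `ρ`. The
output `some [c_0, …, c_{K-1}]` lists the policies whose uniform mixture is the output policy;
`none` means that one of the two loops was cut off after `T` passes. -/
def confidentPolitex (I : Input S d N) (ρ : S) (T : ℕ) :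
    Prog S (Joint N) (Option (List (Option (Fin d → ℝ)))) :=
  (Prog.exec (jointFeature I.feat ρ I.abar)).bind fun x =>
  (initCore I ρ T [⟨ρ, I.abar, x⟩]).bind fun
    | none => Prog.ret none
    | some C => mainLoop I T C

end Algorithm

/-! ### Parameter settings -/

section Parameters

variable (m d : ℕ) (N : Fin m → ℕ) (γ ε b δ : ℝ)

/-- `log (max_i |A^(i)|)`. -/
def logMaxAct : ℝ := Real.log ((Finset.univ.sup N : ℕ) : ℝ)

/-- `1 + log (1 + b² ε⁻² d⁻¹)`. -/
def logTerm : ℝ := 1 + Real.log (1 + b ^ 2 / (ε ^ 2 * d))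

/-- The target accuracy `κ`. -/
def kappa : ℝ := 16 * ε * √d * (2 * m - 1) / (1 - γ) * √(logTerm d ε b)

/-- The regularization coefficient `λ`. -/
def regCoef : ℝ := kappa m d γ ε b ^ 2 * (1 - γ) ^ 2 / (576 * b ^ 2 * (2 * m - 1) ^ 2)

/-- The bound `C_max` on the size of the core set, for the threshold `τ = 1`. -/
def coreBound : ℝ :=
  Real.exp 1 / (Real.exp 1 - 1) * ((1 + 1) / 1) * d *
    (Real.log (1 + 1 / 1) + Real.log (1 + 1 / regCoef m d γ ε b))

/-- The accuracy `θ` of the Monte-Carlo averages. -/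
def theta : ℝ := kappa m d γ ε b * (1 - γ) / (24 * (2 * m - 1) * √(coreBound m d γ ε b))

/-- The rollout length `H`. -/
def rolloutLength : ℕ :=
  ⌈(Real.log (24 * √(coreBound m d γ ε b) * (2 * m - 1)) -
      Real.log (kappa m d γ ε b * (1 - γ) ^ 2)) / (1 - γ) - 1⌉₊

/-- The number of iterations `K`. -/
def numIter : ℕ :=
  max 1 ⌈2 * m * logMaxAct m N *
    (4 / (kappa m d γ ε b ^ 2 * (1 - γ) ^ 4) + 3 / (kappa m d γ ε b * (1 - γ) ^ 2) + 9 / 16)⌉₊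

/-- The number of rollouts `n`. -/
def numRollouts : ℕ :=
  ⌈(Real.log (4 * numIter m d N γ ε b * coreBound m d γ ε b ^ 2) - Real.log δ) /
    (2 * theta m d γ ε b ^ 2 * (1 - γ) ^ 2)⌉₊

/-- The evaluation accuracy `η`. -/
def eta : ℝ :=
  (b * √(regCoef m d γ ε b) +
      (ε + γ ^ (rolloutLength m d γ ε b + 1) / (1 - γ) + theta m d γ ε b) *
        √(coreBound m d γ ε b)) * (2 * m - 1) + ε

/-- The inverse temperature `α` of the softmax policies; `∏ i, N i` is the number of actions. -/
def temperature : ℝ :=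
  1 / (1 / (1 - γ) + 2 * eta m d γ ε b) *
    √(2 * Real.log ((∏ i, N i : ℕ) : ℝ) / numIter m d N γ ε b)

/-- The logarithmic quantity in the query bound. -/
def logFactor : ℝ :=
  1 + Real.log (1 + m) + Real.log (1 + d) + logMaxAct m N + Real.log (1 / (1 - γ)) +
    Real.log (1 + 1 / ε) + Real.log (1 / δ) + Real.log (1 + b)

variable {m d N}

/-- The input of the algorithm with all parameters set. -/
def tunedInput {S : Type u} [MeasurableSpace S] (F : Features S d N) (abar : Joint N) :
    Input S d N where
  feat := F
  abar := abar
  thr := 1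
  reg := regCoef m d γ ε b
  temp := temperature m d N γ ε b
  disc := γ
  K := numIter m d N γ ε b
  n := numRollouts m d N γ ε b δ
  H := rolloutLength m d γ ε b

end Parameters

end

end ConfidentPolitex

open ConfidentPolitex

/-! Three facts carry the proof. The first is that core sets stay small. A pair that fails the check
at threshold 1 more than doubles the determinant of the regularized Gram matrix (`det_gram_append`),
whereas bounded features allow this determinant to grow only polynomially in the number of pairs
(`log_det_gram_le`). So there are at most `coreBound` pairs, and as many passes.

The second is that least squares is accurate in certain states, those that pass the check. For
additive features, the feature of any joint action is the sum of `m` features with one component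
changed minus `m - 1` copies of the default feature (`Features.joint_eq_sum_update`). A check of the
single changes therefore controls all joint actions, at the price of the factor `2m - 1`
(`abs_joint_dotProduct_le`).

The third deals with uncertain states, where the estimates may be useless. Introduce virtual
policies: exponential weights with the least squares estimate in certain states and with the exact
action value of the virtual policy elsewhere. Their estimates are accurate everywhere, so the regret
bound `politex_regret` applies to them. They agree with the policies of the algorithm in certain
states, and a rollout draws actions only there, since a failed check ends the pass. Hence one and
the same average estimates the truncated values of the virtual and of the actual policy
(`expect_rolloutSteps_ge`, `prob_rollout_accurate₂_ge`). The initial state `ρ` is certain from the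
end of the initialization on. There the two policies agree and one estimate approximates both action
values, so their values at `ρ` differ by at most `2η`, which transfers the bound to the output
(`Shadowed.optValue_sub_mixtureValue_le`).

Probabilities are composed through iterated lower integrals, which are superadditive without any
measurability of the program; lower bounds on success need nothing else. Claims about every run
(queries, steps, accessibility, origin of failed checks) are proved in the Hoare-style logic
`Prog.Spec`. The remaining work is arithmetic with the parameters: each source of error receives a
fixed share of `κ(1-γ)`, and the factors of `C_max`, `K`, `n` and `H` are multiplied out. -/

namespace ConfidentPolitex

noncomputable section

universe u v w w₁ w₂

/-! ### Value functions -/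

lemma integrable_of_mem_Icc {X : Type*} [MeasurableSpace X] {μ : Measure X} [IsFiniteMeasure μ]
    {f : X → ℝ} {a b : ℝ} (hf : Measurable f) (h : ∀ x, f x ∈ Set.Icc a b) : Integrable f μ :=
  Integrable.of_mem_Icc a b hf.aemeasurable (Filter.Eventually.of_forall h)

lemma integral_mem_Icc {X : Type*} [MeasurableSpace X] {μ : Measure X} [IsProbabilityMeasure μ]
    {f : X → ℝ} {a b : ℝ} (hf : Measurable f) (h : ∀ x, f x ∈ Set.Icc a b) :
    ∫ x, f x ∂μ ∈ Set.Icc a b := by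
  have hi := integrable_of_mem_Icc (μ := μ) hf h
  constructor
  · have := integral_mono (μ := μ) (integrable_const a) hi fun x => (h x).1
    simpa using this
  · have := integral_mono (μ := μ) hi (integrable_const b) fun x => (h x).2
    simpa using this

namespace MDP

variable {S : Type u} [MeasurableSpace S] {Act : Type v} [MeasurableSpace Act]

instance (M : MDP S Act) (π : Policy S Act) (s : S) :
    IsProbabilityMeasure (M.trajectoryLaw π s) := by
  unfold trajectoryLaw; infer_instance

/-- Expected reward at time `t` from a state-action pair. -/
def expReward (M : MDP S Act) (π : Policy S Act) : ℕ → S × Act → ℝ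
  | 0 => M.r
  | t + 1 => fun x => ∫ y, M.expReward π t y ∂(M.stepKernel π x)

lemma measurable_expReward (M : MDP S Act) (π : Policy S Act) (t : ℕ) :
    Measurable (M.expReward π t) := by
  induction t with
  | zero => exact M.measurable_r
  | succ t ih =>
    exact (StronglyMeasurable.integral_kernel (κ := M.stepKernel π)
      ih.stronglyMeasurable).measurable

lemma expReward_mem (M : MDP S Act) (π : Policy S Act) (t : ℕ) (x : S × Act) :
    M.expReward π t x ∈ Set.Icc (0 : ℝ) 1 := by
  induction t generalizing x with
  | zero => exact M.r_mem x
  | succ t ih => exact integral_mem_Icc (M.measurable_expReward π t) ih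

/-- The Markov property: the joint law of the history up to `t` and the next pair is a composition
product with `historyKernel`, which reads only the last coordinate. -/
lemma integral_trajectoryLaw_succ (M : MDP S Act) (π : Policy S Act) (s : S) (t : ℕ)
    {f : S × Act → ℝ} {a b : ℝ} (hf : Measurable f) (hb : ∀ x, f x ∈ Set.Icc a b) :
    ∫ x, f (x (t + 1)) ∂(M.trajectoryLaw π s) =
      ∫ x, (∫ y, f y ∂(M.stepKernel π (x t))) ∂(M.trajectoryLaw π s) := by
  have h := Kernel.map_frestrictLe_trajMeasure_compProd_eq_map_trajMeasure
    (X := fun _ => S × Act) (κ := M.historyKernel π) (μ₀ := (Measure.dirac s) ⊗ₘ π.kernel) (a := t)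
  have hm : Measurable (fun x : (ℕ → S × Act) => (Preorder.frestrictLe t x, x (t + 1))) := by
    fun_prop
  have h1 : ∫ x, f (x (t + 1)) ∂(M.trajectoryLaw π s) =
      ∫ p, f p.2 ∂((M.trajectoryLaw π s).map
        (fun x => (Preorder.frestrictLe (π := fun _ => S × Act) t x, x (t + 1)))) := by
    rw [integral_map hm.aemeasurable]
    exact (hf.comp measurable_snd).aestronglyMeasurable
  rw [h1]
  unfold trajectoryLaw
  rw [← h]
  have : IsProbabilityMeasure ((Kernel.trajMeasure (X := fun _ => S × Act)
      ((Measure.dirac s) ⊗ₘ π.kernel) (M.historyKernel π)).map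
        (Preorder.frestrictLe (π := fun _ => S × Act) t)) :=
    Measure.isProbabilityMeasure_map (by fun_prop)
  rw [Measure.integral_compProd, integral_map (by fun_prop)]
  · rfl
  · exact (StronglyMeasurable.integral_kernel (κ := M.historyKernel π t)
      hf.stronglyMeasurable).aestronglyMeasurable
  · exact integrable_of_mem_Icc (hf.comp measurable_snd) fun x => hb x.2

lemma integral_trajectoryLaw_zero (M : MDP S Act) (π : Policy S Act) (s : S)
    {f : S × Act → ℝ} (hf : Measurable f) {a b : ℝ} (hb : ∀ x, f x ∈ Set.Icc a b) :
    ∫ x, f (x 0) ∂(M.trajectoryLaw π s) = ∫ a, f (s, a) ∂(π.kernel s) := by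
  have hmap : (M.trajectoryLaw π s).map (fun x => x 0) = (Measure.dirac s) ⊗ₘ π.kernel := by
    have hm : (Kernel.traj (X := fun _ => S × Act) (M.historyKernel π) 0).map
        (fun x => x 0) = Kernel.deterministic
          (fun h : (∀ _ : Finset.Iic 0, S × Act) => h ⟨0, Finset.mem_Iic.2 le_rfl⟩)
          (measurable_pi_apply _) := by
      have h1 := Kernel.traj_map_frestrictLe (X := fun _ => S × Act) (κ := M.historyKernel π) 0 0
      rw [Kernel.partialTraj_self] at h1
      have h2 := congrArg (fun k => Kernel.map k
        (fun h : (∀ _ : Finset.Iic 0, S × Act) => h ⟨0, Finset.mem_Iic.2 le_rfl⟩)) h1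
      rw [← Kernel.map_comp_right _ (by fun_prop) (by fun_prop)] at h2
      rw [show (fun x : ℕ → S × Act => x 0) =
        (fun h : (∀ _ : Finset.Iic 0, S × Act) => h ⟨0, Finset.mem_Iic.2 le_rfl⟩) ∘
          (Preorder.frestrictLe (π := fun _ => S × Act) 0) from rfl, h2,
        Kernel.id_map (by fun_prop)]
    unfold trajectoryLaw Kernel.trajMeasure
    rw [Measure.map_comp _ _ (by fun_prop), hm, Measure.deterministic_comp_eq_map,
      Measure.map_map (by fun_prop) (by fun_prop)]
    exact Measure.map_id
  calc ∫ x, f (x 0) ∂(M.trajectoryLaw π s)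
      = ∫ p, f p ∂((M.trajectoryLaw π s).map (fun x => x 0)) := by
        rw [integral_map (measurable_pi_apply 0).aemeasurable hf.aestronglyMeasurable]
    _ = _ := by
      rw [hmap, Measure.integral_compProd (integrable_of_mem_Icc hf hb), integral_dirac']
      exact (StronglyMeasurable.integral_kernel_prod_right' (κ := π.kernel)
        hf.stronglyMeasurable)

/-- Each induction step trades one time step of the trajectory for one more step in `expReward`; for
this reason `j` is kept general. -/
lemma integral_expReward_trajectoryLaw (M : MDP S Act) (π : Policy S Act) (s : S) (t j : ℕ) :
    ∫ x, M.expReward π j (x t) ∂(M.trajectoryLaw π s) =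
      ∫ a, M.expReward π (t + j) (s, a) ∂(π.kernel s) := by
  induction t generalizing j with
  | zero =>
    rw [zero_add]
    exact M.integral_trajectoryLaw_zero π s (M.measurable_expReward π j) (M.expReward_mem π j)
  | succ t ih =>
    rw [M.integral_trajectoryLaw_succ π s t (M.measurable_expReward π j) (M.expReward_mem π j),
      show t + 1 + j = t + (j + 1) by ring]
    exact ih (j + 1)

/-! ### Discounted series of sequences in the unit interval -/

lemma summable_disc (M : MDP S Act) {c : ℕ → ℝ} (hc : ∀ t, c t ∈ Set.Icc (0 : ℝ) 1) :
    Summable fun t => M.γ ^ t * c t :=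
  Summable.of_nonneg_of_le
    (fun t => mul_nonneg (pow_nonneg M.γ_nonneg t) (hc t).1)
    (fun t => mul_le_of_le_one_right (pow_nonneg M.γ_nonneg t) (hc t).2)
    (summable_geometric_of_lt_one M.γ_nonneg M.γ_lt_one)

lemma integral_disc_tsum (M : MDP S Act) {X : Type*} [MeasurableSpace X] (μ : Measure X)
    [IsProbabilityMeasure μ] {c : ℕ → X → ℝ} (hm : ∀ t, Measurable (c t))
    (hc : ∀ t x, c t x ∈ Set.Icc (0 : ℝ) 1) :
    ∫ x, ∑' t, M.γ ^ t * c t x ∂μ = ∑' t, M.γ ^ t * ∫ x, c t x ∂μ := by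
  rw [← integral_tsum_of_summable_integral_norm]
  · exact tsum_congr fun t => integral_const_mul _ _
  · exact fun t => (integrable_of_mem_Icc (hm t) (hc t)).const_mul _
  · have : ∀ t, ∫ x, ‖M.γ ^ t * c t x‖ ∂μ = M.γ ^ t * ∫ x, c t x ∂μ := by
      intro t
      rw [← integral_const_mul]
      refine integral_congr_ae (Filter.Eventually.of_forall fun x => ?_)
      exact Real.norm_of_nonneg (mul_nonneg (pow_nonneg M.γ_nonneg t) (hc t x).1)
    simp_rw [this]
    exact M.summable_disc fun t => integral_mem_Icc (hm t) (hc t)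

lemma measurable_disc_tsum (M : MDP S Act) {X : Type*} [MeasurableSpace X] {c : ℕ → X → ℝ}
    (hm : ∀ t, Measurable (c t)) (hc : ∀ t x, c t x ∈ Set.Icc (0 : ℝ) 1) :
    Measurable fun x => ∑' t, M.γ ^ t * c t x := by
  refine measurable_of_tendsto_metrizable
    (f := fun n x => ∑ t ∈ Finset.range n, M.γ ^ t * c t x) (fun n => ?_) ?_
  · exact Finset.measurable_fun_sum _ fun t _ => (hm t).const_mul _
  · rw [tendsto_pi_nhds]
    exact fun x => (M.summable_disc fun t => hc t x).hasSum.tendsto_sum_nat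

lemma one_sub_pos (M : MDP S Act) : 0 < 1 - M.γ := sub_pos.2 M.γ_lt_one

lemma disc_tsum_mem (M : MDP S Act) {c : ℕ → ℝ} (hc : ∀ t, c t ∈ Set.Icc (0 : ℝ) 1) :
    ∑' t, M.γ ^ t * c t ∈ Set.Icc (0 : ℝ) (1 / (1 - M.γ)) := by
  refine ⟨tsum_nonneg fun t => mul_nonneg (pow_nonneg M.γ_nonneg t) (hc t).1, ?_⟩
  rw [one_div, ← tsum_geometric_of_lt_one M.γ_nonneg M.γ_lt_one]
  exact (M.summable_disc hc).tsum_le_tsum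
    (fun t => mul_le_of_le_one_right (pow_nonneg M.γ_nonneg t) (hc t).2)
    (summable_geometric_of_lt_one M.γ_nonneg M.γ_lt_one)

/-- Expected discounted reward from a state-action pair. -/
def pairValue (M : MDP S Act) (π : Policy S Act) (x : S × Act) : ℝ :=
  ∑' t, M.γ ^ t * M.expReward π t x

lemma measurable_pairValue (M : MDP S Act) (π : Policy S Act) : Measurable (M.pairValue π) :=
  M.measurable_disc_tsum (M.measurable_expReward π) (M.expReward_mem π)

lemma pairValue_mem (M : MDP S Act) (π : Policy S Act) (x : S × Act) :
    M.pairValue π x ∈ Set.Icc (0 : ℝ) (1 / (1 - M.γ)) :=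
  M.disc_tsum_mem fun t => M.expReward_mem π t x

lemma measurable_discountedReturn (M : MDP S Act) : Measurable M.discountedReturn :=
  M.measurable_disc_tsum (c := fun t (x : ℕ → S × Act) => M.r (x t))
    (fun t => M.measurable_r.comp (measurable_pi_apply t)) fun t x => M.r_mem (x t)

lemma discountedReturn_mem (M : MDP S Act) (x : ℕ → S × Act) :
    M.discountedReturn x ∈ Set.Icc (0 : ℝ) (1 / (1 - M.γ)) :=
  M.disc_tsum_mem fun t => M.r_mem (x t)

/-- Bridge from the path-space definition of the value to the recursive one; geometric domination
allows the exchange of sum and integral. -/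
lemma value_eq_integral_pairValue (M : MDP S Act) (π : Policy S Act) (s : S) :
    M.value π s = ∫ a, M.pairValue π (s, a) ∂(π.kernel s) := by
  unfold value discountedReturn
  rw [M.integral_disc_tsum (M.trajectoryLaw π s) (c := fun t (x : ℕ → S × Act) => M.r (x t))
    (fun t => M.measurable_r.comp (measurable_pi_apply t)) fun t x => M.r_mem (x t)]
  unfold pairValue
  rw [M.integral_disc_tsum (π.kernel s) (c := fun t a => M.expReward π t (s, a))
    (fun t => (M.measurable_expReward π t).comp measurable_prodMk_left)
    fun t a => M.expReward_mem π t (s, a)]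
  exact tsum_congr fun t => by
    congr 1
    exact M.integral_expReward_trajectoryLaw π s t 0

lemma measurable_value (M : MDP S Act) (π : Policy S Act) : Measurable (M.value π) := by
  have : M.value π = fun s => ∫ a, M.pairValue π (s, a) ∂(π.kernel s) :=
    funext (M.value_eq_integral_pairValue π)
  rw [this]
  exact (StronglyMeasurable.integral_kernel_prod_right' (κ := π.kernel)
    (M.measurable_pairValue π).stronglyMeasurable).measurable

lemma value_mem (M : MDP S Act) (π : Policy S Act) (s : S) :
    M.value π s ∈ Set.Icc (0 : ℝ) (1 / (1 - M.γ)) :=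
  integral_mem_Icc M.measurable_discountedReturn M.discountedReturn_mem

lemma integral_stepKernel (M : MDP S Act) (π : Policy S Act) (x : S × Act)
    {f : S × Act → ℝ} {a b : ℝ} (hf : Measurable f) (hb : ∀ x, f x ∈ Set.Icc a b) :
    ∫ y, f y ∂(M.stepKernel π x) = ∫ s, ∫ a, f (s, a) ∂(π.kernel s) ∂(M.P x) := by
  unfold stepKernel
  rw [ProbabilityTheory.integral_compProd (integrable_of_mem_Icc hf hb)]
  rfl

/-- Splitting off the term at time 0 leaves `γ` times the same series after one step. Measurability
and range of `qvalue` are then inherited from `pairValue`. -/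
lemma pairValue_eq_qvalue (M : MDP S Act) (π : Policy S Act) (s : S) (a : Act) :
    M.pairValue π (s, a) = M.qvalue π s a := by
  unfold qvalue
  have h1 : ∫ y, M.value π y ∂(M.P (s, a)) =
      ∫ y, M.pairValue π y ∂(M.stepKernel π (s, a)) := by
    rw [M.integral_stepKernel π _ (M.measurable_pairValue π) (M.pairValue_mem π)]
    simp_rw [value_eq_integral_pairValue]
  rw [h1]
  unfold pairValue
  rw [M.integral_disc_tsum _ (M.measurable_expReward π) (M.expReward_mem π),
    (M.summable_disc fun t => M.expReward_mem π t (s, a)).tsum_eq_zero_add, ← tsum_mul_left]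
  congr 1
  · simp [expReward]
  · exact tsum_congr fun t => by rw [pow_succ, mul_comm (M.γ ^ t), mul_assoc]; rfl

lemma measurable_qvalue (M : MDP S Act) (π : Policy S Act) :
    Measurable fun x : S × Act => M.qvalue π x.1 x.2 := by
  have : (fun x : S × Act => M.qvalue π x.1 x.2) = M.pairValue π :=
    funext fun x => (M.pairValue_eq_qvalue π x.1 x.2).symm
  rw [this]
  exact M.measurable_pairValue π

lemma qvalue_mem (M : MDP S Act) (π : Policy S Act) (s : S) (a : Act) :
    M.qvalue π s a ∈ Set.Icc (0 : ℝ) (1 / (1 - M.γ)) :=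
  M.pairValue_eq_qvalue π s a ▸ M.pairValue_mem π (s, a)

/-- The Bellman equation. -/
lemma value_eq_integral_qvalue (M : MDP S Act) (π : Policy S Act) (s : S) :
    M.value π s = ∫ a, M.qvalue π s a ∂(π.kernel s) := by
  rw [value_eq_integral_pairValue]
  simp_rw [pairValue_eq_qvalue]

lemma mixtureValue_eq (M : MDP S Act) (l : List (Policy S Act)) (s : S) :
    M.mixtureValue l s = (l.length : ℝ)⁻¹ * (l.map fun π => M.value π s).sum := by
  unfold mixtureValue mixtureLaw
  rw [integral_smul_measure]
  simp only [ENNReal.toReal_inv, ENNReal.toReal_natCast, smul_eq_mul]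
  congr 1
  -- Integrability against the sum of the laws needs its finiteness, so both facts go through one
  -- induction.
  have : ∀ l : List (Policy S Act), IsFiniteMeasure (l.map fun π => M.trajectoryLaw π s).sum ∧
      ∫ x, M.discountedReturn x ∂(l.map fun π => M.trajectoryLaw π s).sum =
        (l.map fun π => M.value π s).sum := by
    intro l
    induction l with
    | nil =>
      simp only [List.map_nil, List.sum_nil]
      exact ⟨inferInstance, by simp⟩
    | cons π l ih =>
      obtain ⟨h1, h2⟩ := ih
      simp only [List.map_cons, List.sum_cons]
      refine ⟨inferInstance, ?_⟩
      rw [integral_add_measure, h2]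
      · rfl
      · exact integrable_of_mem_Icc M.measurable_discountedReturn M.discountedReturn_mem
      · exact integrable_of_mem_Icc M.measurable_discountedReturn M.discountedReturn_mem
  exact (this l).2

end MDP

/-! ### Truncated returns -/

namespace MDP

variable {S : Type u} [MeasurableSpace S] {Act : Type v} [MeasurableSpace Act]

/-- Law of the discounted sum of the first `h` rewards, started from a state-action pair. -/
def returnLaw (M : MDP S Act) (π : Policy S Act) : ℕ → Kernel (S × Act) ℝ
  | 0 => Kernel.const _ (Measure.dirac 0)
  | h + 1 => (Kernel.id ×ₖ (M.returnLaw π h ∘ₖ M.stepKernel π)).map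
      fun p : (S × Act) × ℝ => M.r p.1 + M.γ * p.2

lemma measurable_returnStep (M : MDP S Act) :
    Measurable fun p : (S × Act) × ℝ => M.r p.1 + M.γ * p.2 :=
  (M.measurable_r.comp measurable_fst).add (measurable_snd.const_mul _)

instance (M : MDP S Act) (π : Policy S Act) (h : ℕ) : IsMarkovKernel (M.returnLaw π h) := by
  induction h with
  | zero => unfold returnLaw; infer_instance
  | succ h ih => unfold returnLaw; exact Kernel.IsMarkovKernel.map _ M.measurable_returnStep

lemma returnLaw_succ_apply (M : MDP S Act) (π : Policy S Act) (h : ℕ) (x : S × Act) :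
    M.returnLaw π (h + 1) x =
      ((M.returnLaw π h ∘ₖ M.stepKernel π) x).map fun u => M.r x + M.γ * u := by
  rw [returnLaw, Kernel.map_apply _ M.measurable_returnStep, Kernel.prod_apply, Kernel.id_apply,
    Measure.dirac_prod, Measure.map_map M.measurable_returnStep (by fun_prop)]
  rfl

/-- The integrals appear in the order in which a rollout draws: next state, action, remaining
return. This is the form that is matched with the program. -/
lemma lintegral_returnLaw_succ (M : MDP S Act) (π : Policy S Act) (h : ℕ) (x : S × Act)
    {f : ℝ → ℝ≥0∞} (hf : Measurable f) :
    ∫⁻ u, f u ∂(M.returnLaw π (h + 1) x) =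
      ∫⁻ y, ∫⁻ a, ∫⁻ u, f (M.r x + M.γ * u) ∂(M.returnLaw π h (y, a)) ∂(π.kernel y) ∂(M.P x) := by
  rw [returnLaw_succ_apply, lintegral_map hf (by fun_prop)]
  have hf' : Measurable fun u => f (M.r x + M.γ * u) := hf.comp (by fun_prop)
  rw [Kernel.lintegral_comp _ _ _ hf']
  unfold stepKernel
  rw [Kernel.lintegral_compProd _ _ _ hf'.lintegral_kernel]
  rfl

/-- The interval is invariant under `u ↦ r + γ u` because `1 + γ/(1-γ) = 1/(1-γ)`; this gives one
range for all lengths. -/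
lemma returnLaw_mem (M : MDP S Act) (π : Policy S Act) (h : ℕ) (x : S × Act) :
    ∀ᵐ u ∂(M.returnLaw π h x), u ∈ Set.Icc (0 : ℝ) (1 / (1 - M.γ)) := by
  have hB : (1 : ℝ) + M.γ * (1 / (1 - M.γ)) = 1 / (1 - M.γ) := by
    have := M.one_sub_pos
    field_simp
    ring
  induction h generalizing x with
  | zero =>
    simp only [returnLaw, Kernel.const_apply]
    refine (ae_dirac_iff (p := fun u : ℝ => u ∈ Set.Icc (0 : ℝ) (1 / (1 - M.γ)))
      measurableSet_Icc).2 ?_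
    exact ⟨le_rfl, (one_div_pos.2 M.one_sub_pos).le⟩
  | succ h ih =>
    rw [returnLaw_succ_apply]
    refine (ae_map_iff (p := fun u : ℝ => u ∈ Set.Icc (0 : ℝ) (1 / (1 - M.γ)))
      (by fun_prop) measurableSet_Icc).2 ?_
    have h1 : ∀ᵐ u ∂((M.returnLaw π h ∘ₖ M.stepKernel π) x),
        u ∈ Set.Icc (0 : ℝ) (1 / (1 - M.γ)) := by
      rw [ae_iff, ← Set.compl_def,
        Kernel.comp_apply' _ _ _ measurableSet_Icc.compl]
      simp only [lintegral_eq_zero_iff (Kernel.measurable_coe _ measurableSet_Icc.compl)]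
      exact Filter.Eventually.of_forall fun y => ih y
    filter_upwards [h1] with u hu
    obtain ⟨r0, r1⟩ := M.r_mem x
    refine ⟨add_nonneg r0 (mul_nonneg M.γ_nonneg hu.1), ?_⟩
    calc M.r x + M.γ * u ≤ 1 + M.γ * (1 / (1 - M.γ)) :=
          add_le_add r1 (mul_le_mul_of_nonneg_left hu.2 M.γ_nonneg)
      _ = _ := hB

/-- Expected discounted sum of the first `h` rewards. -/
def meanReturn (M : MDP S Act) (π : Policy S Act) (h : ℕ) (x : S × Act) : ℝ :=
  ∫ u, u ∂(M.returnLaw π h x)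

lemma measurable_meanReturn (M : MDP S Act) (π : Policy S Act) (h : ℕ) :
    Measurable (M.meanReturn π h) :=
  (StronglyMeasurable.integral_kernel (κ := M.returnLaw π h)
    (f := fun u : ℝ => u) measurable_id.stronglyMeasurable).measurable

lemma integrable_returnLaw (M : MDP S Act) (π : Policy S Act) (h : ℕ) (x : S × Act) :
    Integrable (fun u => u) (M.returnLaw π h x) :=
  Integrable.of_mem_Icc 0 (1 / (1 - M.γ)) aemeasurable_id (M.returnLaw_mem π h x)

lemma meanReturn_mem (M : MDP S Act) (π : Policy S Act) (h : ℕ) (x : S × Act) :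
    M.meanReturn π h x ∈ Set.Icc (0 : ℝ) (1 / (1 - M.γ)) := by
  have hi := M.integrable_returnLaw π h x
  have hm := M.returnLaw_mem π h x
  constructor
  · exact integral_nonneg_of_ae (hm.mono fun u hu => hu.1)
  · have := integral_mono_ae hi (integrable_const (1 / (1 - M.γ))) (hm.mono fun u hu => hu.2)
    simpa [meanReturn] using this

lemma meanReturn_succ (M : MDP S Act) (π : Policy S Act) (h : ℕ) (x : S × Act) :
    M.meanReturn π (h + 1) x = M.r x + M.γ * ∫ y, M.meanReturn π h y ∂(M.stepKernel π x) := by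
  have h1 : ∀ᵐ u ∂((M.returnLaw π h ∘ₖ M.stepKernel π) x),
      u ∈ Set.Icc (0 : ℝ) (1 / (1 - M.γ)) := by
    rw [ae_iff, ← Set.compl_def, Kernel.comp_apply' _ _ _ measurableSet_Icc.compl]
    simp only [lintegral_eq_zero_iff (Kernel.measurable_coe _ measurableSet_Icc.compl)]
    exact Filter.Eventually.of_forall fun y => M.returnLaw_mem π h y
  have hi : Integrable (fun u : ℝ => u) ((M.returnLaw π h ∘ₖ M.stepKernel π) x) :=
    Integrable.of_mem_Icc 0 (1 / (1 - M.γ)) aemeasurable_id h1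
  unfold meanReturn
  rw [returnLaw_succ_apply, integral_map (by fun_prop) (by fun_prop),
    integral_add (integrable_const _) (hi.const_mul _), integral_const_mul, Kernel.integral_comp hi]
  simp

/-- Both sides obey the same one-step recursion, so the difference shrinks by `γ` per reward,
starting from the a priori bound on values. -/
lemma abs_meanReturn_sub_pairValue_le (M : MDP S Act) (π : Policy S Act) (h : ℕ) (x : S × Act) :
    |M.meanReturn π h x - M.pairValue π x| ≤ M.γ ^ h / (1 - M.γ) := by
  induction h generalizing x with
  | zero =>
    have h0 : M.meanReturn π 0 x = 0 := by simp [meanReturn, returnLaw]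
    have := M.pairValue_mem π x
    rw [h0, zero_sub, abs_neg, abs_of_nonneg this.1, pow_zero]
    exact this.2
  | succ h ih =>
    have hQ : M.pairValue π x = M.r x + M.γ * ∫ y, M.pairValue π y ∂(M.stepKernel π x) := by
      obtain ⟨s, a⟩ := x
      rw [pairValue_eq_qvalue, qvalue,
        M.integral_stepKernel π _ (M.measurable_pairValue π) (M.pairValue_mem π)]
      simp_rw [value_eq_integral_pairValue]
    rw [meanReturn_succ, hQ, add_sub_add_left_eq_sub, ← mul_sub,
      ← integral_sub (integrable_of_mem_Icc (M.measurable_meanReturn π h) (M.meanReturn_mem π h))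
        (integrable_of_mem_Icc (M.measurable_pairValue π) (M.pairValue_mem π)),
      abs_mul, abs_of_nonneg M.γ_nonneg, pow_succ, mul_comm (M.γ ^ h), mul_div_assoc]
    refine mul_le_mul_of_nonneg_left ?_ M.γ_nonneg
    have := norm_integral_le_of_norm_le_const (μ := M.stepKernel π x)
      (f := fun y => M.meanReturn π h y - M.pairValue π y)
      (Filter.Eventually.of_forall ih)
    simpa using this

end MDP

/-! ### Concentration of sums of independent bounded variables -/

/-- Law of the sum of `k` independent variables with law `ν`. -/
def sumLaw (ν : Measure ℝ) : ℕ → Measure ℝ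
  | 0 => Measure.dirac 0
  | k + 1 => (ν.prod (sumLaw ν k)).map fun p => p.1 + p.2

instance (ν : Measure ℝ) [IsProbabilityMeasure ν] (k : ℕ) : IsProbabilityMeasure (sumLaw ν k) := by
  induction k with
  | zero => unfold sumLaw; infer_instance
  | succ k ih => unfold sumLaw; exact Measure.isProbabilityMeasure_map (by fun_prop)

lemma lintegral_sumLaw_succ (ν : Measure ℝ) [IsProbabilityMeasure ν] (k : ℕ) {f : ℝ → ℝ≥0∞}
    (hf : Measurable f) :
    ∫⁻ u, f u ∂(sumLaw ν (k + 1)) = ∫⁻ x, ∫⁻ u, f (x + u) ∂(sumLaw ν k) ∂ν := by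
  rw [sumLaw, lintegral_map hf (by fun_prop),
    lintegral_prod (fun p : ℝ × ℝ => f (p.1 + p.2)) (hf.comp (by fun_prop)).aemeasurable]

lemma hasSubgaussianMGF_map_iff {Ω : Type*} [MeasurableSpace Ω] {P : Measure Ω} {f : Ω → ℝ}
    {g : ℝ → ℝ} {c : NNReal} (hf : Measurable f) (hg : Measurable g) :
    HasSubgaussianMGF g c (P.map f) ↔ HasSubgaussianMGF (g ∘ f) c P := by
  rw [← HasSubgaussianMGF.id_map_iff hg.aemeasurable, Measure.map_map hg hf,
    HasSubgaussianMGF.id_map_iff (hg.comp hf).aemeasurable]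

/-- Hoeffding's lemma gives the variance proxy `(B/2)²` for one summand; proxies of independent
summands add up. -/
lemma hasSubgaussianMGF_sumLaw (ν : Measure ℝ) [IsProbabilityMeasure ν] {B : ℝ}
    (hν : ∀ᵐ u ∂ν, u ∈ Set.Icc 0 B) (k : ℕ) :
    HasSubgaussianMGF (fun u => u - k * ∫ x, x ∂ν) (k * (‖B - 0‖₊ / 2) ^ 2) (sumLaw ν k) := by
  induction k with
  | zero =>
    simp only [Nat.cast_zero, zero_mul, sub_zero, sumLaw]
    have := (hasSubgaussianMGF_map_iff (P := Measure.dirac (0 : ℝ)) (f := fun _ => (0 : ℝ))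
      (g := fun u => u) (c := 0) measurable_const measurable_id).2 HasSubgaussianMGF.fun_zero
    simpa using this
  | succ k ih =>
    rw [sumLaw, hasSubgaussianMGF_map_iff (by fun_prop) (by fun_prop)]
    have h1 : HasSubgaussianMGF (fun u => u - ∫ x, x ∂ν) ((‖B - 0‖₊ / 2) ^ 2) ν :=
      hasSubgaussianMGF_of_mem_Icc aemeasurable_id hν
    have h2 : HasSubgaussianMGF ((fun u => u - ∫ x, x ∂ν) ∘ Prod.fst) ((‖B - 0‖₊ / 2) ^ 2)
        (ν.prod (sumLaw ν k)) := by
      rw [← hasSubgaussianMGF_map_iff measurable_fst (by fun_prop), Measure.map_fst_prod]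
      simpa using h1
    have h3 : HasSubgaussianMGF ((fun u => u - k * ∫ x, x ∂ν) ∘ Prod.snd)
        (k * (‖B - 0‖₊ / 2) ^ 2) (ν.prod (sumLaw ν k)) := by
      rw [← hasSubgaussianMGF_map_iff measurable_snd (by fun_prop), Measure.map_snd_prod]
      simpa using ih
    have h4 := h2.add_of_indepFun h3 (indepFun_prod (X := fun u => u - ∫ x, x ∂ν)
      (Y := fun u => u - k * ∫ x, x ∂ν) (by fun_prop) (by fun_prop))
    convert h4 using 1
    · ext p
      simp only [Function.comp_apply]
      push_cast
      ring
    · push_cast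
      ring

/-- Two-sided Hoeffding inequality, stated as a lower bound because only lower bounds on success are
propagated through programs. -/
lemma sumLaw_average_ge (ν : Measure ℝ) [IsProbabilityMeasure ν] {B : ℝ} (hB : 0 < B)
    (hν : ∀ᵐ u ∂ν, u ∈ Set.Icc 0 B) {n : ℕ} (hn : 0 < n) {θ : ℝ} (hθ : 0 ≤ θ) :
    ENNReal.ofReal (1 - 2 * Real.exp (-(2 * n * θ ^ 2 / B ^ 2))) ≤
      sumLaw ν n {u | |u / n - ∫ x, x ∂ν| ≤ θ} := by
  set μ := ∫ x, x ∂ν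
  have hn' : (0 : ℝ) < n := by exact_mod_cast hn
  have hG := hasSubgaussianMGF_sumLaw ν hν n
  have e : -(n * θ) ^ 2 / (2 * ((n * (‖B - 0‖₊ / 2) ^ 2 : NNReal) : ℝ)) =
      -(2 * n * θ ^ 2 / B ^ 2) := by
    push_cast
    rw [sub_zero, Real.norm_of_nonneg hB.le]
    field_simp
  have u1 := hG.measure_ge_le (ε := n * θ) (by positivity)
  have u2 := hG.neg.measure_ge_le (ε := n * θ) (by positivity)
  rw [e] at u1 u2
  have hmeas : MeasurableSet {u : ℝ | |u / n - μ| ≤ θ} :=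
    measurableSet_le (by fun_prop) measurable_const
  have hc : (sumLaw ν n).real {u : ℝ | |u / n - μ| ≤ θ}ᶜ ≤
      2 * Real.exp (-(2 * n * θ ^ 2 / B ^ 2)) := by
    calc (sumLaw ν n).real {u : ℝ | |u / n - μ| ≤ θ}ᶜ
        ≤ (sumLaw ν n).real
            ({u | n * θ ≤ u - n * μ} ∪ {u | n * θ ≤ (-fun u : ℝ => u - n * μ) u}) := by
          refine measureReal_mono ?_
          intro u hu
          simp only [Set.mem_compl_iff, Set.mem_ofPred_eq, not_le] at hu
          have hu' : u / n - μ = (u - n * μ) / n := by field_simp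
          rw [hu', abs_div, abs_of_pos hn', lt_div_iff₀ hn', lt_abs] at hu
          rcases hu with hu | hu
          · left; simp only [Set.mem_ofPred_eq]; linarith
          · right; simp only [Set.mem_ofPred_eq, Pi.neg_apply]; linarith
      _ ≤ _ := measureReal_union_le _ _
      _ ≤ _ := by linarith
  rw [probReal_compl_eq_one_sub hmeas] at hc
  rw [← ofReal_measureReal]
  exact ENNReal.ofReal_le_ofReal (by linarith)

/-! ### Expectations of programs -/

namespace Prog

variable {S : Type u} [MeasurableSpace S] {Act : Type v} [MeasurableSpace Act]
  (M : MDP S Act) (π₀ : Policy S Act)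

lemma expect_mono {α : Type w} (p : Prog S Act α) {f g : α → ℝ≥0∞} (h : ∀ x, f x ≤ g x) :
    p.expect M π₀ f ≤ p.expect M π₀ g := by
  induction p with
  | ret x => exact h x
  | work c p ih => exact ih
  | query s a k ih => exact lintegral_mono fun y => ih y _
  | draw n w k ih => exact Finset.sum_le_sum fun i _ => mul_le_mul_right (ih i) _
  | initial s k ih => exact lintegral_mono fun a => ih a

lemma expect_bind {α : Type w₁} {β : Type w₂} (p : Prog S Act α) (k : α → Prog S Act β)
    (f : β → ℝ≥0∞) :
    (p.bind k).expect M π₀ f = p.expect M π₀ fun x => (k x).expect M π₀ f := by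
  induction p with
  | ret x => rfl
  | work c p ih => exact ih
  | query s a k ih => exact lintegral_congr fun y => ih y _
  | draw n w k ih => exact Finset.sum_congr rfl fun i _ => congrArg _ (ih i)
  | initial s k ih => exact lintegral_congr fun a => ih a

/-- The lower integral obeys this one-sided rule for any integrand, measurable or not. -/
lemma const_mul_expect_le {α : Type w} (p : Prog S Act α) (c : ℝ≥0∞) (f : α → ℝ≥0∞) :
    c * p.expect M π₀ f ≤ p.expect M π₀ fun x => c * f x := by
  induction p with
  | ret x => exact le_rfl
  | work c p ih => exact ih
  | query s a k ih =>
    exact (lintegral_const_mul_le _ _).trans (lintegral_mono fun y => ih y _)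
  | draw n w k ih =>
    simp only [expect, Finset.mul_sum]
    refine Finset.sum_le_sum fun i _ => ?_
    rw [mul_left_comm]
    exact mul_le_mul_right (ih i) _
  | initial s k ih => exact (lintegral_const_mul_le _ _).trans (lintegral_mono fun a => ih a)

/-- Superadditivity of the lower integral. It serves to combine two events in
`prob_rollout_accurate₂_ge`. -/
lemma expect_add_le {α : Type w} (p : Prog S Act α) (f g : α → ℝ≥0∞) :
    p.expect M π₀ f + p.expect M π₀ g ≤ p.expect M π₀ fun x => f x + g x := by
  induction p with
  | ret x => exact le_rfl
  | work c p ih => exact ih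
  | query s a k ih => exact (le_lintegral_add _ _).trans (lintegral_mono fun y => ih y _)
  | draw n w k ih =>
    simp only [expect, ← Finset.sum_add_distrib, ← mul_add]
    exact Finset.sum_le_sum fun i _ => mul_le_mul_right (ih i) _
  | initial s k ih => exact (le_lintegral_add _ _).trans (lintegral_mono fun a => ih a)

/-- If the output of `p` is good with probability at least `1 - x` and the continuation succeeds
with probability at least `1 - y` after a good output, then the composition succeeds with
probability at least `1 - x - y`. -/
lemma prob_bind_ge {α : Type w₁} {β : Type w₂} {p : Prog S Act α} {k : α → Prog S Act β}
    {G : Set α} {E : Set β} {x y : ℝ} (hx : 0 ≤ x) (hy : 0 ≤ y)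
    (hp : ENNReal.ofReal (1 - x) ≤ p.prob M π₀ G)
    (hk : ∀ z ∈ G, ENNReal.ofReal (1 - y) ≤ (k z).prob M π₀ E) :
    ENNReal.ofReal (1 - (x + y)) ≤ (p.bind k).prob M π₀ E := by
  -- For `y ≥ 1` the claim is empty, since `ENNReal.ofReal` sends nonpositive numbers to 0.
  -- Otherwise the product `(1 - y)(1 - x)` dominates `1 - x - y`.
  rcases le_or_gt 1 y with h1 | h1
  · rw [ENNReal.ofReal_of_nonpos (by linarith)]
    exact zero_le
  unfold prob
  rw [expect_bind]
  calc ENNReal.ofReal (1 - (x + y)) ≤ ENNReal.ofReal ((1 - y) * (1 - x)) :=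
        ENNReal.ofReal_le_ofReal (by nlinarith)
    _ = ENNReal.ofReal (1 - y) * ENNReal.ofReal (1 - x) := ENNReal.ofReal_mul (by linarith)
    _ ≤ ENNReal.ofReal (1 - y) * p.expect M π₀ (G.indicator 1) := mul_le_mul_right hp _
    _ ≤ p.expect M π₀ fun z => ENNReal.ofReal (1 - y) * G.indicator 1 z :=
        const_mul_expect_le M π₀ p _ _
    _ ≤ _ := by
      refine expect_mono M π₀ p fun z => ?_
      by_cases hz : z ∈ G
      · simpa [hz, prob] using hk z hz
      · simp [hz]

/-- The total mass of the output law of a program is at most one. -/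
def SubUnital {α : Type w} (p : Prog S Act α) : Prop :=
  ∀ f : α → ℝ≥0∞, p.expect M π₀ (fun x => f x + 1) ≤ p.expect M π₀ f + 1

variable {M π₀}

/-- The definition quantifies over all test functions, so the constant 1 can be moved out of the
inner program first and out of the outer one afterwards. Only a constant is ever added, so
measurability plays no role. -/
lemma SubUnital.bind {α : Type w₁} {β : Type w₂} {p : Prog S Act α} {k : α → Prog S Act β}
    (hp : p.SubUnital M π₀) (hk : ∀ x, (k x).SubUnital M π₀) : (p.bind k).SubUnital M π₀ := by
  intro f
  rw [expect_bind, expect_bind]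
  exact (expect_mono M π₀ p fun x => hk x f).trans (hp _)

lemma SubUnital.exec {α : Type w} (x : Timed α) :
    (Prog.exec x : Prog S Act α).SubUnital M π₀ := fun _ => le_rfl

lemma SubUnital.ret {α : Type w} (x : α) : (Prog.ret x : Prog S Act α).SubUnital M π₀ :=
  fun _ => le_rfl

lemma lintegral_add_one_le {X : Type*} [MeasurableSpace X] {μ : Measure X} [IsProbabilityMeasure μ]
    {F G : X → ℝ≥0∞} (h : ∀ x, F x ≤ G x + 1) : ∫⁻ x, F x ∂μ ≤ ∫⁻ x, G x ∂μ + 1 := by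
  refine (lintegral_mono h).trans ?_
  rw [lintegral_add_right _ measurable_const]
  simp

lemma SubUnital.query {α : Type w} {s : S} {a : Act} {k : S → ℝ → Prog S Act α}
    (hk : ∀ y r, (k y r).SubUnital M π₀) : (Prog.query s a k).SubUnital M π₀ :=
  fun f => lintegral_add_one_le fun y => hk y _ f

end Prog

/-! ### Sampling from the policies of the algorithm -/

section Sampling

variable {S : Type u} [MeasurableSpace S] {m d : ℕ} {N : Fin m → ℕ}

/-- Unnormalized softmax weights of one component. -/
def componentWeight (I : Input S d N) (W : Fin d → ℝ) (s : S) (i : Fin m) (c : Fin (N i)) : ℝ :=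
  Real.exp (I.temp * (W ⬝ᵥ I.feat.φ i s c))

/-- Draw one component of a joint action. -/
def sampleComponent (I : Input S d N) (W : Fin d → ℝ) (s : S) (i : Fin m) (a : Joint N) :
    Prog S (Joint N) (Joint N) :=
  (Prog.exec (Timed.tabulate fun c : Fin (N i) =>
    (Timed.tabulate fun l => Timed.read (I.feat.φ i s c l)).bind fun x =>
    (Timed.dot W x).bind fun y =>
    (Timed.mul I.temp y).bind fun e => Timed.exp e)).bind fun ws =>
  Prog.draw (N i) ws fun c => Prog.exec ⟨Function.update a i c, 1⟩

lemma sampleSoftmax_eq (I : Input S d N) (W : Fin d → ℝ) (s : S) :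
    sampleSoftmax I W s =
      (List.finRange m).foldl (fun p i => p.bind (sampleComponent I W s i)) (Prog.ret I.abar) :=
  rfl

/-- Law of one component. -/
def componentLaw (I : Input S d N) (W : Fin d → ℝ) (s : S) (i : Fin m) : Measure (Fin (N i)) :=
  ∑ c, ENNReal.ofReal (componentWeight I W s i c / ∑ j, componentWeight I W s i j) •
    Measure.dirac c

instance (I : Input S d N) (W : Fin d → ℝ) (s : S) (i : Fin m) :
    IsFiniteMeasure (componentLaw I W s i) := by
  unfold componentLaw
  constructor
  simp only [Measure.coe_finsetSum, Finset.sum_apply, Measure.smul_apply, smul_eq_mul,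
    measure_univ, mul_one]
  exact ENNReal.sum_lt_top.2 fun c _ => ENNReal.ofReal_lt_top

lemma expect_sampleComponent (M : MDP S (Joint N)) (π₀ : Policy S (Joint N)) (I : Input S d N)
    (W : Fin d → ℝ) (s : S) (i : Fin m) (a : Joint N) (f : Joint N → ℝ≥0∞) :
    (sampleComponent I W s i a).expect M π₀ f =
      ∫⁻ c, f (Function.update a i c) ∂(componentLaw I W s i) := by
  unfold componentLaw
  rw [lintegral_finsetSum_measure]
  simp only [lintegral_smul_measure, lintegral_dirac, smul_eq_mul]
  rfl

/-- Drawing a coordinate means integrating it out, so drawing the coordinates of `L` one after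
another is a marginal integral. Without repetitions, each insertion is one `lmarginal_insert`. -/
lemma expect_foldl_sampleComponent (M : MDP S (Joint N)) (π₀ : Policy S (Joint N))
    (I : Input S d N) (W : Fin d → ℝ) (s : S) (f : Joint N → ℝ≥0∞) (L : List (Fin m))
    (hL : L.Nodup) (p : Prog S (Joint N) (Joint N)) :
    (L.foldl (fun p i => p.bind (sampleComponent I W s i)) p).expect M π₀ f =
      p.expect M π₀ (lmarginal (componentLaw I W s) L.toFinset f) := by
  induction L generalizing p with
  | nil => simp
  | cons i L ih =>
    rw [List.nodup_cons] at hL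
    rw [List.foldl_cons, ih hL.2, Prog.expect_bind]
    congr 1
    funext a
    rw [expect_sampleComponent, List.toFinset_cons,
      lmarginal_insert _ Measurable.of_discrete (by simpa using hL.1)]

/-- Additivity of the features turns the exponential into a product over components, and the
normalizer factorizes accordingly. This is why exponentially many joint actions need not be
enumerated. -/
lemma softmaxProb_eq_prod (I : Input S d N) (W : Fin d → ℝ) (s : S) (a : Joint N) :
    I.feat.softmaxProb I.temp W s a =
      ∏ i, (componentWeight I W s i (a i) / ∑ j, componentWeight I W s i j) := by
  have h : ∀ a : Joint N, Real.exp (I.temp * (W ⬝ᵥ I.feat.joint s a)) =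
      ∏ i, componentWeight I W s i (a i) := by
    intro a
    unfold componentWeight Features.joint
    rw [← Real.exp_sum, ← Finset.mul_sum, dotProduct_sum]
  unfold Features.softmaxProb
  rw [Finset.prod_div_distrib, Fintype.prod_sum, h]
  simp_rw [h]

/-- Every coordinate is redrawn, so the starting action `I.abar` leaves no trace in the law. -/
lemma expect_sampleSoftmax (M : MDP S (Joint N)) (π₀ : Policy S (Joint N)) (I : Input S d N)
    (W : Fin d → ℝ) (s : S) (f : Joint N → ℝ≥0∞) :
    (sampleSoftmax I W s).expect M π₀ f =
      ∑ a, ENNReal.ofReal (I.feat.softmaxProb I.temp W s a) * f a := by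
  rw [sampleSoftmax_eq, expect_foldl_sampleComponent _ _ _ _ _ _ _ (List.nodup_finRange m)]
  simp only [Prog.expect]
  rw [List.toFinset_finRange, lmarginal_univ, lintegral_fintype]
  refine Finset.sum_congr rfl fun a _ => ?_
  rw [Measure.pi_singleton, mul_comm, softmaxProb_eq_prod, ENNReal.ofReal_prod_of_nonneg]
  · congr 1
    refine Finset.prod_congr rfl fun i _ => ?_
    unfold componentLaw
    simp only [Measure.coe_finsetSum, Finset.sum_apply, Measure.smul_apply, smul_eq_mul,
      MeasurableSet.singleton, Measure.dirac_apply', Set.indicator_apply, Set.mem_singleton_iff,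
      Pi.one_apply, mul_ite, mul_one, mul_zero]
    simp
  · intro i _
    unfold componentWeight
    positivity

lemma lintegral_softmaxPolicy [Nonempty (Joint N)] (F : Features S d N) (α : ℝ) (W : Fin d → ℝ)
    (s : S) (f : Joint N → ℝ≥0∞) :
    ∫⁻ a, f a ∂((F.softmaxPolicy α W).kernel s) =
      ∑ a, ENNReal.ofReal (F.softmaxProb α W s a) * f a := by
  change ∫⁻ a, f a ∂(∑ a, ENNReal.ofReal (F.softmaxProb α W s a) • Measure.dirac a) = _
  rw [lintegral_finsetSum_measure]
  simp only [lintegral_smul_measure, lintegral_dirac, smul_eq_mul]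

lemma expect_samplePolicy (M : MDP S (Joint N)) (π₀ : Policy S (Joint N)) (I : Input S d N)
    (c : Option (Fin d → ℝ)) (s : S) (f : Joint N → ℝ≥0∞) :
    (samplePolicy I c s).expect M π₀ f = ∫⁻ a, f a ∂((decode I π₀ c).kernel s) := by
  cases c with
  | none => rfl
  | some W =>
    have : Nonempty (Joint N) := ⟨I.abar⟩
    exact (expect_sampleSoftmax M π₀ I W s f).trans
      (lintegral_softmaxPolicy I.feat I.temp W s f).symm

/-- Argued through the law of the policy: a `draw` with arbitrary real weights could have total mass
above one. -/
lemma subUnital_samplePolicy (M : MDP S (Joint N)) (π₀ : Policy S (Joint N)) (I : Input S d N)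
    (c : Option (Fin d → ℝ)) (s : S) : (samplePolicy I c s).SubUnital M π₀ := by
  intro f
  rw [expect_samplePolicy, expect_samplePolicy]
  exact Prog.lintegral_add_one_le (F := fun a => f a + 1) (G := f) fun _ => le_rfl

end Sampling

/-! ### Laws of rollouts -/

section Rollouts

variable {S : Type u} [MeasurableSpace S] {m d : ℕ} {N : Fin m → ℕ}
  {M : MDP S (Joint N)} {π₀ : Policy S (Joint N)} {I : Input S d N}
  {c : Option (Fin d → ℝ)} {C : List (CoreElt S d N)}

lemma subUnital_rolloutSteps (h : ℕ) (g acc : ℝ) (s : S) :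
    (rolloutSteps I c C h g acc s).SubUnital M π₀ := by
  induction h generalizing g acc s with
  | zero => exact Prog.SubUnital.ret _
  | succ h ih =>
    refine Prog.SubUnital.bind (Prog.SubUnital.exec _) fun o => ?_
    cases o with
    | some z => exact Prog.SubUnital.ret _
    | none =>
      refine Prog.SubUnital.bind (subUnital_samplePolicy M π₀ I c s) fun a => ?_
      exact Prog.SubUnital.query fun y r => ih _ _ _

lemma subUnital_rolloutLoop (z : CoreElt S d N) (k : ℕ) (tot : ℝ) :
    (rolloutLoop I c C z k tot).SubUnital M π₀ := by
  induction k generalizing tot with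
  | zero => exact Prog.SubUnital.ret _
  | succ k ih =>
    refine Prog.SubUnital.query fun y r =>
      Prog.SubUnital.bind (subUnital_rolloutSteps I.H I.disc r y) fun o => ?_
    cases o with
    | inl x => exact Prog.SubUnital.ret _
    | inr g => exact ih (tot + g)

lemma subUnital_rollout (z : CoreElt S d N) : (rollout I c C z).SubUnital M π₀ := by
  refine Prog.SubUnital.bind (subUnital_rolloutLoop z I.n 0) fun o => ?_
  cases o with
  | inl x => exact Prog.SubUnital.ret _
  | inr g => exact fun f => le_rfl

/-- A policy agrees with the current policy of the algorithm in all states that pass the check. -/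
def AgreesOnCertain (I : Input S d N) (π₀ : Policy S (Joint N)) (c : Option (Fin d → ℝ))
    (C : List (CoreElt S d N)) (ν : Policy S (Joint N)) : Prop :=
  ∀ s, (davCheck I C s).val = none → ν.kernel s = (decode I π₀ c).kernel s

lemma agreesOnCertain_decode : AgreesOnCertain I π₀ c C (decode I π₀ c) := fun _ _ => rfl

lemma lintegral_le_one {X : Type*} [MeasurableSpace X] {μ : Measure X} [IsProbabilityMeasure μ]
    {F : X → ℝ≥0∞} (h : ∀ x, F x ≤ 1) : ∫⁻ x, F x ∂μ ≤ 1 :=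
  (lintegral_mono h).trans (by simp)

/-- Coupling argument. Actions are drawn only in states that passed the check, where `ν` is the
current policy. Once a check fails, the outcome is on the left, where `f ≥ 1` dominates every `φ ≤
1`. So simulating with `ν` and without checks can only lower the expectation. -/
lemma expect_rolloutSteps_ge (hd : I.disc = M.γ) {ν : Policy S (Joint N)}
    (hν : AgreesOnCertain I π₀ c C ν) {f : CoreElt S d N ⊕ ℝ → ℝ≥0∞} {φ : ℝ → ℝ≥0∞}
    (hφ : Measurable φ) (hf : ∀ z, 1 ≤ f (Sum.inl z)) (hφ1 : ∀ u, φ u ≤ 1)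
    (hφf : ∀ u, φ u ≤ f (Sum.inr u)) (h : ℕ) (g acc : ℝ) (s : S) :
    ∫⁻ a, ∫⁻ u, φ (acc + g * u) ∂(M.returnLaw ν h (s, a)) ∂(ν.kernel s) ≤
      (rolloutSteps I c C h g acc s).expect M π₀ f := by
  have hφ' : ∀ g acc : ℝ, Measurable fun u => φ (acc + g * u) := fun g acc =>
    hφ.comp (by fun_prop)
  induction h generalizing g acc s with
  | zero =>
    simp only [MDP.returnLaw, Kernel.const_apply, rolloutSteps, Prog.expect]
    calc ∫⁻ _, ∫⁻ u, φ (acc + g * u) ∂(Measure.dirac 0) ∂(ν.kernel s)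
        = φ acc := by
          rw [lintegral_dirac' _ (hφ' g acc)]
          simp
      _ ≤ _ := hφf acc
  | succ h ih =>
    rw [rolloutSteps]
    change _ ≤ Prog.expect M π₀ (match (davCheck I C s).val with | some z => _ | none => _) f
    cases hz : (davCheck I C s).val with
    | some z =>
      exact (lintegral_le_one fun a => lintegral_le_one fun u => hφ1 _).trans (hf z)
    | none =>
      simp only
      rw [Prog.expect_bind, expect_samplePolicy, hν s hz]
      refine lintegral_mono fun a => ?_
      rw [M.lintegral_returnLaw_succ ν h (s, a) (hφ' g acc)]
      refine lintegral_mono fun y => ?_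
      -- After one step the return `acc + g (r + γ u)` reads `(acc + g r) + (g γ) u`, the state with
      -- which the program recurses.
      refine le_trans (le_of_eq ?_) (ih (g * I.disc) (acc + g * M.r (s, a)) y)
      rw [hd]
      refine lintegral_congr fun a' => lintegral_congr fun u => ?_
      congr 1
      ring

lemma expect_rolloutLoop_ge (hd : I.disc = M.γ) {ν : Policy S (Joint N)}
    (hν : AgreesOnCertain I π₀ c C ν) {f : CoreElt S d N ⊕ ℝ → ℝ≥0∞} {φ : ℝ → ℝ≥0∞}
    (hφ : Measurable φ) (hf : ∀ z, 1 ≤ f (Sum.inl z)) (hφ1 : ∀ u, φ u ≤ 1)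
    (hφf : ∀ u, φ u ≤ f (Sum.inr u)) (z : CoreElt S d N) (k : ℕ) (tot : ℝ) :
    ∫⁻ u, φ (tot + u) ∂(sumLaw (M.returnLaw ν (I.H + 1) (z.state, z.act)) k) ≤
      (rolloutLoop I c C z k tot).expect M π₀ f := by
  have hφ' : ∀ tot : ℝ, Measurable fun u => φ (tot + u) := fun tot => hφ.comp (by fun_prop)
  induction k generalizing tot with
  | zero =>
    simp only [sumLaw, rolloutLoop, Prog.expect]
    rw [lintegral_dirac' _ (hφ' tot), add_zero]
    exact hφf tot
  | succ k ih =>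
    have hmeas : Measurable fun x : ℝ =>
        ∫⁻ u, φ (tot + (x + u)) ∂(sumLaw (M.returnLaw ν (I.H + 1) (z.state, z.act)) k) :=
      Measurable.lintegral_prod_right' (f := fun p : ℝ × ℝ => φ (tot + (p.1 + p.2)))
        (hφ.comp (by fun_prop))
    -- The query at `z` already yields a reward before the `I.H` steps of `rolloutSteps`, hence
    -- `returnLaw` of length `I.H + 1`.
    rw [lintegral_sumLaw_succ _ _ (hφ' tot), M.lintegral_returnLaw_succ ν _ _ hmeas,
      rolloutLoop]
    refine lintegral_mono fun y => ?_
    rw [Prog.expect_bind]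
    -- The test function for one rollout is the integral over the sum of the remaining `k` returns,
    -- as a function of the current return.
    refine le_trans (le_of_eq ?_) (expect_rolloutSteps_ge hd hν
      (φ := fun x => ∫⁻ u, φ (tot + (x + u))
        ∂(sumLaw (M.returnLaw ν (I.H + 1) (z.state, z.act)) k))
      hmeas ?_ ?_ ?_ I.H I.disc (M.r (z.state, z.act)) y)
    · rw [hd]
    · exact hf
    · exact fun u => lintegral_le_one fun _ => hφ1 _
    · intro x
      refine le_trans (le_of_eq ?_) (ih (tot + x))
      simp_rw [add_assoc]

/-- Outcomes of a rollout that are uncertain or `θ`-accurate for the target `μ`. -/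
def accurate {X : Type*} (μ θ : ℝ) : Set (X ⊕ ℝ) :=
  {o | ∀ q, o = Sum.inr q → |q - μ| ≤ θ}

/-- Hoeffding's bound holds for the target of any `ν` that agrees on certain states, although `ν` is
not the policy being simulated; outcomes on the left count as accurate. -/
lemma prob_rollout_accurate_ge (hd : I.disc = M.γ) (hn : 0 < I.n) {ν : Policy S (Joint N)}
    (hν : AgreesOnCertain I π₀ c C ν) (z : CoreElt S d N) {θ : ℝ} (hθ : 0 ≤ θ) :
    ENNReal.ofReal (1 - 2 * Real.exp (-(2 * I.n * θ ^ 2 * (1 - M.γ) ^ 2))) ≤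
      (rollout I c C z).prob M π₀
        (accurate (M.meanReturn ν (I.H + 1) (z.state, z.act)) θ) := by
  set μ := M.meanReturn ν (I.H + 1) (z.state, z.act)
  have h1 := sumLaw_average_ge (M.returnLaw ν (I.H + 1) (z.state, z.act))
    (one_div_pos.2 M.one_sub_pos) (M.returnLaw_mem ν _ _) hn hθ
  have e : 2 * (I.n : ℝ) * θ ^ 2 / (1 / (1 - M.γ)) ^ 2 = 2 * I.n * θ ^ 2 * (1 - M.γ) ^ 2 := by
    have := M.one_sub_pos
    field_simp
  rw [e] at h1
  refine h1.trans ?_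
  have hmeas : MeasurableSet {u : ℝ | |u / I.n - μ| ≤ θ} :=
    measurableSet_le (by fun_prop) measurable_const
  unfold Prog.prob rollout
  rw [Prog.expect_bind]
  refine le_trans (le_of_eq ?_) (expect_rolloutLoop_ge hd hν
    (φ := Set.indicator {u : ℝ | |u / I.n - μ| ≤ θ} 1) (measurable_one.indicator hmeas)
    ?_ ?_ ?_ z I.n 0)
  · simp only [zero_add]
    rw [lintegral_indicator_one hmeas]
    rfl
  · intro x
    simp [Prog.expect, accurate]
  · exact fun u => Set.indicator_le_self' (by simp) u |>.trans le_rfl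
  · intro u
    by_cases hu : |u / I.n - μ| ≤ θ
    · have : (Sum.inr (u / I.n) : CoreElt S d N ⊕ ℝ) ∈ accurate μ θ := by
        rintro q ⟨⟩
        exact hu
      change _ ≤ Set.indicator (accurate μ θ) 1 (Sum.inr (u / I.n) : CoreElt S d N ⊕ ℝ)
      simp [this, hu]
    · simp [hu]

lemma prob_rollout_accurate₂_ge (hd : I.disc = M.γ) (hn : 0 < I.n) {ν ν' : Policy S (Joint N)}
    (hν : AgreesOnCertain I π₀ c C ν) (hν' : AgreesOnCertain I π₀ c C ν') (z : CoreElt S d N)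
    {θ : ℝ} (hθ : 0 ≤ θ) :
    ENNReal.ofReal (1 - 4 * Real.exp (-(2 * I.n * θ ^ 2 * (1 - M.γ) ^ 2))) ≤
      (rollout I c C z).prob M π₀
        (accurate (M.meanReturn ν (I.H + 1) (z.state, z.act)) θ ∩
          accurate (M.meanReturn ν' (I.H + 1) (z.state, z.act)) θ) := by
  set e := Real.exp (-(2 * I.n * θ ^ 2 * (1 - M.γ) ^ 2))
  set A := accurate (X := CoreElt S d N) (M.meanReturn ν (I.H + 1) (z.state, z.act)) θ
  set B := accurate (X := CoreElt S d N) (M.meanReturn ν' (I.H + 1) (z.state, z.act)) θ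
  have h1 : ENNReal.ofReal (1 - 2 * e) ≤ _ := prob_rollout_accurate_ge hd hn hν z hθ
  have h2 : ENNReal.ofReal (1 - 2 * e) ≤ _ := prob_rollout_accurate_ge hd hn hν' z hθ
  have h3 : (rollout I c C z).prob M π₀ A + (rollout I c C z).prob M π₀ B ≤
      (rollout I c C z).prob M π₀ (A ∩ B) + 1 := by
    refine (Prog.expect_add_le M π₀ _ _ _).trans
      (le_trans (Prog.expect_mono M π₀ _ fun x => ?_) (subUnital_rollout z _))
    by_cases hA : x ∈ A <;> by_cases hB : x ∈ B <;> simp [hA, hB]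
  have h4 := (add_le_add h1 h2).trans h3
  rcases le_or_gt (1 - 4 * e) 0 with h5 | h5
  · rw [ENNReal.ofReal_of_nonpos h5]
    exact zero_le
  · rw [← ENNReal.ofReal_add (by linarith) (by linarith)] at h4
    have h6 : ENNReal.ofReal (1 - 4 * e) + 1 ≤
        (rollout I c C z).prob M π₀ (A ∩ B) + 1 := by
      refine le_trans (le_of_eq ?_) h4
      rw [← ENNReal.ofReal_one, ← ENNReal.ofReal_add h5.le zero_le_one]
      congr 1
      ring
    exact (ENNReal.add_le_add_iff_right ENNReal.one_ne_top).1 h6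

end Rollouts

/-! ### Regularized Gram matrices -/

section Gram

variable {d : ℕ} {reg : ℝ}

/-- The squared norm `xᵀ (Φᵀ Φ + reg • 1)⁻¹ x`. -/
def invSq (reg : ℝ) (L : List (Fin d → ℝ)) (x : Fin d → ℝ) : ℝ :=
  x ⬝ᵥ (gram reg L)⁻¹.mulVec x

lemma gram_append (L : List (Fin d → ℝ)) (x : Fin d → ℝ) :
    gram reg (L ++ [x]) = gram reg L + Matrix.vecMulVec x x := by
  simp only [gram, List.map_append, List.map_cons, List.map_nil, List.sum_append, List.sum_cons,
    List.sum_nil, add_zero]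
  abel

lemma isUnit_det_gram (h : 0 < reg) (L : List (Fin d → ℝ)) : IsUnit (gram reg L).det :=
  (Matrix.isUnit_iff_isUnit_det _).1 (gram_posDef h L).isUnit

lemma gram_mulVec_inv (h : 0 < reg) (L : List (Fin d → ℝ)) (x : Fin d → ℝ) :
    (gram reg L).mulVec ((gram reg L)⁻¹.mulVec x) = x := by
  rw [Matrix.mulVec_mulVec, Matrix.mul_nonsing_inv _ (isUnit_det_gram h L), Matrix.one_mulVec]

lemma dotProduct_gram_mulVec (L : List (Fin d → ℝ)) (u v : Fin d → ℝ) :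
    u ⬝ᵥ (gram reg L).mulVec v =
      (L.map fun x => (x ⬝ᵥ u) * (x ⬝ᵥ v)).sum + reg * (u ⬝ᵥ v) := by
  induction L with
  | nil => simp [gram, Matrix.smul_mulVec, dotProduct_smul]
  | cons x L ih =>
    have e : gram reg (x :: L) = Matrix.vecMulVec x x + gram reg L := by
      simp [gram, add_assoc]
    rw [e, Matrix.add_mulVec, dotProduct_add, ih, Matrix.vecMulVec_mulVec]
    simp only [List.map_cons, List.sum_cons, dotProduct_smul, MulOpposite.smul_eq_mul_unop,
      MulOpposite.unop_op]
    rw [dotProduct_comm u x]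
    ring

lemma dotProduct_gram_mulVec_comm (L : List (Fin d → ℝ)) (u v : Fin d → ℝ) :
    u ⬝ᵥ (gram reg L).mulVec v = v ⬝ᵥ (gram reg L).mulVec u := by
  rw [dotProduct_gram_mulVec, dotProduct_gram_mulVec, dotProduct_comm u v]
  simp_rw [mul_comm]

lemma dotProduct_gram_mulVec_self_nonneg (h : 0 < reg) (L : List (Fin d → ℝ)) (u : Fin d → ℝ) :
    0 ≤ u ⬝ᵥ (gram reg L).mulVec u := by
  simpa using (gram_posDef h L).posSemidef.dotProduct_mulVec_nonneg u

/-- Matrix determinant lemma for a rank-one update. -/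
lemma det_gram_append (h : 0 < reg) (L : List (Fin d → ℝ)) (x : Fin d → ℝ) :
    (gram reg (L ++ [x])).det = (gram reg L).det * (1 + invSq reg L x) := by
  rw [gram_append, Matrix.vecMulVec_eq Unit, Matrix.det_add_replicateCol_mul_replicateRow
    (isUnit_det_gram h L)]
  congr 1
  rw [Matrix.det_unique, Matrix.add_apply, Matrix.one_apply_eq, invSq, Matrix.mul_assoc,
    ← Matrix.replicateCol_mulVec, Matrix.replicateRow_mul_replicateCol_apply]

lemma invSq_nonneg (h : 0 < reg) (L : List (Fin d → ℝ)) (x : Fin d → ℝ) :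
    0 ≤ invSq reg L x := by
  simpa [invSq] using (gram_posDef h L).inv.posSemidef.dotProduct_mulVec_nonneg x

/-- Inversion reverses the Loewner order. With `G y = x = G' y'` and `G ≤ G'`, nonnegativity of the
`G`-form at `y - y'` gives `2 y'ᵀx ≤ yᵀx + y'ᵀG y' ≤ yᵀx + y'ᵀx`. -/
lemma invSq_append_le (h : 0 < reg) (L : List (Fin d → ℝ)) (z x : Fin d → ℝ) :
    invSq reg (L ++ [z]) x ≤ invSq reg L x := by
  set G := gram reg L with hG
  set y := G⁻¹.mulVec x with hy
  set y' := (gram reg (L ++ [z]))⁻¹.mulVec x with hy'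
  have e1 : G.mulVec y = x := gram_mulVec_inv h L x
  have e2 : (gram reg (L ++ [z])).mulVec y' = x := gram_mulVec_inv h (L ++ [z]) x
  have e3 : y' ⬝ᵥ G.mulVec y' ≤ y' ⬝ᵥ x := by
    have h1 : y' ⬝ᵥ x = y' ⬝ᵥ (gram reg (L ++ [z])).mulVec y' := by rw [e2]
    rw [h1, hG, dotProduct_gram_mulVec, dotProduct_gram_mulVec, List.map_append, List.sum_append]
    simp only [List.map_cons, List.map_nil, List.sum_cons, List.sum_nil, add_zero]
    nlinarith [mul_self_nonneg (z ⬝ᵥ y')]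
  have e4 := dotProduct_gram_mulVec_self_nonneg h L (y - y')
  rw [← hG, Matrix.mulVec_sub, dotProduct_sub, sub_dotProduct, sub_dotProduct, e1,
    dotProduct_gram_mulVec_comm L y y', ← hG, e1] at e4
  have e5 : invSq reg L x = y ⬝ᵥ x := by rw [invSq, ← hG, ← hy, dotProduct_comm]
  have e6 : invSq reg (L ++ [z]) x = y' ⬝ᵥ x := by rw [invSq, ← hy', dotProduct_comm]
  rw [e5, e6]
  linarith

/-- Cauchy–Schwarz for the dual norms of the Gram matrix and of its inverse. -/
lemma abs_dotProduct_le_of_invSq_le_one (h : 0 < reg) (L : List (Fin d → ℝ))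
    {x : Fin d → ℝ} (hx : invSq reg L x ≤ 1) (u : Fin d → ℝ) :
    |x ⬝ᵥ u| ≤ √(u ⬝ᵥ (gram reg L).mulVec u) := by
  apply Real.le_sqrt_of_sq_le
  rw [sq_abs]
  set t := x ⬝ᵥ u
  set y := (gram reg L)⁻¹.mulVec x
  have e1 : (gram reg L).mulVec y = x := gram_mulVec_inv h L x
  have e2 : y ⬝ᵥ x = invSq reg L x := by rw [invSq, dotProduct_comm]
  -- Expanding gives `0 ≤ uᵀGu - 2t² + t² · invSq`, and `invSq ≤ 1` leaves `t² ≤ uᵀGu`.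
  have e3 := dotProduct_gram_mulVec_self_nonneg h L (u - t • y)
  rw [Matrix.mulVec_sub, Matrix.mulVec_smul, e1, dotProduct_sub, sub_dotProduct, sub_dotProduct,
    dotProduct_smul, dotProduct_smul, smul_dotProduct, smul_dotProduct,
    dotProduct_gram_mulVec_comm L y u, e1, e2, dotProduct_comm u x] at e3
  simp only [smul_eq_mul] at e3
  change 0 ≤ _ - t * t - (t * t - t * (t * _)) at e3
  nlinarith [mul_self_nonneg t]

lemma sum_abs_sq_le (l : List ℝ) :
    (l.map fun t => |t|).sum ^ 2 ≤ l.length * (l.map fun t => t * t).sum := by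
  induction l with
  | nil => simp
  | cons t l ih =>
    simp only [List.map_cons, List.sum_cons, List.length_cons]
    push_cast
    set A := (l.map fun t => |t|).sum
    set Q := (l.map fun t => t * t).sum
    have ht : |t| * |t| = t * t := abs_mul_abs_self t
    have hQ : 0 ≤ Q := List.sum_nonneg (by simpa using fun t _ => mul_self_nonneg t)
    rcases Nat.eq_zero_or_pos l.length with h0 | h0
    · have : l = [] := List.length_eq_zero_iff.1 h0
      subst this
      simp only [List.length_nil]
      simp [A, Q]
      nlinarith
    · have h1 : (1 : ℝ) ≤ l.length := by exact_mod_cast h0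
      generalize (l.length : ℝ) = n at *
      rw [← ht]
      generalize |t| = a at *
      -- The factor `n` makes `(n a - A)²` available; together with `A² ≤ n Q` it bounds the cross
      -- term.
      have h2 : n * (2 * a * A) ≤ n * (n * (a * a) + Q) := by
        nlinarith [sq_nonneg (n * a - A)]
      have h3 := le_of_mul_le_mul_left h2 (by linarith)
      nlinarith

lemma euclNorm_sq (x : Fin d → ℝ) : euclNorm x ^ 2 = x ⬝ᵥ x := by
  rw [euclNorm, EuclideanSpace.norm_sq_eq]
  simp [dotProduct, sq]

lemma euclNorm_nonneg (x : Fin d → ℝ) : 0 ≤ euclNorm x := norm_nonneg _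

lemma abs_dotProduct_le_euclNorm (x y : Fin d → ℝ) : |x ⬝ᵥ y| ≤ euclNorm x * euclNorm y := by
  have h := abs_real_inner_le_norm (WithLp.toLp 2 x) (WithLp.toLp 2 y)
  simpa [euclNorm, EuclideanSpace.inner_eq_star_dotProduct, dotProduct_comm] using h

/-- Error of regularized least squares at a point of small `(Φᵀ Φ + reg • 1)⁻¹`-norm. -/
lemma sqrt_gram_leastSquares_sub_le (h : 0 < reg) (l : List ((Fin d → ℝ) × ℝ)) (θ : Fin d → ℝ)
    {b e : ℝ} (hθ : euclNorm θ ≤ b) (he : 0 ≤ e) (hl : ∀ p ∈ l, |p.2 - θ ⬝ᵥ p.1| ≤ e)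
    {u : Fin d → ℝ} (hu : u = ((gram reg (l.map Prod.fst))⁻¹).mulVec
      (l.map fun p => p.2 • p.1).sum - θ) :
    √(u ⬝ᵥ (gram reg (l.map Prod.fst)).mulVec u) ≤ b * √reg + e * √(l.length : ℝ) := by
  set G := gram reg (l.map Prod.fst) with hG
  set U := u ⬝ᵥ G.mulVec u with hU
  have hb : 0 ≤ b := (euclNorm_nonneg θ).trans hθ
  have hU0 : 0 ≤ U := dotProduct_gram_mulVec_self_nonneg h _ u
  -- The normal equations: `G u` is the residual-weighted sum of the features minus `reg • θ`, here
  -- paired with `u`.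
  have h1 : U = (l.map fun p => (p.2 - θ ⬝ᵥ p.1) * (p.1 ⬝ᵥ u)).sum - reg * (u ⬝ᵥ θ) := by
    have e1 : G.mulVec u = (l.map fun p => p.2 • p.1).sum - G.mulVec θ := by
      rw [hu, Matrix.mulVec_sub, hG, gram_mulVec_inv h]
    have e2 : ∀ l : List ((Fin d → ℝ) × ℝ), u ⬝ᵥ (l.map fun p => p.2 • p.1).sum =
        (l.map fun p => p.2 * (p.1 ⬝ᵥ u)).sum := by
      intro l
      induction l with
      | nil => simp
      | cons p l ih =>
        simp only [List.map_cons, List.sum_cons, dotProduct_add, ih, dotProduct_smul, smul_eq_mul]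
        rw [dotProduct_comm u p.1]
    rw [hU, e1, dotProduct_sub, e2, hG, dotProduct_gram_mulVec]
    have e3 : ∀ l : List ((Fin d → ℝ) × ℝ),
        (l.map fun p => (p.2 - θ ⬝ᵥ p.1) * (p.1 ⬝ᵥ u)).sum =
        (l.map fun p => p.2 * (p.1 ⬝ᵥ u)).sum -
          ((l.map Prod.fst).map fun x => (x ⬝ᵥ u) * (x ⬝ᵥ θ)).sum := by
      intro l
      induction l with
      | nil => simp
      | cons p l ih =>
        simp only [List.map_cons, List.sum_cons]
        rw [ih, dotProduct_comm θ]
        ring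
    rw [e3]
    ring
  have h2 : U = ((l.map fun p => p.1 ⬝ᵥ u).map fun t => t * t).sum + reg * (u ⬝ᵥ u) := by
    rw [hU, hG, dotProduct_gram_mulVec, List.map_map, List.map_map]
    rfl
  set T := l.map fun p => p.1 ⬝ᵥ u with hT
  have hT0 : 0 ≤ (T.map fun t => t * t).sum :=
    List.sum_nonneg fun x hx => by
      obtain ⟨t, _, rfl⟩ := List.mem_map.1 hx
      exact mul_self_nonneg t
  have huu : 0 ≤ u ⬝ᵥ u := by rw [← euclNorm_sq]; positivity
  have h3 : (l.map fun p => (p.2 - θ ⬝ᵥ p.1) * (p.1 ⬝ᵥ u)).sum ≤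
      e * (T.map fun t => |t|).sum := by
    rw [hT]
    clear hT hT0 h2 h1 hu hU hU0
    clear_value G U T
    clear hG U T G
    induction l with
    | nil => simp
    | cons p l ih =>
      have h4 := ih fun q hq => hl q (List.mem_cons_of_mem _ hq)
      simp only [List.map_cons, List.sum_cons, mul_add]
      have h5 : (p.2 - θ ⬝ᵥ p.1) * (p.1 ⬝ᵥ u) ≤ e * |p.1 ⬝ᵥ u| := by
        refine (le_abs_self _).trans ?_
        rw [abs_mul]
        exact mul_le_mul_of_nonneg_right (hl p List.mem_cons_self) (abs_nonneg _)
      linarith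
  have h4 : (T.map fun t => |t|).sum ≤ √(l.length : ℝ) * √U := by
    rw [← Real.sqrt_mul (Nat.cast_nonneg _)]
    apply Real.le_sqrt_of_sq_le
    refine (sum_abs_sq_le T).trans ?_
    rw [hT, List.length_map, ← hT]
    refine mul_le_mul_of_nonneg_left ?_ (Nat.cast_nonneg _)
    nlinarith [mul_nonneg h.le huu]
  -- The ridge bias: `reg ‖u‖² ≤ U` turns `reg ‖u‖ b` into `b √reg √U`.
  have h5 : -(reg * (u ⬝ᵥ θ)) ≤ b * √reg * √U := by
    have e1 : √reg * euclNorm u ≤ √U := by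
      apply Real.le_sqrt_of_sq_le
      rw [mul_pow, Real.sq_sqrt h.le, euclNorm_sq]
      linarith
    have e2 : -(u ⬝ᵥ θ) ≤ euclNorm u * b :=
      (neg_le_abs _).trans ((abs_dotProduct_le_euclNorm u θ).trans
        (mul_le_mul_of_nonneg_left hθ (euclNorm_nonneg u)))
    calc -(reg * (u ⬝ᵥ θ)) = reg * -(u ⬝ᵥ θ) := by ring
      _ ≤ reg * (euclNorm u * b) := mul_le_mul_of_nonneg_left e2 h.le
      _ = b * √reg * (√reg * euclNorm u) := by
        nth_rewrite 1 [← Real.mul_self_sqrt h.le]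
        ring
      _ ≤ _ := mul_le_mul_of_nonneg_left e1 (by positivity)
  -- Both error terms carry a factor `√U`, which is cancelled at the end.
  have h6 : √U * √U ≤ (b * √reg + e * √(l.length : ℝ)) * √U := by
    rw [Real.mul_self_sqrt hU0]
    nlinarith [mul_le_mul_of_nonneg_left h4 he]
  rcases (Real.sqrt_nonneg U).eq_or_lt with h7 | h7
  · rw [← h7]; positivity
  · exact le_of_mul_le_mul_right h6 h7

/-! ### Elliptical potential: determinant growth bounds the size of a core set -/

lemma trace_gram_le (L : List (Fin d → ℝ)) (hL : ∀ x ∈ L, euclNorm x ≤ 1) :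
    (gram reg L).trace ≤ L.length + reg * d := by
  induction L with
  | nil => simp [gram, Matrix.trace_smul]
  | cons x L ih =>
    have e : gram reg (x :: L) = Matrix.vecMulVec x x + gram reg L := by
      simp [gram, add_assoc]
    have h1 := ih fun y hy => hL y (List.mem_cons_of_mem _ hy)
    have h2 : x ⬝ᵥ x ≤ 1 := by
      rw [← euclNorm_sq]
      exact pow_le_one₀ (euclNorm_nonneg x) (hL x List.mem_cons_self)
    rw [e, Matrix.trace_add, Matrix.trace_vecMulVec, List.length_cons]
    push_cast
    linarith

/-- AM–GM for the eigenvalues, through the tangent of the logarithm at `c`; the trace is at most `d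
c`, so the linear terms are nonpositive in total. -/
lemma log_det_gram_le (hd : 0 < d) (h : 0 < reg) (L : List (Fin d → ℝ))
    (hL : ∀ x ∈ L, euclNorm x ≤ 1) :
    Real.log (gram reg L).det ≤ d * Real.log (reg + L.length / d) := by
  have hp := gram_posDef h L
  have hd' : (0 : ℝ) < d := by exact_mod_cast hd
  set c := reg + (L.length : ℝ) / d with hc
  have hc0 : 0 < c := by positivity
  have hev := hp.eigenvalues_pos
  have hdet : (gram reg L).det = ∏ i, hp.isHermitian.eigenvalues i := by
    simpa using hp.isHermitian.det_eq_prod_eigenvalues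
  have htr : (gram reg L).trace = ∑ i, hp.isHermitian.eigenvalues i := by
    simpa using hp.isHermitian.trace_eq_sum_eigenvalues
  rw [hdet, Real.log_prod fun i _ => (hev i).ne']
  calc ∑ i, Real.log (hp.isHermitian.eigenvalues i)
      ≤ ∑ i, (Real.log c + (hp.isHermitian.eigenvalues i / c - 1)) := by
        refine Finset.sum_le_sum fun i _ => ?_
        have := Real.log_le_sub_one_of_pos (div_pos (hev i) hc0)
        rw [Real.log_div (hev i).ne' hc0.ne'] at this
        linarith
    _ = d * Real.log c + ((gram reg L).trace / c - d) := by
        rw [Finset.sum_add_distrib, Finset.sum_sub_distrib, ← Finset.sum_div, ← htr]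
        simp
    _ ≤ d * Real.log c := by
        have : (gram reg L).trace / c ≤ d := by
          rw [div_le_iff₀ hc0]
          refine (trace_gram_le L hL).trans (le_of_eq ?_)
          rw [hc]
          field_simp
          ring
        linarith

/-- Solves a linear-below-logarithmic inequality. For `y ≥ 1` one has `log (1 + y/Λ) ≤ log (1 + 1/Λ)
+ log y`, and `log y ≤ y/e` is absorbed on the left. -/
lemma elliptical_numeric {y Λ s : ℝ} (hΛ : 0 < Λ) (hs : s ≤ Real.log 2)
    (h : y * Real.log 2 ≤ s + Real.log (1 + y / Λ)) :
    y ≤ Real.exp 1 / (Real.exp 1 - 1) * 2 * (Real.log 2 + Real.log (1 + 1 / Λ)) := by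
  have he := Real.exp_one_gt_d9
  have hl := Real.log_two_gt_d9
  have he1 : 0 < Real.exp 1 - 1 := by linarith
  set ℓ := Real.log (1 + 1 / Λ) with hℓ
  have hℓ0 : 0 ≤ ℓ := Real.log_nonneg (by have := one_div_pos.2 hΛ; linarith)
  by_contra! hy
  rw [mul_assoc, div_mul_eq_mul_div, div_lt_iff₀ he1] at hy
  have hy1 : 1 ≤ y := by
    by_contra! h1
    nlinarith
  have hlog : Real.log (1 + y / Λ) ≤ ℓ + Real.log y := by
    rw [hℓ, ← Real.log_mul (by positivity) (by positivity)]
    refine Real.log_le_log (by positivity) ?_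
    have : (1 + 1 / Λ) * y = y + y / Λ := by ring
    rw [this]
    linarith
  have hlogy : Real.log y * Real.exp 1 ≤ y := by
    have := Real.log_le_sub_one_of_pos (x := y / Real.exp 1) (by positivity)
    rw [Real.log_div (by positivity) (by positivity), Real.log_exp] at this
    rw [← le_div_iff₀ (by positivity)]
    linarith
  have h1 : y * Real.log 2 * (2 * Real.exp 1) ≤
      2 * Real.exp 1 * (Real.log 2 + ℓ) + 2 * y := by nlinarith
  -- Equivalent to `log 2 - 1/e > (e - 1)/(2e)`, the reciprocal of the constant in the bound.
  have h2 : Real.exp 1 + 1 < Real.log 2 * (2 * Real.exp 1) := by nlinarith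
  nlinarith [mul_pos (by linarith : 0 < y) (sub_pos.2 h2)]

/-- The determinant is required to double for all elements but one; the missing `log 2`, divided by
`d`, is the slack `s` of `elliptical_numeric`. -/
lemma length_le_coreBound (hd : 0 < d) (h : 0 < reg) (L : List (Fin d → ℝ))
    (hL : ∀ x ∈ L, euclNorm x ≤ 1)
    (hdet : ((L.length : ℝ) - 1) * Real.log 2 + d * Real.log reg ≤
      Real.log (gram reg L).det) :
    (L.length : ℝ) ≤ Real.exp 1 / (Real.exp 1 - 1) * ((1 + 1) / 1) * d *
      (Real.log (1 + 1 / 1) + Real.log (1 + 1 / reg)) := by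
  have hd' : (1 : ℝ) ≤ d := by exact_mod_cast hd
  have h1 := hdet.trans (log_det_gram_le hd h L hL)
  have hl := Real.log_two_gt_d9
  have h2 := elliptical_numeric (y := L.length / d) (s := Real.log 2 / d) h
    (div_le_self (by linarith) hd') (by
      have e1 : Real.log (reg + L.length / d) =
          Real.log reg + Real.log (1 + L.length / d / reg) := by
        rw [← Real.log_mul h.ne' (by positivity)]
        congr 1
        field_simp
      rw [e1] at h1
      have : (L.length / d * Real.log 2 - Real.log 2 / d) * d ≤
          Real.log (1 + L.length / d / reg) * d := by
        have : (L.length / d * Real.log 2 - Real.log 2 / d) * d =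
          (L.length - 1) * Real.log 2 := by field_simp
        rw [this]
        linarith
      have := le_of_mul_le_mul_right this (by linarith)
      linarith)
  rw [div_le_iff₀ (by linarith)] at h2
  refine h2.trans (le_of_eq ?_)
  norm_num
  ring

lemma log_det_gram_nil :
    Real.log (gram reg ([] : List (Fin d → ℝ))).det = d * Real.log reg := by
  simp [gram]

lemma log_det_gram_append (h : 0 < reg) (L : List (Fin d → ℝ)) (x : Fin d → ℝ) :
    Real.log (gram reg (L ++ [x])).det =
      Real.log (gram reg L).det + Real.log (1 + invSq reg L x) := by
  have := invSq_nonneg h L x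
  rw [det_gram_append h, Real.log_mul (gram_posDef h L).det_pos.ne' (by positivity)]

end Gram

/-! ### Exponential weights -/

section Gibbs

variable {A : Type*} [Fintype A] [MeasurableSpace A]

/-- The distribution with probabilities proportional to `exp (α * g a)`. -/
def gibbsLaw (α : ℝ) (g : A → ℝ) : Measure A :=
  ∑ a, ENNReal.ofReal (Real.exp (α * g a) / ∑ b, Real.exp (α * g b)) • Measure.dirac a

lemma isProbabilityMeasure_gibbsLaw [Nonempty A] (α : ℝ) (g : A → ℝ) :
    IsProbabilityMeasure (gibbsLaw α g) := by
  constructor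
  have hs : 0 < ∑ b, Real.exp (α * g b) :=
    Finset.sum_pos (fun a _ => Real.exp_pos _) Finset.univ_nonempty
  simp only [gibbsLaw, Measure.coe_finsetSum, Finset.sum_apply, Measure.smul_apply, smul_eq_mul,
    measure_univ, mul_one]
  rw [← ENNReal.ofReal_sum_of_nonneg fun a _ => by positivity, ← Finset.sum_div,
    div_self hs.ne', ENNReal.ofReal_one]

lemma integral_gibbsLaw [MeasurableSingletonClass A] (α : ℝ) (g f : A → ℝ) :
    ∫ a, f a ∂(gibbsLaw α g) =
      (∑ a, Real.exp (α * g a) * f a) / ∑ b, Real.exp (α * g b) := by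
  unfold gibbsLaw
  have : ∀ a, IsFiniteMeasure
      (ENNReal.ofReal (Real.exp (α * g a) / ∑ b, Real.exp (α * g b)) • Measure.dirac a) :=
    fun a => Measure.smul_finite _ ENNReal.ofReal_ne_top
  rw [integral_finsetSum_measure fun a _ => Integrable.of_finite]
  simp only [integral_smul_measure, integral_dirac, smul_eq_mul]
  rw [Finset.sum_div]
  refine Finset.sum_congr rfl fun a _ => ?_
  rw [ENNReal.toReal_ofReal (by positivity)]
  ring

/-- Hoeffding's lemma: an interval of length `R` has variance proxy `R²/4`, whence the 8. -/
lemma integral_exp_le [MeasurableSingletonClass A] (μ : Measure A)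
    [IsProbabilityMeasure μ] (α : ℝ) {q : A → ℝ}
    {lo R : ℝ} (hR : 0 ≤ R) (hq : ∀ a, q a ∈ Set.Icc lo (lo + R)) :
    ∫ a, Real.exp (α * q a) ∂μ ≤ Real.exp (α * ∫ a, q a ∂μ + α ^ 2 * R ^ 2 / 8) := by
  have h := (hasSubgaussianMGF_of_mem_Icc (μ := μ) (X := q) Measurable.of_discrete.aemeasurable
    (Filter.Eventually.of_forall hq)).mgf_le α
  unfold mgf at h
  have e : ∀ a, Real.exp (α * (q a - ∫ a, q a ∂μ)) =
      Real.exp (α * q a) * Real.exp (-(α * ∫ a, q a ∂μ)) := fun a => by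
    rw [← Real.exp_add]; congr 1; ring
  simp_rw [e] at h
  rw [integral_mul_const, Real.exp_neg, ← div_eq_mul_inv, div_le_iff₀ (Real.exp_pos _),
    ← Real.exp_add] at h
  refine h.trans (le_of_eq ?_)
  congr 1
  push_cast
  rw [add_sub_cancel_left, Real.norm_of_nonneg hR]
  ring

/-- Regret of exponential weights against a fixed action. -/
lemma exponential_weights_regret [MeasurableSingletonClass A] [Nonempty A] {α : ℝ}
    (hα : 0 < α) (q : ℕ → A → ℝ) {lo R : ℝ}
    (hR : 0 ≤ R) (K : ℕ) (hq : ∀ k < K, ∀ a, q k a ∈ Set.Icc lo (lo + R)) (a : A) :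
    ∑ k ∈ Finset.range K, (q k a - ∫ b, q k b ∂(gibbsLaw α fun b => ∑ j ∈ Finset.range k, q j b)) ≤
      Real.log (Fintype.card A) / α + K * α * R ^ 2 / 8 := by
  set Z : ℕ → ℝ := fun k => ∑ b, Real.exp (α * ∑ j ∈ Finset.range k, q j b) with hZ
  have hZ0 : ∀ k, 0 < Z k := fun k =>
    Finset.sum_pos (fun a _ => Real.exp_pos _) Finset.univ_nonempty
  -- `Z (k+1) / Z k` is the Gibbs mean of `exp (α q_k)`, so the potential `log Z` grows by at most
  -- the Hoeffding bound.
  have hstep : ∀ k < K, Real.log (Z (k + 1)) - Real.log (Z k) ≤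
      α * ∫ b, q k b ∂(gibbsLaw α fun b => ∑ j ∈ Finset.range k, q j b) + α ^ 2 * R ^ 2 / 8 := by
    intro k hk
    have := isProbabilityMeasure_gibbsLaw α fun b => ∑ j ∈ Finset.range k, q j b
    have h1 := integral_exp_le (gibbsLaw α fun b => ∑ j ∈ Finset.range k, q j b) α hR (hq k hk)
    rw [integral_gibbsLaw α (fun b => ∑ j ∈ Finset.range k, q j b)
      (fun b => Real.exp (α * q k b))] at h1
    have e : ∑ b, Real.exp (α * ∑ j ∈ Finset.range k, q j b) * Real.exp (α * q k b) =
        Z (k + 1) := by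
      refine Finset.sum_congr rfl fun b _ => ?_
      rw [← Real.exp_add, Finset.sum_range_succ, mul_add]
    rw [e] at h1
    rw [← Real.log_div (hZ0 _).ne' (hZ0 _).ne']
    exact (Real.log_le_iff_le_exp (div_pos (hZ0 _) (hZ0 _))).2 h1
  have htel : Real.log (Z K) - Real.log (Z 0) ≤ ∑ k ∈ Finset.range K,
      (α * ∫ b, q k b ∂(gibbsLaw α fun b => ∑ j ∈ Finset.range k, q j b) + α ^ 2 * R ^ 2 / 8) := by
    rw [← Finset.sum_range_sub (fun k => Real.log (Z k))]
    exact Finset.sum_le_sum fun k hk => hstep k (Finset.mem_range.1 hk)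
  -- The partition function is at least its summand at the comparator `a`.
  have hK : α * ∑ k ∈ Finset.range K, q k a ≤ Real.log (Z K) := by
    rw [Real.le_log_iff_exp_le (hZ0 K)]
    exact Finset.single_le_sum (f := fun b => Real.exp (α * ∑ j ∈ Finset.range K, q j b))
      (fun b _ => (Real.exp_pos _).le) (Finset.mem_univ a)
  have h0 : Z 0 = Fintype.card A := by simp [hZ]
  rw [h0] at htel
  rw [Finset.sum_add_distrib, ← Finset.mul_sum, Finset.sum_const, Finset.card_range,
    nsmul_eq_mul] at htel
  rw [Finset.sum_sub_distrib]
  set X := ∑ k ∈ Finset.range K, q k a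
  set Y := ∑ k ∈ Finset.range K, ∫ b, q k b ∂(gibbsLaw α fun b => ∑ j ∈ Finset.range k, q j b)
  have h1 : α * (X - Y) ≤ Real.log (Fintype.card A) + K * (α ^ 2 * R ^ 2 / 8) := by linarith
  have h2 : Real.log (Fintype.card A) / α + K * α * R ^ 2 / 8 =
      (Real.log (Fintype.card A) + K * (α ^ 2 * R ^ 2 / 8)) / α := by
    field_simp
  rw [h2, le_div_iff₀ hα]
  linarith

/-- Allows arbitrary measurable preferences; those of the virtual policies are not linear in the
features. -/
lemma exists_gibbsPolicy [Nonempty A] {S : Type*} [MeasurableSpace S] (α : ℝ) (G : S → A → ℝ)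
    (hG : ∀ a, Measurable fun s => G s a) :
    ∃ ν : Policy S A, ∀ s, ν.kernel s = gibbsLaw α (G s) := by
  refine ⟨⟨⟨fun s => gibbsLaw α (G s), ?_⟩, ⟨fun s => isProbabilityMeasure_gibbsLaw α (G s)⟩⟩,
    fun s => rfl⟩
  refine Measure.measurable_of_measurable_coe _ fun B _ => ?_
  simp only [gibbsLaw, Measure.coe_finsetSum, Finset.sum_apply, Measure.smul_apply, smul_eq_mul]
  refine Finset.measurable_fun_sum _ fun a _ => Measurable.mul_const ?_ _
  refine Measurable.ennreal_ofReal ?_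
  exact ((hG a).const_mul α).exp.div
    (Finset.measurable_fun_sum _ fun b _ => ((hG b).const_mul α).exp)

end Gibbs

/-! ### Approximate policy iteration -/

section PolicyIteration

/-- Apply the hypothesis to the supremum, which is finite because `f` is bounded above. This
replaces an unrolling over discounted occupancy measures. -/
lemma le_of_contraction {S : Type u} {f : S → ℝ} {B c Γ : ℝ} (hS : Nonempty S) (hc : c < 1)
    (hB : ∀ s, f s ≤ B) (h : ∀ b, (∀ s, f s ≤ b) → ∀ s, f s ≤ c * b + Γ) (s : S) :
    f s ≤ Γ / (1 - c) := by
  have hbdd : BddAbove (Set.range f) := ⟨B, by rintro _ ⟨s, rfl⟩; exact hB s⟩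
  have h1 : sSup (Set.range f) ≤ c * sSup (Set.range f) + Γ :=
    csSup_le (Set.range_nonempty f) (by
      rintro _ ⟨s, rfl⟩
      exact h _ (fun t => le_csSup hbdd ⟨t, rfl⟩) s)
  refine (le_csSup hbdd ⟨s, rfl⟩).trans ?_
  rw [le_div_iff₀ (by linarith)]
  linarith

variable {A : Type v} [Fintype A] [MeasurableSpace A] [MeasurableSingletonClass A]

lemma abs_integral_sub_le {μ : Measure A} [IsProbabilityMeasure μ] {f g : A → ℝ} {η : ℝ}
    (h : ∀ a, |f a - g a| ≤ η) : |∫ a, f a ∂μ - ∫ a, g a ∂μ| ≤ η := by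
  rw [← integral_sub Integrable.of_finite Integrable.of_finite]
  have := norm_integral_le_of_norm_le_const (μ := μ) (f := fun a => f a - g a)
    (Filter.Eventually.of_forall h)
  simpa using this

/-- Sub-optimality of policy iteration with exponential weights, an arbitrary initial policy and
uniformly accurate value estimates. -/
lemma politex_regret [Nonempty A] {S : Type u} [MeasurableSpace S] (M : MDP S A) {α : ℝ}
    (hα : 0 < α) {K : ℕ} (hK : 0 < K)
    (ν : ℕ → Policy S A) (q : ℕ → S → A → ℝ) {η : ℝ} (hη : 0 ≤ η)
    (hν : ∀ k, k + 1 < K →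
      ∀ s, (ν (k + 1)).kernel s = gibbsLaw α fun a => ∑ j ∈ Finset.range (k + 1), q j s a)
    (hq : ∀ k < K, ∀ s a, |q k s a - M.qvalue (ν k) s a| ≤ η) (π : Policy S A) (s : S) :
    ∑ k ∈ Finset.range K, (M.value π s - M.value (ν k) s) ≤
      (Real.log (Fintype.card A) / α + K * α * (1 / (1 - M.γ) + 2 * η) ^ 2 / 8 +
        (1 / (1 - M.γ) + 2 * η) + 2 * η * K) / (1 - M.γ) := by
  set R := 1 / (1 - M.γ) + 2 * η with hR
  have hγ := M.one_sub_pos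
  have hR0 : 0 ≤ R := by positivity
  -- Accurate estimates lie within `η` of the range of action values, an interval of length `R`;
  -- clipping is therefore unnecessary.
  have hqI : ∀ k < K, ∀ s a, q k s a ∈ Set.Icc (-η) (-η + R) := by
    intro k hk s a
    have h1 := abs_le.1 (hq k hk s a)
    have h2 := M.qvalue_mem (ν k) s a
    constructor <;> [linarith [h2.1]; linarith [h2.2]]
  set Γ := Real.log (Fintype.card A) / α + K * α * R ^ 2 / 8 + R + 2 * η * K with hΓ
  -- the advantage of the comparator
  have hadv : ∀ s, ∑ k ∈ Finset.range K, (∫ a, M.qvalue (ν k) s a ∂(π.kernel s) -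
      ∫ a, M.qvalue (ν k) s a ∂((ν k).kernel s)) ≤ Γ := by
    intro s
    -- Estimated instead of exact action values cost `η` under each of the two policies. Policy 0 is
    -- arbitrary and need not be the Gibbs law without data; this mismatch costs at most the range
    -- `R`.
    have h1 : ∀ k ∈ Finset.range K, ∫ a, M.qvalue (ν k) s a ∂(π.kernel s) -
        ∫ a, M.qvalue (ν k) s a ∂((ν k).kernel s) ≤
        (∫ a, q k s a ∂(π.kernel s) -
          ∫ b, q k s b ∂(gibbsLaw α fun b => ∑ j ∈ Finset.range k, q j s b)) + 2 * η +
          (if k = 0 then R else 0) := by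
      intro k hk
      have hk := Finset.mem_range.1 hk
      have e1 := abs_le.1 (abs_integral_sub_le (μ := π.kernel s) (hq k hk s))
      have e2 := abs_le.1 (abs_integral_sub_le (μ := (ν k).kernel s) (hq k hk s))
      cases k with
      | zero =>
        simp only [if_true]
        have := isProbabilityMeasure_gibbsLaw α fun b => ∑ j ∈ Finset.range 0, q j s b
        have e3 := integral_mem_Icc (μ := (ν 0).kernel s) Measurable.of_discrete (hqI 0 hk s)
        have e4 := integral_mem_Icc
          (μ := gibbsLaw α fun b => ∑ j ∈ Finset.range 0, q j s b) Measurable.of_discrete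
          (hqI 0 hk s)
        linarith [e3.1, e4.2, e3.2, e4.1]
      | succ k =>
        rw [if_neg (Nat.succ_ne_zero k), ← hν k hk s]
        linarith
    refine (Finset.sum_le_sum h1).trans ?_
    rw [Finset.sum_add_distrib, Finset.sum_add_distrib, Finset.sum_ite_eq' _ 0,
      if_pos (Finset.mem_range.2 hK), Finset.sum_const, Finset.card_range, nsmul_eq_mul]
    -- The regret bound against fixed actions is averaged over the comparator's law at `s`.
    have h2 : ∑ k ∈ Finset.range K, (∫ a, q k s a ∂(π.kernel s) -
          ∫ b, q k s b ∂(gibbsLaw α fun b => ∑ j ∈ Finset.range k, q j s b)) =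
        ∫ a, ∑ k ∈ Finset.range K, (q k s a -
          ∫ b, q k s b ∂(gibbsLaw α fun b => ∑ j ∈ Finset.range k, q j s b)) ∂(π.kernel s) := by
      rw [integral_finsetSum _ fun k _ => Integrable.of_finite]
      refine Finset.sum_congr rfl fun k _ => ?_
      rw [integral_sub Integrable.of_finite Integrable.of_finite]
      simp
    have h3 : ∫ a, ∑ k ∈ Finset.range K, (q k s a -
          ∫ b, q k s b ∂(gibbsLaw α fun b => ∑ j ∈ Finset.range k, q j s b)) ∂(π.kernel s) ≤
        Real.log (Fintype.card A) / α + K * α * R ^ 2 / 8 := by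
      have := integral_mono (μ := π.kernel s) Integrable.of_finite Integrable.of_finite
        (fun a => exponential_weights_regret hα (fun k => q k s) hR0 K
          (fun k hk => hqI k hk s) a)
      simpa using this
    rw [h2, hΓ]
    linarith
  set f : S → ℝ := fun s => ∑ k ∈ Finset.range K, (M.value π s - M.value (ν k) s) with hf
  have hfm : Measurable f := Finset.measurable_fun_sum _ fun k _ =>
    (M.measurable_value π).sub (M.measurable_value (ν k))
  have hfb : ∀ s, f s ≤ K * (1 / (1 - M.γ)) := by
    intro s
    calc f s ≤ ∑ k ∈ Finset.range K, (1 / (1 - M.γ)) := Finset.sum_le_sum fun k _ => by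
          linarith [(M.value_mem π s).2, (M.value_mem (ν k) s).1]
      _ = _ := by simp
  have hfb' : ∀ s, -(K * (1 / (1 - M.γ))) ≤ f s := by
    intro s
    calc -(K * (1 / (1 - M.γ))) = ∑ k ∈ Finset.range K, -(1 / (1 - M.γ)) := by simp
      _ ≤ f s := Finset.sum_le_sum fun k _ => by
          linarith [(M.value_mem π s).1, (M.value_mem (ν k) s).2]
  refine le_of_contraction (f := f) ⟨s⟩ M.γ_lt_one hfb (fun b hb s => ?_) s
  -- the performance difference recursion
  have hrec : f s = M.γ * ∫ a, ∫ y, f y ∂(M.P (s, a)) ∂(π.kernel s) +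
      ∑ k ∈ Finset.range K, (∫ a, M.qvalue (ν k) s a ∂(π.kernel s) -
        ∫ a, M.qvalue (ν k) s a ∂((ν k).kernel s)) := by
    have hsum : ∀ a, ∫ y, f y ∂(M.P (s, a)) = ∑ k ∈ Finset.range K,
        (∫ y, M.value π y ∂(M.P (s, a)) - ∫ y, M.value (ν k) y ∂(M.P (s, a))) := by
      intro a
      have hi : ∀ π', Integrable (M.value π') (M.P (s, a)) := fun π' =>
        integrable_of_mem_Icc (M.measurable_value π') (M.value_mem π')
      simp only [hf]
      rw [integral_finsetSum (f := fun k s => M.value π s - M.value (ν k) s) _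
        fun k _ => (hi π).sub (hi (ν k))]
      exact Finset.sum_congr rfl fun k _ => integral_sub (hi π) (hi (ν k))
    simp_rw [hsum]
    rw [integral_finsetSum _ fun k _ => Integrable.of_finite, Finset.mul_sum,
      ← Finset.sum_add_distrib]
    refine Finset.sum_congr rfl fun k _ => ?_
    rw [← integral_const_mul, ← add_sub_assoc, ← integral_add Integrable.of_finite
      Integrable.of_finite, M.value_eq_integral_qvalue (ν k) s, M.value_eq_integral_qvalue π s]
    congr 1
    refine integral_congr_ae (Filter.Eventually.of_forall fun a => ?_)
    simp only [MDP.qvalue]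
    ring
  rw [hrec]
  refine add_le_add (mul_le_mul_of_nonneg_left ?_ M.γ_nonneg) (hadv s)
  have hI : ∀ a, ∫ y, f y ∂(M.P (s, a)) ≤ b := fun a =>
    (integral_mem_Icc hfm fun y => ⟨hfb' y, hb y⟩).2
  have := integral_mono (μ := π.kernel s) Integrable.of_finite Integrable.of_finite hI
  simpa using this

end PolicyIteration

/-! ### Specifications of programs -/

namespace Prog

section Spec

variable {S : Type u} {Act : Type v}

/-- Starting with access to the states in `V`, all runs of the program only use accessible states,
make at most `Q` queries and `T` steps, and satisfy the postcondition, which may depend on the set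
of states that are accessible at the end. -/
def Spec {α : Type w} : Prog S Act α → Set S → ℕ → ℕ → (α → Set S → Prop) → Prop
  | ret x, V, _, _, P => P x V
  | work c p, V, Q, T, P => c ≤ T ∧ p.Spec V Q (T - c) P
  | query s _ k, V, Q, T, P =>
    s ∈ V ∧ 1 ≤ Q ∧ 1 ≤ T ∧ ∀ y r, (k y r).Spec (insert y V) (Q - 1) (T - 1) P
  | draw n _ k, V, Q, T, P => n ≤ T ∧ ∀ i, (k i).Spec V Q (T - n) P
  | initial s k, V, Q, T, P => s ∈ V ∧ 1 ≤ T ∧ ∀ a, (k a).Spec V Q (T - 1) P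

lemma Spec.mono {α : Type w} {p : Prog S Act α} {V : Set S} {Q Q' T T' : ℕ}
    {P P' : α → Set S → Prop} (h : p.Spec V Q T P) (hQ : Q ≤ Q') (hT : T ≤ T')
    (hP : ∀ x V', V ⊆ V' → P x V' → P' x V') : p.Spec V Q' T' P' := by
  induction p generalizing V Q Q' T T' with
  | ret x => exact hP x V subset_rfl h
  | work c p ih => exact ⟨h.1.trans hT, ih h.2 hQ (by omega) hP⟩
  | query s a k ih =>
    obtain ⟨h1, h2, h3, h4⟩ := h
    exact ⟨h1, h2.trans hQ, h3.trans hT, fun y r => ih y r (h4 y r) (by omega) (by omega)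
      fun x V' hV => hP x V' ((Set.subset_insert y V).trans hV)⟩
  | draw n w k ih => exact ⟨h.1.trans hT, fun i => ih i (h.2 i) hQ (by omega) hP⟩
  | initial s k ih =>
    exact ⟨h.1, h.2.1.trans hT, fun a => ih a (h.2.2 a) hQ (by omega) hP⟩

lemma Spec.bind {α : Type w₁} {β : Type w₂} {p : Prog S Act α} {k : α → Prog S Act β}
    {V : Set S} {Q₁ Q₂ T₁ T₂ : ℕ} {P₁ : α → Set S → Prop} {P₂ : β → Set S → Prop}
    (h : p.Spec V Q₁ T₁ P₁)
    (hk : ∀ x V', V ⊆ V' → P₁ x V' → (k x).Spec V' Q₂ T₂ P₂) :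
    (p.bind k).Spec V (Q₁ + Q₂) (T₁ + T₂) P₂ := by
  induction p generalizing V Q₁ T₁ with
  | ret x => exact (hk x V subset_rfl h).mono (by omega) (by omega) fun _ _ _ h => h
  | work c p ih =>
    refine ⟨by have := h.1; omega, ?_⟩
    exact (ih h.2 hk).mono le_rfl (by have := h.1; omega) fun _ _ _ h => h
  | query s a q ih =>
    obtain ⟨h1, h2, h3, h4⟩ := h
    refine ⟨h1, by omega, by omega, fun y r => ?_⟩
    exact (ih y r (h4 y r) fun x V' hV => hk x V' ((Set.subset_insert y V).trans hV)).mono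
      (by omega) (by omega) fun _ _ _ h => h
  | draw n w q ih =>
    refine ⟨by have := h.1; omega, fun i => ?_⟩
    exact (ih i (h.2 i) hk).mono le_rfl (by have := h.1; omega) fun _ _ _ h => h
  | initial s q ih =>
    obtain ⟨h1, h2, h3⟩ := h
    refine ⟨h1, by omega, fun a => ?_⟩
    exact (ih a (h3 a) hk).mono le_rfl (by omega) fun _ _ _ h => h

lemma Spec.exec {α : Type w} {x : Timed α} {V : Set S} {Q T : ℕ} {P : α → Set S → Prop}
    (hT : x.cost ≤ T) (h : P x.val V) : (Prog.exec x : Prog S Act α).Spec V Q T P :=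
  ⟨hT, h⟩

lemma Spec.query {α : Type w} {s : S} {a : Act} {k : S → ℝ → Prog S Act α} {V : Set S} {Q T : ℕ}
    {P : α → Set S → Prop} (hs : s ∈ V) (h : ∀ y r, (k y r).Spec (insert y V) Q T P) :
    (Prog.query s a k).Spec V (Q + 1) (T + 1) P :=
  ⟨hs, by omega, by omega, h⟩

lemma Spec.localAccess {α : Type w} {p : Prog S Act α} {V : Set S} {Q T : ℕ}
    {P : α → Set S → Prop} (h : p.Spec V Q T P) : p.LocalAccess V := by
  induction p generalizing V Q T with
  | ret x => trivial
  | work c p ih => exact ih h.2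
  | query s a k ih => exact ⟨h.1, fun y r => ih y r (h.2.2.2 y r)⟩
  | draw n w k ih => exact fun i => ih i (h.2 i)
  | initial s k ih => exact ⟨h.1, fun a => ih a (h.2.2 a)⟩

variable [MeasurableSpace S] [MeasurableSpace Act]

lemma Spec.run {α : Type w} {p : Prog S Act α} {V : Set S} {Q T : ℕ}
    {P : α → Set S → Prop} (h : p.Spec V Q T P) {M : MDP S Act} {x : α} {q t : ℕ}
    (hr : p.Run M x q t) : q ≤ Q ∧ t ≤ T ∧ ∃ V', P x V' := by
  induction hr generalizing V Q T with
  | ret x => exact ⟨by omega, by omega, V, h⟩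
  | work hr ih =>
    obtain ⟨h1, h2, h3⟩ := ih h.2
    exact ⟨h1, by have := h.1; omega, h3⟩
  | query y hr ih =>
    obtain ⟨g1, g2, g3, g4⟩ := h
    obtain ⟨h1, h2, h3⟩ := ih (g4 y _)
    exact ⟨by omega, by omega, h3⟩
  | draw i hr ih =>
    obtain ⟨h1, h2, h3⟩ := ih (h.2 i)
    exact ⟨h1, by have := h.1; omega, h3⟩
  | initial a hr ih =>
    obtain ⟨g1, g2, g3⟩ := h
    obtain ⟨h1, h2, h3⟩ := ih (g3 a)
    exact ⟨h1, by omega, h3⟩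

lemma Spec.expect_le {α : Type w} {p : Prog S Act α} {V : Set S} {Q T : ℕ}
    {P : α → Set S → Prop} (h : p.Spec V Q T P) (M : MDP S Act) (π₀ : Policy S Act)
    {f g : α → ℝ≥0∞} (hfg : ∀ x V', P x V' → f x ≤ g x) :
    p.expect M π₀ f ≤ p.expect M π₀ g := by
  induction p generalizing V Q T with
  | ret x => exact hfg x V h
  | work c p ih => exact ih h.2
  | query s a k ih => exact lintegral_mono fun y => ih y _ (h.2.2.2 y _)
  | draw n w k ih => exact Finset.sum_le_sum fun i _ => mul_le_mul_right (ih i (h.2 i)) _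
  | initial s k ih => exact lintegral_mono fun a => ih a (h.2.2 a)

/-- A property of all runs can be added to an event without loss of probability. This provides,
after a restart, that the new element came from a failed check. -/
lemma Spec.prob_inter {α : Type w} {p : Prog S Act α} {V : Set S} {Q T : ℕ}
    {P : α → Set S → Prop} (h : p.Spec V Q T P) (M : MDP S Act) (π₀ : Policy S Act)
    (E : Set α) : p.prob M π₀ E ≤ p.prob M π₀ {x | x ∈ E ∧ ∃ V', P x V'} := by
  refine h.expect_le M π₀ fun x V' hx => ?_
  by_cases hE : x ∈ E
  · have : x ∈ {x | x ∈ E ∧ ∃ V', P x V'} := ⟨hE, V', hx⟩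
    simp [hE, this]
  · simp [hE]

end Spec

end Prog

/-! ### Costs of the deterministic computations -/

section Costs

variable {d : ℕ}

lemma cost_matVec (A : Matrix (Fin d) (Fin d) ℝ) (x : Fin d → ℝ) :
    (Timed.matVec A x).cost = 2 * d * d := by
  simp [Timed.matVec, Timed.tabulate, Timed.dot, Timed.sum, Timed.mul]
  ring

lemma cost_dot (x y : Fin d → ℝ) : (Timed.dot x y).cost = 2 * d := by
  simp [Timed.dot, Timed.sum, Timed.mul]
  ring

lemma cost_gramInv (reg : ℝ) (L : List (Fin d → ℝ)) :
    (Timed.gramInv reg L).cost = d * d + L.length * (5 * d * d + 2 * d + 1) := by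
  induction L with
  | nil =>
    have : ∀ i j : Fin d, (if i = j then Timed.div 1 reg else Timed.read 0).cost = 1 := by
      intro i j
      split_ifs <;> rfl
    simp [Timed.gramInv, Timed.tabulate, this]
  | cons x L ih =>
    simp only [Timed.gramInv, Timed.bind, ih, cost_matVec, cost_dot, Timed.tabulate, Timed.add,
      Timed.mul, Timed.div, Timed.sub, List.length_cons]
    simp
    ring

lemma cost_featTargets (l : List ((Fin d → ℝ) × ℝ)) :
    (Timed.featTargets l).cost = d + l.length * (2 * d) := by
  induction l with
  | nil => simp [Timed.featTargets, Timed.tabulate, Timed.read]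
  | cons p l ih =>
    simp [Timed.featTargets, Timed.bind, ih, Timed.tabulate, Timed.mul, Timed.add]
    ring

variable {S : Type u} [MeasurableSpace S] {m : ℕ} {N : Fin m → ℕ}

lemma cost_jointFeature (F : Features S d N) (s : S) (a : Joint N) :
    (jointFeature F s a).cost = 2 * d * m := by
  simp [jointFeature, Timed.tabulate, Timed.sum, Timed.read]
  ring

lemma jointFeature_val (F : Features S d N) (s : S) (a : Joint N) :
    (jointFeature F s a).val = F.joint s a := by
  ext l
  simp [jointFeature, Timed.tabulate, Timed.sum, Timed.read, Features.joint]

/-- Bound on the cost of an uncertainty check with at most `ℓ` core set elements. -/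
def davCost (d m A ℓ : ℕ) : ℕ :=
  d * d + ℓ * (5 * d * d + 2 * d + 1) + A * (m + 2 * d * m + 2 * d * d + 2 * d + 1)

lemma davSearch_cons (I : Input S d N) (B : Matrix (Fin d) (Fin d) ℝ) (s : S)
    (p : (j : Fin m) × Fin (N j)) (L : List ((j : Fin m) × Fin (N j))) :
    davSearch I B s (p :: L) =
      (⟨Function.update I.abar p.1 p.2, m⟩ : Timed (Joint N)).bind fun a =>
      (jointFeature I.feat s a).bind fun x =>
      (Timed.matVec B x).bind fun y =>
      (Timed.dot x y).bind fun c =>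
      (Timed.less I.thr c).bind fun big =>
      if big then Timed.pure (some ⟨s, a, x⟩) else davSearch I B s L := rfl

lemma cost_ite_le {α : Type*} {b : Bool} {x y : Timed α} {c : ℕ} (hx : x.cost ≤ c)
    (hy : y.cost ≤ c) : (if b then x else y).cost ≤ c := by
  cases b <;> assumption

lemma cost_davSearch_le (I : Input S d N) (B : Matrix (Fin d) (Fin d) ℝ) (s : S)
    (L : List ((j : Fin m) × Fin (N j))) :
    (davSearch I B s L).cost ≤ L.length * (m + 2 * d * m + 2 * d * d + 2 * d + 1) := by
  induction L with
  | nil => simp [davSearch, Timed.pure]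
  | cons p L ih =>
    rw [davSearch_cons]
    simp only [Timed.bind, cost_jointFeature, cost_matVec, cost_dot, Timed.less, List.length_cons]
    have h := fun b z => cost_ite_le (b := b) (x := Timed.pure (some z)) (Nat.zero_le _) ih
    refine (Nat.add_le_add_left (Nat.add_le_add_left (Nat.add_le_add_left (Nat.add_le_add_left
      (Nat.add_le_add_left (h _ _) _) _) _) _) _).trans (le_of_eq ?_)
    ring

lemma length_componentActions (N : Fin m → ℕ) :
    (componentActions N).length = ∑ i, N i := by
  simp [componentActions, List.length_flatMap, Fin.sum_univ_def]

lemma mem_componentActions (p : (j : Fin m) × Fin (N j)) : p ∈ componentActions N := by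
  simp only [componentActions, List.mem_flatMap, List.mem_map]
  exact ⟨p.1, List.mem_finRange _, p.2, List.mem_finRange _, rfl⟩

lemma cost_davCheck_le (I : Input S d N) (C : List (CoreElt S d N)) (s : S) {ℓ : ℕ}
    (hC : C.length ≤ ℓ) : (davCheck I C s).cost ≤ davCost d m (∑ i, N i) ℓ := by
  simp only [davCheck, Timed.bind, cost_gramInv, List.length_map]
  have h := cost_davSearch_le I (Timed.gramInv I.reg (C.map CoreElt.vec)).val s
    (componentActions N)
  rw [length_componentActions] at h
  exact add_le_add (add_le_add le_rfl (mul_le_mul_left hC _)) h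

lemma cost_leastSquares (I : Input S d N) (l : List ((Fin d → ℝ) × ℝ)) :
    (leastSquares I l).cost =
      d * d + l.length * (5 * d * d + 2 * d + 1) + (d + l.length * (2 * d) + 2 * d * d) := by
  simp only [leastSquares, Timed.bind, cost_gramInv, List.length_map, cost_featTargets,
    cost_matVec]

/-! ### The uncertainty check and core sets -/

lemma davSearch_eq_none_iff (I : Input S d N) (B : Matrix (Fin d) (Fin d) ℝ) (s : S)
    (L : List ((j : Fin m) × Fin (N j))) :
    (davSearch I B s L).val = none ↔
      ∀ p ∈ L, I.feat.joint s (Function.update I.abar p.1 p.2) ⬝ᵥ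
        B.mulVec (I.feat.joint s (Function.update I.abar p.1 p.2)) ≤ I.thr := by
  induction L with
  | nil => simp [davSearch, Timed.pure]
  | cons p L ih =>
    rw [davSearch_cons]
    simp only [Timed.bind, jointFeature_val, Timed.less, List.forall_mem_cons]
    set c := (Timed.dot (I.feat.joint s (Function.update I.abar p.1 p.2))
      (Timed.matVec B (I.feat.joint s (Function.update I.abar p.1 p.2))).val).val with hc
    have hc' : c = I.feat.joint s (Function.update I.abar p.1 p.2) ⬝ᵥ
        B.mulVec (I.feat.joint s (Function.update I.abar p.1 p.2)) := rfl
    rw [← hc']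
    by_cases h : I.thr < c
    · simp [h, Timed.pure]
    · simp only [h, decide_false, Bool.false_eq_true, if_false, ih]
      simp [not_lt.1 h]

lemma davSearch_eq_some (I : Input S d N) (B : Matrix (Fin d) (Fin d) ℝ) (s : S)
    (L : List ((j : Fin m) × Fin (N j))) {z : CoreElt S d N}
    (hz : (davSearch I B s L).val = some z) :
    z.state = s ∧ z.vec = I.feat.joint s z.act ∧ I.thr < z.vec ⬝ᵥ B.mulVec z.vec := by
  induction L with
  | nil => simp [davSearch, Timed.pure] at hz
  | cons p L ih =>
    rw [davSearch_cons] at hz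
    simp only [Timed.bind, jointFeature_val, Timed.less] at hz
    split_ifs at hz with h
    · simp only [Timed.pure, Option.some.injEq] at hz
      subst hz
      exact ⟨rfl, rfl, of_decide_eq_true h⟩
    · exact ih hz

lemma davCheck_eq_none_iff (I : Input S d N) (hreg : 0 < I.reg) (C : List (CoreElt S d N))
    (s : S) : (davCheck I C s).val = none ↔
      ∀ (j : Fin m) (c : Fin (N j)),
        invSq I.reg (C.map CoreElt.vec) (I.feat.joint s (Function.update I.abar j c)) ≤ I.thr := by
  have h := davSearch_eq_none_iff I (Timed.gramInv I.reg (C.map CoreElt.vec)).val s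
    (componentActions N)
  rw [gramInv_val hreg] at h
  simp only [davCheck, Timed.bind]
  rw [gramInv_val hreg, h]
  exact ⟨fun h j c => h ⟨j, c⟩ (mem_componentActions _), fun h p _ => h p.1 p.2⟩

lemma davCheck_eq_some (I : Input S d N) (hreg : 0 < I.reg) (C : List (CoreElt S d N))
    (s : S) {z : CoreElt S d N} (hz : (davCheck I C s).val = some z) :
    z.state = s ∧ z.vec = I.feat.joint s z.act ∧
      I.thr < invSq I.reg (C.map CoreElt.vec) z.vec := by
  simp only [davCheck, Timed.bind] at hz
  have h := davSearch_eq_some I _ s (componentActions N) hz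
  rwa [gramInv_val hreg] at h

/-- Certain states stay certain when the core set grows; in particular `ρ` stays certain throughout
the main loop. -/
lemma davCheck_append_eq_none (I : Input S d N) (hreg : 0 < I.reg) (C : List (CoreElt S d N))
    (s : S) (z : CoreElt S d N) (h : (davCheck I C s).val = none) :
    (davCheck I (C ++ [z]) s).val = none := by
  rw [davCheck_eq_none_iff I hreg] at h ⊢
  intro j c
  rw [List.map_append]
  exact (invSq_append_le hreg _ _ _).trans (h j c)

/-- Needed for the virtual policies to be kernels, since their estimates are defined by cases on the
check. -/
lemma measurableSet_certain (I : Input S d N) (hreg : 0 < I.reg) (C : List (CoreElt S d N)) :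
    MeasurableSet {s | (davCheck I C s).val = none} := by
  simp_rw [davCheck_eq_none_iff I hreg]
  have hm : ∀ (a : Joint N) (l : Fin d), Measurable fun s => I.feat.joint s a l := by
    intro a l
    have h1 : ∀ (i : Fin m), Measurable fun s => I.feat.φ i s (a i) l := fun i =>
      (measurable_pi_apply l).comp (I.feat.measurable_φ i (a i))
    simp only [Features.joint, Finset.sum_apply]
    fun_prop
  have : {s | ∀ (j : Fin m) (c : Fin (N j)), invSq I.reg (C.map CoreElt.vec)
      (I.feat.joint s (Function.update I.abar j c)) ≤ I.thr} =
      ⋂ j, ⋂ c, {s | invSq I.reg (C.map CoreElt.vec)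
        (I.feat.joint s (Function.update I.abar j c)) ≤ I.thr} := by
    ext s
    simp
  rw [this]
  refine MeasurableSet.iInter fun j => MeasurableSet.iInter fun c =>
    measurableSet_le ?_ measurable_const
  simp only [invSq, dotProduct, Matrix.mulVec]
  have := hm (Function.update I.abar j c)
  fun_prop

/-- Core sets that arise by adding uncertain elements. -/
structure CoreValid (I : Input S d N) (C : List (CoreElt S d N)) : Prop where
  vec_eq : ∀ z ∈ C, z.vec = I.feat.joint z.state z.act
  det_ge : ((C.length : ℝ) - 1) * Real.log 2 + d * Real.log I.reg ≤
    Real.log (gram I.reg (C.map CoreElt.vec)).det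

/-- The initial pair has failed no check, so its determinant factor is only known to be at least 1;
this explains the `- 1` in `det_ge`. -/
lemma coreValid_singleton (I : Input S d N) (hreg : 0 < I.reg) (s : S) (a : Joint N) :
    CoreValid I [⟨s, a, I.feat.joint s a⟩] := by
  refine ⟨by simp, ?_⟩
  have h := log_det_gram_append hreg [] (I.feat.joint s a)
  rw [log_det_gram_nil] at h
  simp only [List.nil_append] at h
  simp only [List.length_singleton, Nat.cast_one, sub_self, zero_mul, zero_add, List.map_cons,
    List.map_nil]
  rw [h]
  have := Real.log_nonneg (x := 1 + invSq I.reg [] (I.feat.joint s a))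
    (by linarith [invSq_nonneg hreg [] (I.feat.joint s a)])
  linarith

/-- With threshold 1, a failed check gives a determinant factor `1 + invSq` above 2. -/
lemma CoreValid.append {I : Input S d N} {C : List (CoreElt S d N)} (h : CoreValid I C)
    (hreg : 0 < I.reg) (hthr : I.thr = 1) {s : S} {z : CoreElt S d N}
    (hz : (davCheck I C s).val = some z) : CoreValid I (C ++ [z]) := by
  obtain ⟨h1, h2, h3⟩ := davCheck_eq_some I hreg C s hz
  constructor
  · intro y hy
    rcases List.mem_append.1 hy with hy | hy
    · exact h.vec_eq y hy
    · rw [List.mem_singleton.1 hy, h1, h2]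
  · rw [List.map_append, List.map_singleton, log_det_gram_append hreg, List.length_append,
      List.length_singleton]
    have h4 : Real.log 2 ≤ Real.log (1 + invSq I.reg (C.map CoreElt.vec) z.vec) :=
      Real.log_le_log (by norm_num) (by linarith)
    have := h.det_ge
    push_cast
    linarith

/-- The bound on the size of core sets, in terms of the regularization coefficient. -/
def sizeBound (d : ℕ) (reg : ℝ) : ℝ :=
  Real.exp 1 / (Real.exp 1 - 1) * ((1 + 1) / 1) * d *
    (Real.log (1 + 1 / 1) + Real.log (1 + 1 / reg))

lemma CoreValid.length_le {I : Input S d N} {C : List (CoreElt S d N)} (h : CoreValid I C)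
    (hreg : 0 < I.reg) (hd : 0 < d) (hF : I.feat.Bounded) :
    (C.length : ℝ) ≤ sizeBound d I.reg := by
  have := length_le_coreBound hd hreg (C.map CoreElt.vec) (by
    intro x hx
    obtain ⟨z, hz, rfl⟩ := List.mem_map.1 hx
    rw [h.vec_eq z hz]
    exact hF _ _) (by simpa using h.det_ge)
  simpa [sizeBound] using this

end Costs

/-! ### Specification of the algorithm -/

section AlgorithmSpec

variable {S : Type u} [MeasurableSpace S] {m d : ℕ} {N : Fin m → ℕ} {I : Input S d N}

/-- Cost of sampling from a softmax policy. -/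
def sampleCost (d : ℕ) {m : ℕ} (N : Fin m → ℕ) : ℕ := ∑ i, (N i * (3 * d + 3) + 1)

lemma spec_sampleComponent (W : Fin d → ℝ) (s : S) (i : Fin m) (a : Joint N) (V : Set S) :
    (sampleComponent I W s i a).Spec V 0 (N i * (3 * d + 3) + 1) fun _ _ => True := by
  have hc : ((Timed.tabulate fun c : Fin (N i) =>
    (Timed.tabulate fun l => Timed.read (I.feat.φ i s c l)).bind fun x =>
    (Timed.dot W x).bind fun y =>
    (Timed.mul I.temp y).bind fun e => Timed.exp e)).cost = N i * (3 * d + 2) := by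
    simp only [Timed.tabulate, Timed.bind, cost_dot, Timed.read, Timed.mul, Timed.exp]
    simp
    left
    ring
  unfold sampleComponent
  -- Computing the weights costs `N i * (3d + 2)`, the draw `N i`, setting the component 1.
  refine (Prog.Spec.bind (Q₁ := 0) (Q₂ := 0) (T₁ := N i * (3 * d + 2)) (T₂ := N i + 1)
    (P₁ := fun _ _ => True) (Prog.Spec.exec hc.le trivial) fun ws V' _ _ => ?_).mono le_rfl
    (by ring_nf; omega) fun _ _ _ h => h
  refine ⟨by omega, fun c => Prog.Spec.exec ?_ trivial⟩
  simp

lemma spec_foldl_sampleComponent (W : Fin d → ℝ) (s : S) (V : Set S) (L : List (Fin m))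
    (p : Prog S (Joint N) (Joint N)) {T : ℕ} (hp : p.Spec V 0 T fun _ _ => True) :
    (L.foldl (fun p i => p.bind (sampleComponent I W s i)) p).Spec V 0
      (T + (L.map fun i => N i * (3 * d + 3) + 1).sum) fun _ _ => True := by
  induction L generalizing p T with
  | nil => simpa using hp
  | cons i L ih =>
    rw [List.foldl_cons, List.map_cons, List.sum_cons, ← add_assoc]
    exact ih _ (hp.bind fun x V' _ _ => spec_sampleComponent W s i x V')

lemma spec_sampleSoftmax (W : Fin d → ℝ) (s : S) (V : Set S) :
    (sampleSoftmax I W s).Spec V 0 (sampleCost d N) fun _ _ => True := by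
  have h := spec_foldl_sampleComponent (I := I) W s V (List.finRange m) (Prog.ret I.abar)
    (T := 0) trivial
  rw [zero_add, ← Fin.sum_univ_def] at h
  exact h

lemma spec_samplePolicy (c : Option (Fin d → ℝ)) {s : S} {V : Set S} (hs : s ∈ V) :
    (samplePolicy I c s).Spec V 0 (sampleCost d N + 1) fun _ _ => True := by
  cases c with
  | none => exact ⟨hs, by omega, fun a => trivial⟩
  | some W => exact (spec_sampleSoftmax W s V).mono le_rfl (by omega) fun _ _ _ h => h

/-- Outcomes on the left come from a failed uncertainty check in an accessible state. -/
def FromCheck (I : Input S d N) (C : List (CoreElt S d N)) {X : Type*}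
    (o : CoreElt S d N ⊕ X) (V : Set S) : Prop :=
  ∀ z, o = Sum.inl z → ∃ s ∈ V, (davCheck I C s).val = some z

lemma fromCheck_inr {C : List (CoreElt S d N)} {X : Type*} (x : X) (V : Set S) :
    FromCheck I C (Sum.inr x) V := by
  rintro z ⟨⟩

/-- Cost of one step of a rollout. -/
def stepCost (d : ℕ) {m : ℕ} (N : Fin m → ℕ) (ℓ : ℕ) : ℕ :=
  davCost d m (∑ i, N i) ℓ + sampleCost d N + 5

lemma spec_rolloutSteps (c : Option (Fin d → ℝ)) {C : List (CoreElt S d N)} {ℓ : ℕ}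
    (hC : C.length ≤ ℓ) (h : ℕ) (g acc : ℝ) {s : S} {V : Set S} (hs : s ∈ V) :
    (rolloutSteps I c C h g acc s).Spec V h (h * stepCost d N ℓ) (FromCheck I C) := by
  induction h generalizing g acc s V with
  | zero => exact fromCheck_inr _ _
  | succ h ih =>
    rw [rolloutSteps]
    -- The 5 covers a possible call of the initial policy, the query, and three arithmetic
    -- operations.
    refine (Prog.Spec.bind (Q₁ := 0) (Q₂ := h + 1) (T₁ := davCost d m (∑ i, N i) ℓ)
      (T₂ := h * stepCost d N ℓ + sampleCost d N + 5)
      (P₁ := fun o _ => o = (davCheck I C s).val)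
      (Prog.Spec.exec (cost_davCheck_le I C s hC) rfl) fun o V' hV ho => ?_).mono
      (by omega) (by unfold stepCost; ring_nf; omega) fun _ _ _ h => h
    cases o with
    | some z =>
      rintro y hy
      cases hy
      exact ⟨s, hV hs, ho.symm⟩
    | none =>
      refine (Prog.Spec.bind (spec_samplePolicy c (hV hs)) fun a V'' hV'' _ =>
        Prog.Spec.query (Q := h) (T := h * stepCost d N ℓ + 3) (hV'' (hV hs))
          fun y r => ?_).mono (by omega) (by omega) fun _ _ _ h => h
      refine ⟨?_, ?_, ?_, ?_⟩
      · simp only [Timed.mul]; omega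
      · simp only [Timed.add, Timed.mul]; omega
      · simp only [Timed.mul, Timed.add]; omega
      · exact (ih _ _ (Set.mem_insert y V'')).mono le_rfl
          (by simp only [Timed.mul, Timed.add]; omega) fun _ _ _ h => h

lemma spec_rolloutLoop (c : Option (Fin d → ℝ)) {C : List (CoreElt S d N)} {ℓ : ℕ}
    (hC : C.length ≤ ℓ) (k : ℕ) (tot : ℝ) {z : CoreElt S d N} {V : Set S} (hz : z.state ∈ V) :
    (rolloutLoop I c C z k tot).Spec V (k * (I.H + 1)) (k * (I.H * stepCost d N ℓ + 2))
      (FromCheck I C) := by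
  induction k generalizing tot V with
  | zero => exact fromCheck_inr _ _
  | succ k ih =>
    rw [rolloutLoop]
    refine (Prog.Spec.query (Q := I.H + k * (I.H + 1))
      (T := I.H * stepCost d N ℓ + (1 + k * (I.H * stepCost d N ℓ + 2))) hz
      fun y r => ?_).mono (by ring_nf; omega) (by ring_nf; omega) fun _ _ _ h => h
    refine Prog.Spec.bind (spec_rolloutSteps c hC I.H I.disc r (Set.mem_insert y V))
      fun o V' hV ho => ?_
    cases o with
    | inl x =>
      rintro x' ⟨⟩
      exact ho x rfl
    | inr g =>
      exact Prog.Spec.exec (P := fun _ _ => True) (Q := 0) (x := Timed.add tot g)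
        (T := 1) le_rfl trivial |>.bind (fun x V'' hV'' _ =>
          ih x (hV'' (hV (Set.mem_insert_of_mem y hz)))) |>.mono (by omega) le_rfl
        fun _ _ _ h => h

/-- Cost of the rollouts from one core set element. -/
def rolloutCost (I : Input S d N) (ℓ : ℕ) : ℕ := I.n * (I.H * stepCost d N ℓ + 2) + 1

lemma spec_rollout (c : Option (Fin d → ℝ)) {C : List (CoreElt S d N)} {ℓ : ℕ}
    (hC : C.length ≤ ℓ) {z : CoreElt S d N} {V : Set S} (hz : z.state ∈ V) :
    (rollout I c C z).Spec V (I.n * (I.H + 1)) (rolloutCost I ℓ) (FromCheck I C) := by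
  refine (Prog.Spec.bind (Q₂ := 0) (T₂ := 1) (spec_rolloutLoop c hC I.n 0 hz)
    fun o V' hV ho => ?_).mono (by omega) le_rfl fun _ _ _ h => h
  cases o with
  | inl x =>
    rintro x' ⟨⟩
    exact ho x rfl
  | inr tot => exact ⟨le_rfl, fromCheck_inr _ _⟩

lemma spec_evaluate (c : Option (Fin d → ℝ)) {C : List (CoreElt S d N)} {ℓ : ℕ}
    (hC : C.length ≤ ℓ) (L : List (CoreElt S d N)) {V : Set S} (hL : ∀ z ∈ L, z.state ∈ V) :
    (evaluate I c C L).Spec V (L.length * (I.n * (I.H + 1))) (L.length * rolloutCost I ℓ)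
      fun o V => FromCheck I C o V ∧ ∀ l, o = Sum.inr l → l.length = L.length := by
  induction L generalizing V with
  | nil =>
    refine ⟨fromCheck_inr _ _, ?_⟩
    rintro l ⟨⟩
    rfl
  | cons z L ih =>
    rw [evaluate]
    refine (Prog.Spec.bind (Q₂ := L.length * (I.n * (I.H + 1)))
      (T₂ := L.length * rolloutCost I ℓ) (spec_rollout c hC (hL z List.mem_cons_self))
      fun o V' hV ho => ?_).mono (by rw [List.length_cons, add_mul, one_mul, add_comm])
        (by rw [List.length_cons, add_mul, one_mul, add_comm]) fun _ _ _ h => h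
    cases o with
    | inl x =>
      refine ⟨?_, ?_⟩
      · rintro x' ⟨⟩
        exact ho x rfl
      · rintro l ⟨⟩
    | inr q =>
      refine Prog.Spec.bind (Q₂ := 0) (T₂ := 0)
        (ih fun y hy => hV (hL y (List.mem_cons_of_mem _ hy))) fun o V'' hV'' ho' => ?_
      cases o with
      | inl x =>
        refine ⟨?_, ?_⟩
        · rintro x' ⟨⟩
          exact ho'.1 x rfl
        · rintro l ⟨⟩
      | inr l =>
        refine ⟨fromCheck_inr _ _, ?_⟩
        rintro l' ⟨⟩
        simp [ho'.2 l rfl]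

/-- Cost of one policy iteration with at most `ℓ` core set elements. -/
def iterationCost (I : Input S d N) (ℓ : ℕ) : ℕ :=
  ℓ * rolloutCost I ℓ +
    (d * d + ℓ * (5 * d * d + 2 * d + 1) + (d + ℓ * (2 * d) + 2 * d * d)) + d

lemma spec_iterate {C : List (CoreElt S d N)} {ℓ : ℕ} (hC : C.length ≤ ℓ) (k : ℕ)
    (c : Option (Fin d → ℝ)) (W : Fin d → ℝ) {V : Set S} (hV : ∀ z ∈ C, z.state ∈ V) :
    (iterate I C k c W).Spec V (k * (ℓ * (I.n * (I.H + 1)))) (k * iterationCost I ℓ)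
      fun o V => FromCheck I C o V ∧ ∀ l, o = Sum.inr l → l.length = k := by
  induction k generalizing c W V with
  | zero =>
    refine ⟨fromCheck_inr _ _, ?_⟩
    rintro l ⟨⟩
    rfl
  | succ k ih =>
    rw [iterate]
    set LS := d * d + ℓ * (5 * d * d + 2 * d + 1) + (d + ℓ * (2 * d) + 2 * d * d) with hLS
    have e : ℓ * rolloutCost I ℓ + (LS + (d + k * iterationCost I ℓ)) =
        (k + 1) * iterationCost I ℓ := by
      unfold iterationCost
      rw [← hLS]
      ring
    rw [← e]
    refine (Prog.Spec.bind (Q₁ := ℓ * (I.n * (I.H + 1))) (Q₂ := k * (ℓ * (I.n * (I.H + 1))))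
      (T₂ := LS + (d + k * iterationCost I ℓ))
      ((spec_evaluate c hC C hV).mono (mul_le_mul_left hC _) (mul_le_mul_left hC _)
        fun _ _ _ h => h) fun o V' hV' ho => ?_).mono (by ring_nf; omega) le_rfl fun _ _ _ h => h
    cases o with
    | inl x =>
      refine ⟨?_, ?_⟩
      · rintro x' ⟨⟩
        exact ho.1 x rfl
      · rintro l ⟨⟩
    | inr l =>
      have hl := ho.2 l rfl
      have hcost : (leastSquares I l).cost ≤ LS := by
        rw [cost_leastSquares, hl, hLS]
        gcongr
      refine (Prog.Spec.bind (Q₁ := 0) (P₁ := fun _ _ => True) (Prog.Spec.exec hcost trivial)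
        fun w V₁ hV₁ _ => Prog.Spec.bind (Q₁ := 0) (P₁ := fun _ _ => True)
          (Prog.Spec.exec (T := d) ?_ trivial) fun W₁ V₂ hV₂ _ =>
          Prog.Spec.bind (Q₂ := 0) (T₂ := 0)
            (ih (some W₁) W₁ fun z hz => hV₂ (hV₁ (hV' (hV z hz))))
            fun o V₃ hV₃ ho' => ?_).mono (by omega) (by omega) fun _ _ _ h => h
      · simp [Timed.vecAdd, Timed.tabulate, Timed.add]
      · cases o with
        | inl x =>
          refine ⟨?_, ?_⟩
          · rintro x' ⟨⟩
            exact ho'.1 x rfl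
          · rintro l ⟨⟩
        | inr l =>
          refine ⟨fromCheck_inr _ _, ?_⟩
          rintro l' ⟨⟩
          simp [ho'.2 l rfl]

/-- Each restart lengthens a valid core set, whose length never exceeds `ℓ`, so `ℓ + 1 - C.length`
bounds the remaining passes. The hypothesis on `T` makes the cut-off unreachable. -/
lemma spec_mainLoop (hreg : 0 < I.reg) (hthr : I.thr = 1) {ℓ : ℕ}
    (hℓ : ∀ C, CoreValid I C → C.length ≤ ℓ) (T : ℕ)
    {C : List (CoreElt S d N)} (hC : CoreValid I C) (hT : ℓ + 1 ≤ T + C.length)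
    {V : Set S} (hV : ∀ z ∈ C, z.state ∈ V) :
    (mainLoop I T C).Spec V ((ℓ + 1 - C.length) * (I.K * (ℓ * (I.n * (I.H + 1)))))
      ((ℓ + 1 - C.length) * (I.K * iterationCost I ℓ))
      fun o _ => ∃ l, o = some l ∧ l.length = I.K := by
  induction T generalizing C V with
  | zero => have := hℓ C hC; omega
  | succ T ih =>
    rw [mainLoop]
    have h1 := hℓ C hC
    obtain ⟨j, hj⟩ : ∃ j, ℓ + 1 - C.length = j + 1 := ⟨ℓ - C.length, by omega⟩
    rw [hj]
    refine (Prog.Spec.bind (Q₂ := j * (I.K * (ℓ * (I.n * (I.H + 1)))))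
      (T₂ := j * (I.K * iterationCost I ℓ)) (spec_iterate h1 I.K none 0 hV)
      fun o V' hV' ho => ?_).mono (by ring_nf; omega) (by ring_nf; omega) fun _ _ _ h => h
    cases o with
    | inl z =>
      obtain ⟨s, hs, hz⟩ := ho.1 z rfl
      have hC' := hC.append hreg hthr hz
      have hlen : (C ++ [z]).length = C.length + 1 := by simp
      have hj' : ℓ + 1 - (C ++ [z]).length = j := by omega
      have := ih hC' (by omega) (V := V') (by
        intro y hy
        rcases List.mem_append.1 hy with hy | hy
        · exact hV' (hV y hy)
        · rw [List.mem_singleton.1 hy, (davCheck_eq_some I hreg C s hz).1]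
          exact hs)
      rwa [hj'] at this
    | inr l => exact ⟨l, rfl, ho.2 l rfl⟩

lemma spec_initCore (hreg : 0 < I.reg) (hthr : I.thr = 1) {ℓ : ℕ}
    (hℓ : ∀ C, CoreValid I C → C.length ≤ ℓ) (ρ : S) (T : ℕ)
    {C : List (CoreElt S d N)} (hC : CoreValid I C) (hT : ℓ + 1 ≤ T + C.length) {V : Set S}
    (hρ : ρ ∈ V) (hV : ∀ z ∈ C, z.state ∈ V) (hC1 : 1 ≤ C.length) :
    (initCore I ρ T C).Spec V 0 ((ℓ + 1 - C.length) * davCost d m (∑ i, N i) ℓ)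
      fun o V => ∃ C', o = some C' ∧ CoreValid I C' ∧ (∀ z ∈ C', z.state ∈ V) ∧
        1 ≤ C'.length ∧ (davCheck I C' ρ).val = none := by
  induction T generalizing C V with
  | zero => have := hℓ C hC; omega
  | succ T ih =>
    rw [initCore]
    have h1 := hℓ C hC
    obtain ⟨j, hj⟩ : ∃ j, ℓ + 1 - C.length = j + 1 := ⟨ℓ - C.length, by omega⟩
    rw [hj]
    refine (Prog.Spec.bind (Q₁ := 0) (Q₂ := 0) (T₂ := j * davCost d m (∑ i, N i) ℓ)
      (P₁ := fun o _ => o = (davCheck I C ρ).val)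
      (Prog.Spec.exec (cost_davCheck_le I C ρ h1) rfl)
      fun o V' hV' ho => ?_).mono le_rfl (by ring_nf; omega) fun _ _ _ h => h
    cases o with
    | some z =>
      have hC' := hC.append hreg hthr ho.symm
      have hlen : (C ++ [z]).length = C.length + 1 := by simp
      have hj' : ℓ + 1 - (C ++ [z]).length = j := by omega
      have := ih hC' (by omega) (V := V') (hV' hρ) (by
        intro y hy
        rcases List.mem_append.1 hy with hy | hy
        · exact hV' (hV y hy)
        · rw [List.mem_singleton.1 hy, (davCheck_eq_some I hreg C ρ ho.symm).1]
          exact hV' hρ) (by omega)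
      rwa [hj'] at this
    | none => exact ⟨C, rfl, hC, fun z hz => hV' (hV z hz), hC1, ho.symm⟩

/-- Cost of a complete run with at most `ℓ` core set elements. -/
def runCost (I : Input S d N) (ℓ : ℕ) : ℕ :=
  2 * d * m + (ℓ * davCost d m (∑ i, N i) ℓ + ℓ * (I.K * iterationCost I ℓ))

lemma spec_confidentPolitex (hreg : 0 < I.reg) (hthr : I.thr = 1) {ℓ : ℕ}
    (hℓ : ∀ C, CoreValid I C → C.length ≤ ℓ) (ρ : S) {T : ℕ}
    (hT : ℓ ≤ T) :
    (confidentPolitex I ρ T).Spec {ρ} (ℓ * (I.K * (ℓ * (I.n * (I.H + 1))))) (runCost I ℓ)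
      fun o _ => ∃ l, o = some l ∧ l.length = I.K := by
  have hval := jointFeature_val I.feat ρ I.abar
  have hcost := cost_jointFeature I.feat ρ I.abar
  unfold confidentPolitex
  refine (Prog.Spec.bind (Q₁ := 0) (T₁ := 2 * d * m)
    (P₁ := fun x _ => x = I.feat.joint ρ I.abar) (Prog.Spec.exec hcost.le hval)
    fun x V hV hx => ?_).mono (by rw [zero_add]) le_rfl fun _ _ _ h => h
  subst hx
  have hρ : ρ ∈ V := hV rfl
  have hinit := spec_initCore hreg hthr hℓ ρ T (coreValid_singleton I hreg ρ I.abar)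
    (by simpa using hT) hρ (by simpa using hρ) (by simp)
  refine (Prog.Spec.bind (Q₂ := ℓ * (I.K * (ℓ * (I.n * (I.H + 1)))))
    (T₂ := ℓ * (I.K * iterationCost I ℓ)) hinit fun o V' hV' ho => ?_).mono (by omega)
    (by simp) fun _ _ _ h => h
  obtain ⟨C, rfl, hC, hCV, hC1, -⟩ := ho
  exact (spec_mainLoop hreg hthr hℓ T hC (by omega) hCV).mono
    (mul_le_mul_left (by omega) _) (mul_le_mul_left (by omega) _) fun _ _ _ h => h

end AlgorithmSpec

/-! ### Accuracy of least squares in certain states -/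

section Accuracy

variable {S : Type u} {m d : ℕ} {N : Fin m → ℕ}

/-- Pairs of features and value estimates that are `θ`-accurate for the targets `μ`. -/
def AccurateTargets (θ : ℝ) (μ : CoreElt S d N → ℝ) (L : List (CoreElt S d N))
    (l : List ((Fin d → ℝ) × ℝ)) : Prop :=
  List.Forall₂ (fun z p => p.1 = z.vec ∧ |p.2 - μ z| ≤ θ) L l

lemma AccurateTargets.map_fst {θ : ℝ} {μ : CoreElt S d N → ℝ} {L : List (CoreElt S d N)}
    {l : List ((Fin d → ℝ) × ℝ)} (h : AccurateTargets θ μ L l) :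
    l.map Prod.fst = L.map CoreElt.vec := by
  induction h with
  | nil => rfl
  | cons h _ ih => simp [h.1, ih]

lemma AccurateTargets.exists_of_mem {θ : ℝ} {μ : CoreElt S d N → ℝ} {L : List (CoreElt S d N)}
    {l : List ((Fin d → ℝ) × ℝ)} (h : AccurateTargets θ μ L l) {p : (Fin d → ℝ) × ℝ}
    (hp : p ∈ l) : ∃ z ∈ L, p.1 = z.vec ∧ |p.2 - μ z| ≤ θ := by
  induction h with
  | nil => simp at hp
  | cons h _ ih =>
    rcases List.mem_cons.1 hp with rfl | hp
    · exact ⟨_, List.mem_cons_self, h⟩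
    · obtain ⟨z, hz, h'⟩ := ih hp
      exact ⟨z, List.mem_cons_of_mem _ hz, h'⟩

variable [MeasurableSpace S]

/-- A change of component `j` adds `φ_j(s, a_j) - φ_j(s, abar_j)` whatever the other components are.
Summing the `m` single changes counts the default feature `m` times, `m - 1` times too often. -/
lemma Features.joint_eq_sum_update (F : Features S d N) (s : S) (abar a : Joint N) :
    F.joint s a = ∑ j, F.joint s (Function.update abar j (a j)) -
      ((m : ℝ) - 1) • F.joint s abar := by
  have h : ∀ j, F.joint s (Function.update abar j (a j)) =
      F.joint s abar + (F.φ j s (a j) - F.φ j s (abar j)) := by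
    intro j
    have h1 : F.joint s (Function.update abar j (a j)) - F.joint s abar =
        F.φ j s (a j) - F.φ j s (abar j) := by
      unfold Features.joint
      rw [← Finset.sum_sub_distrib, Finset.sum_eq_single j]
      · simp
      · intro i _ hi
        simp [hi]
      · simp
    rw [← h1]
    abel
  simp_rw [h, Finset.sum_add_distrib, Finset.sum_sub_distrib]
  change _ = ∑ _, _ + (F.joint s a - F.joint s abar) - _
  ext l
  simp
  ring

lemma abs_joint_dotProduct_le (I : Input S d N) (hm : 0 < m) (hreg : 0 < I.reg) (hthr : I.thr = 1)
    {C : List (CoreElt S d N)} {s : S} (hs : (davCheck I C s).val = none) (a : Joint N)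
    (u : Fin d → ℝ) :
    |I.feat.joint s a ⬝ᵥ u| ≤
      (2 * m - 1) * √(u ⬝ᵥ (gram I.reg (C.map CoreElt.vec)).mulVec u) := by
  set U := √(u ⬝ᵥ (gram I.reg (C.map CoreElt.vec)).mulVec u)
  rw [davCheck_eq_none_iff I hreg, hthr] at hs
  have hU : ∀ j c, |I.feat.joint s (Function.update I.abar j c) ⬝ᵥ u| ≤ U := fun j c =>
    abs_dotProduct_le_of_invSq_le_one hreg _ (hs j c) u
  -- The default action is itself among the tested ones: replace component 0 by its own value.
  have h0 : |I.feat.joint s I.abar ⬝ᵥ u| ≤ U := by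
    simpa using hU ⟨0, hm⟩ (I.abar ⟨0, hm⟩)
  have hm1 : (1 : ℝ) ≤ m := by exact_mod_cast hm
  rw [Features.joint_eq_sum_update I.feat s I.abar a, sub_dotProduct, smul_dotProduct,
    sum_dotProduct, smul_eq_mul]
  calc |∑ j, I.feat.joint s (Function.update I.abar j (a j)) ⬝ᵥ u -
        (m - 1) * (I.feat.joint s I.abar ⬝ᵥ u)|
      ≤ |∑ j, I.feat.joint s (Function.update I.abar j (a j)) ⬝ᵥ u| +
        |(m - 1) * (I.feat.joint s I.abar ⬝ᵥ u)| := abs_sub _ _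
    _ ≤ ∑ _j : Fin m, U + (m - 1) * U := by
      refine add_le_add ((Finset.abs_sum_le_sum_abs _ _).trans
        (Finset.sum_le_sum fun j _ => hU j (a j))) ?_
      rw [abs_mul, abs_of_nonneg (by linarith)]
      exact mul_le_mul_of_nonneg_left h0 (by linarith)
    _ = _ := by
      simp
      ring

/-- Standing assumptions on the inputs of the algorithm. -/
structure WellPosed (M : MDP S (Joint N)) (I : Input S d N) (b ε θ : ℝ) : Prop where
  comp_pos : 0 < m
  reg_pos : 0 < I.reg
  thr_eq : I.thr = 1
  disc_eq : I.disc = M.γ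
  n_pos : 0 < I.n
  eps_nonneg : 0 ≤ ε
  theta_nonneg : 0 ≤ θ
  realizable : AdditiveRealizable M I.feat b ε

/-- Accuracy of the value estimates in certain states, for core sets with at most `ℓ` elements. -/
def evalAccuracy (M : MDP S (Joint N)) (I : Input S d N) (b ε θ ℓ : ℝ) : ℝ :=
  (b * √I.reg + (ε + M.γ ^ (I.H + 1) / (1 - M.γ) + θ) * √ℓ) * (2 * m - 1) + ε

variable {M : MDP S (Joint N)} {I : Input S d N} {b ε θ : ℝ}

/-- Each regression target deviates from the linear model by misspecification, truncation and Monte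
Carlo error, together `e`. The final `ε` in `evalAccuracy` is the misspecification at `(s, a)`
itself. -/
lemma WellPosed.abs_leastSquares_sub_le (hI : WellPosed M I b ε θ) {C : List (CoreElt S d N)}
    (hC : CoreValid I C) {ℓ : ℝ} (hℓ : C.length ≤ ℓ) (ν : Policy S (Joint N))
    {l : List ((Fin d → ℝ) × ℝ)}
    (hl : AccurateTargets θ (fun z => M.meanReturn ν (I.H + 1) (z.state, z.act)) C l)
    {s : S} (hs : (davCheck I C s).val = none) (a : Joint N) :
    |(leastSquares I l).val ⬝ᵥ I.feat.joint s a - M.qvalue ν s a| ≤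
      evalAccuracy M I b ε θ ℓ := by
  obtain ⟨ϑ, hϑ, hQ⟩ := hI.realizable ν
  set e := ε + M.γ ^ (I.H + 1) / (1 - M.γ) + θ with he
  have hγ := M.one_sub_pos
  have he0 : 0 ≤ e := by
    have := hI.eps_nonneg
    have := hI.theta_nonneg
    have := M.γ_nonneg
    positivity
  have hacc : ∀ p ∈ l, |p.2 - ϑ ⬝ᵥ p.1| ≤ e := by
    intro p hp
    obtain ⟨z, hz, h1, h2⟩ := hl.exists_of_mem hp
    rw [h1, hC.vec_eq z hz]
    have h3 := M.abs_meanReturn_sub_pairValue_le ν (I.H + 1) (z.state, z.act)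
    rw [M.pairValue_eq_qvalue] at h3
    have h4 := hQ z.state z.act
    rw [abs_le] at *
    constructor <;> linarith [h2.1, h2.2, h3.1, h3.2, h4.1, h4.2]
  set u := (leastSquares I l).val - ϑ with hu
  have hls := sqrt_gram_leastSquares_sub_le hI.reg_pos l ϑ hϑ he0 hacc (u := u)
    (by rw [hu, leastSquares_val I hI.reg_pos])
  rw [hl.map_fst] at hls
  have hj := abs_joint_dotProduct_le I hI.comp_pos hI.reg_pos hI.thr_eq hs a u
  have hm1 : (1 : ℝ) ≤ m := by exact_mod_cast hI.comp_pos
  have hlen : (l.length : ℝ) ≤ ℓ := by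
    have := congrArg List.length hl.map_fst
    simp only [List.length_map] at this
    rwa [this]
  have h5 : |I.feat.joint s a ⬝ᵥ u| ≤ (b * √I.reg + e * √ℓ) * (2 * m - 1) := by
    refine hj.trans ?_
    rw [mul_comm]
    refine mul_le_mul_of_nonneg_right (hls.trans ?_) (by linarith)
    gcongr
  have h6 : (leastSquares I l).val ⬝ᵥ I.feat.joint s a - M.qvalue ν s a =
      I.feat.joint s a ⬝ᵥ u - (M.qvalue ν s a - ϑ ⬝ᵥ I.feat.joint s a) := by
    rw [hu, dotProduct_sub, dotProduct_comm _ ϑ, dotProduct_comm (leastSquares I l).val]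
    ring
  rw [h6]
  exact (abs_sub _ _).trans (add_le_add h5 (hQ s a))

end Accuracy

/-! ### Runs with accurate estimates -/

section GoodRuns

variable {S : Type u} [MeasurableSpace S] {m d : ℕ} {N : Fin m → ℕ}
  {M : MDP S (Joint N)} {I : Input S d N} {b ε θ : ℝ} {π₀ : Policy S (Joint N)}

/-- Failure probability of the rollouts from one core set element. -/
def failProb (M : MDP S (Joint N)) (I : Input S d N) (θ : ℝ) : ℝ :=
  4 * Real.exp (-(2 * I.n * θ ^ 2 * (1 - M.γ) ^ 2))

lemma failProb_nonneg (M : MDP S (Joint N)) (I : Input S d N) (θ : ℝ) : 0 ≤ failProb M I θ := by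
  unfold failProb
  positivity

lemma prob_ret {α : Type w} {x : α} {E : Set α} (h : x ∈ E) (c : ℝ) (hc : 0 ≤ c) :
    ENNReal.ofReal (1 - c) ≤ (Prog.ret x : Prog S (Joint N) α).prob M π₀ E := by
  simp only [Prog.prob, Prog.expect, h, Set.indicator_of_mem, Pi.one_apply]
  exact ENNReal.ofReal_le_one.2 (by linarith)

lemma prob_exec_bind {α : Type w₁} {β : Type w₂} (x : Timed α) (k : α → Prog S (Joint N) β)
    (E : Set β) : ((Prog.exec x).bind k).prob M π₀ E = (k x.val).prob M π₀ E := rfl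

/-- In the application `ν` is the virtual and `ν'` the actual policy; failures are summed over the
core set, and an uncertain outcome satisfies the event vacuously. -/
lemma WellPosed.prob_evaluate_ge (hI : WellPosed M I b ε θ) {c : Option (Fin d → ℝ)}
    {C : List (CoreElt S d N)} {ν ν' : Policy S (Joint N)} (hν : AgreesOnCertain I π₀ c C ν)
    (hν' : AgreesOnCertain I π₀ c C ν') (L : List (CoreElt S d N)) :
    ENNReal.ofReal (1 - L.length * failProb M I θ) ≤ (evaluate I c C L).prob M π₀
      {o | ∀ l, o = Sum.inr l →
        AccurateTargets θ (fun z => M.meanReturn ν (I.H + 1) (z.state, z.act)) L l ∧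
        AccurateTargets θ (fun z => M.meanReturn ν' (I.H + 1) (z.state, z.act)) L l} := by
  induction L with
  | nil =>
    refine prob_ret ?_ _ (by simp)
    rintro l ⟨⟩
    exact ⟨List.Forall₂.nil, List.Forall₂.nil⟩
  | cons z L ih =>
    have hp := failProb_nonneg M I θ
    rw [evaluate]
    have e : (((z :: L).length : ℕ) : ℝ) * failProb M I θ =
        failProb M I θ + (L.length * failProb M I θ + 0) := by
      rw [List.length_cons]; push_cast; ring
    rw [e]
    refine Prog.prob_bind_ge M π₀ hp (by positivity)
      (prob_rollout_accurate₂_ge hI.disc_eq hI.n_pos hν hν' z hI.theta_nonneg) fun o ho => ?_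
    cases o with
    | inl x =>
      refine prob_ret ?_ _ (by positivity)
      rintro l ⟨⟩
    | inr q =>
      refine Prog.prob_bind_ge M π₀ (by positivity) le_rfl ih fun o ho' => ?_
      cases o with
      | inl x =>
        refine prob_ret ?_ _ le_rfl
        rintro l ⟨⟩
      | inr l =>
        refine prob_ret ?_ _ le_rfl
        rintro l' ⟨⟩
        obtain ⟨h1, h2⟩ := ho' l rfl
        exact ⟨List.Forall₂.cons ⟨rfl, ho.1 q rfl⟩ h1, List.Forall₂.cons ⟨rfl, ho.2 q rfl⟩ h2⟩

/-- A list of policies of the algorithm is shadowed by policies `νs`, which follow exponential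
weights with value estimates `qs` that are accurate everywhere; in the state `ρ` the two sequences
agree, and the estimates are accurate also for the original policies. -/
def Shadowed (M : MDP S (Joint N)) (I : Input S d N) (π₀ : Policy S (Joint N)) (ρ : S) (η : ℝ)
    (G : S → Joint N → ℝ) (ν : Policy S (Joint N)) (l : List (Option (Fin d → ℝ))) : Prop :=
  ∃ (νs : ℕ → Policy S (Joint N)) (qs : ℕ → S → Joint N → ℝ), νs 0 = ν ∧
    (∀ j, j + 1 < l.length → ∀ s, (νs (j + 1)).kernel s =
      gibbsLaw I.temp fun a => G s a + ∑ i ∈ Finset.range (j + 1), qs i s a) ∧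
    ∀ j (hj : j < l.length), (∀ s a, |qs j s a - M.qvalue (νs j) s a| ≤ η) ∧
      (∀ a, |qs j ρ a - M.qvalue (decode I π₀ l[j]) ρ a| ≤ η) ∧
      (νs j).kernel ρ = (decode I π₀ l[j]).kernel ρ

/-- The offset `G` stores the estimates of earlier iterations, so prepending one iteration shifts
the indices and moves `q` out of the offset. -/
lemma Shadowed.cons {ρ : S} {η : ℝ} {G : S → Joint N → ℝ} {ν ν' : Policy S (Joint N)}
    {l : List (Option (Fin d → ℝ))} {q : S → Joint N → ℝ} {c : Option (Fin d → ℝ)}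
    (h : Shadowed M I π₀ ρ η (fun s a => G s a + q s a) ν' l)
    (hν' : ∀ s, ν'.kernel s = gibbsLaw I.temp fun a => G s a + q s a)
    (hq : ∀ s a, |q s a - M.qvalue ν s a| ≤ η)
    (hqρ : ∀ a, |q ρ a - M.qvalue (decode I π₀ c) ρ a| ≤ η)
    (hν : ν.kernel ρ = (decode I π₀ c).kernel ρ) : Shadowed M I π₀ ρ η G ν (c :: l) := by
  obtain ⟨νs, qs, h0, h1, h2⟩ := h
  refine ⟨fun j => Nat.casesOn j ν νs, fun j => Nat.casesOn j q qs, rfl, ?_, ?_⟩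
  · intro j hj s
    cases j with
    | zero => simpa [h0] using hν' s
    | succ j =>
      have := h1 j (by simpa using hj) s
      simp only [this]
      congr 1
      funext a
      rw [Finset.sum_range_succ' _ (j + 1)]
      change _ = G s a + (∑ i ∈ Finset.range (j + 1), qs i s a + q s a)
      ring
  · intro j hj
    cases j with
    | zero => exact ⟨hq, hqρ, hν⟩
    | succ j => exact h2 j (by simpa using hj)

/-- The past enters only through `G`, the sum of the virtual estimates, and `W`, the sum of the
actual weights; both give the same preferences in certain states. This invariant keeps the next
virtual and the next actual policy in agreement there. -/
lemma WellPosed.prob_iterate_ge (hI : WellPosed M I b ε θ) {C : List (CoreElt S d N)}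
    (hC : CoreValid I C) {ℓ : ℝ} (hℓ : C.length ≤ ℓ) {ρ : S}
    (hρ : (davCheck I C ρ).val = none) (k : ℕ) (c : Option (Fin d → ℝ)) (W : Fin d → ℝ)
    (G : S → Joint N → ℝ) (hGm : ∀ a, Measurable fun s => G s a)
    (hG : ∀ s, (davCheck I C s).val = none → ∀ a, G s a = W ⬝ᵥ I.feat.joint s a)
    (ν : Policy S (Joint N)) (hν : AgreesOnCertain I π₀ c C ν) :
    ENNReal.ofReal (1 - k * (C.length * failProb M I θ)) ≤ (iterate I C k c W).prob M π₀
      {o | ∀ l, o = Sum.inr l →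
        Shadowed M I π₀ ρ (evalAccuracy M I b ε θ ℓ) G ν l} := by
  have hp := failProb_nonneg M I θ
  induction k generalizing c W G ν with
  | zero =>
    refine prob_ret ?_ _ (by simp)
    rintro l ⟨⟩
    exact ⟨fun _ => ν, fun _ _ _ => 0, rfl, by simp, by simp⟩
  | succ k ih =>
    rw [iterate]
    have e : ((k + 1 : ℕ) : ℝ) * (C.length * failProb M I θ) =
        C.length * failProb M I θ + (k * (C.length * failProb M I θ) + 0) := by
      push_cast; ring
    rw [e]
    refine Prog.prob_bind_ge M π₀ (by positivity) (by positivity)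
      (hI.prob_evaluate_ge hν agreesOnCertain_decode C) fun o ho => ?_
    cases o with
    | inl x =>
      refine prob_ret ?_ _ (by positivity)
      rintro l ⟨⟩
    | inr l =>
      obtain ⟨h1, h2⟩ := ho l rfl
      simp only
      rw [prob_exec_bind, prob_exec_bind]
      set w := (leastSquares I l).val with hw
      set W₁ := (Timed.vecAdd W w).val with hW₁
      have hW₁' : W₁ = W + w := rfl
      classical
      -- The virtual estimate: least squares where the check passes, the exact action value of `ν`
      -- (error zero) elsewhere.
      set q : S → Joint N → ℝ := fun s a =>
        if (davCheck I C s).val = none then w ⬝ᵥ I.feat.joint s a else M.qvalue ν s a with hq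
      have hqc : ∀ s, (davCheck I C s).val = none → ∀ a, q s a = w ⬝ᵥ I.feat.joint s a :=
        fun s hs a => if_pos hs
      have hqm : ∀ a, Measurable fun s => q s a := by
        intro a
        refine Measurable.ite (measurableSet_certain I hI.reg_pos C) ?_
          ((M.measurable_qvalue ν).comp (measurable_id.prodMk measurable_const))
        have h1 : ∀ (i : Fin m) (l : Fin d), Measurable fun s => I.feat.φ i s (a i) l :=
          fun i l => (measurable_pi_apply l).comp (I.feat.measurable_φ i (a i))
        simp only [Features.joint, dotProduct, Finset.sum_apply]
        fun_prop
      have : Nonempty (Joint N) := ⟨I.abar⟩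
      have hGq : ∀ a, Measurable fun s => G s a + q s a := fun a => (hGm a).add (hqm a)
      obtain ⟨ν', hν'⟩ := exists_gibbsPolicy I.temp (fun s a => G s a + q s a) hGq
      have hG₁ : ∀ s, (davCheck I C s).val = none → ∀ a,
          G s a + q s a = W₁ ⬝ᵥ I.feat.joint s a := by
        intro s hs a
        rw [hG s hs, hqc s hs, hW₁', add_dotProduct]
      have hag : AgreesOnCertain I π₀ (some W₁) C ν' := by
        intro s hs
        rw [hν' s]
        change _ = gibbsLaw I.temp fun a => W₁ ⬝ᵥ I.feat.joint s a
        congr 1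
        funext a
        exact hG₁ s hs a
      refine Prog.prob_bind_ge M π₀ (by positivity) le_rfl
        (ih (some W₁) W₁ (fun s a => G s a + q s a) hGq hG₁ ν' hag) fun o ho' => ?_
      cases o with
      | inl x =>
        refine prob_ret ?_ _ le_rfl
        rintro l ⟨⟩
      | inr l₁ =>
        refine prob_ret ?_ _ le_rfl
        rintro l' ⟨⟩
        refine Shadowed.cons (q := q) (ho' l₁ rfl) hν' ?_ ?_ (hν ρ hρ)
        · intro s a
          by_cases hs : (davCheck I C s).val = none
          · rw [hqc s hs]
            exact hI.abs_leastSquares_sub_le hC hℓ ν h1 hs a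
          · have hq0 : q s a = M.qvalue ν s a := if_neg hs
            rw [hq0, sub_self, abs_zero]
            -- Only `0 ≤ evalAccuracy` is needed; it is read off from the bound at the certain state
            -- `ρ`.
            exact (abs_nonneg _).trans (hI.abs_leastSquares_sub_le hC hℓ ν h1 hρ a)
        · intro a
          rw [hqc ρ hρ]
          exact hI.abs_leastSquares_sub_le hC hℓ _ h2 hρ a

/-- Outputs of the algorithm for which the analysis of policy iteration applies. -/
def goodOutputs (M : MDP S (Joint N)) (I : Input S d N) (π₀ : Policy S (Joint N)) (ρ : S)
    (η : ℝ) : Set (Option (List (Option (Fin d → ℝ)))) :=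
  {o | ∃ l, o = some l ∧ l.length = I.K ∧ Shadowed M I π₀ ρ η (fun _ _ => 0) π₀ l}

/-- Union bound over the remaining passes. A pass that ends in an uncertain element is not a
failure: it leads to a larger valid core set with `ρ` still certain. -/
lemma WellPosed.prob_mainLoop_ge (hI : WellPosed M I b ε θ) {ℓ : ℕ}
    (hℓ : ∀ C, CoreValid I C → C.length ≤ ℓ) {ℓ' : ℝ} (hℓ' : ℓ ≤ ℓ') {ρ : S} (T : ℕ)
    {C : List (CoreElt S d N)} (hC : CoreValid I C) (hT : ℓ + 1 ≤ T + C.length)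
    (hρ : (davCheck I C ρ).val = none) :
    ENNReal.ofReal (1 - (ℓ + 1 - C.length : ℕ) * (I.K * (ℓ * failProb M I θ))) ≤
      (mainLoop I T C).prob M π₀ (goodOutputs M I π₀ ρ (evalAccuracy M I b ε θ ℓ')) := by
  have hp := failProb_nonneg M I θ
  induction T generalizing C with
  | zero => have := hℓ C hC; omega
  | succ T ih =>
    rw [mainLoop]
    have h1 := hℓ C hC
    have h1' : (C.length : ℝ) ≤ ℓ := by exact_mod_cast h1
    obtain ⟨j, hj⟩ : ∃ j, ℓ + 1 - C.length = j + 1 := ⟨ℓ - C.length, by omega⟩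
    rw [hj]
    have e : ((j + 1 : ℕ) : ℝ) * (I.K * (ℓ * failProb M I θ)) =
        I.K * (ℓ * failProb M I θ) + j * (I.K * (ℓ * failProb M I θ)) := by
      push_cast; ring
    rw [e]
    have h2 := hI.prob_iterate_ge (π₀ := π₀) hC (h1'.trans hℓ') hρ I.K none 0 (fun _ _ => 0)
      (fun _ => measurable_const) (by simp) π₀ agreesOnCertain_decode
    have h3 := (spec_iterate (I := I) h1 I.K none 0 (V := Set.univ)
      fun z _ => Set.mem_univ _).prob_inter M π₀ {o | ∀ l, o = Sum.inr l →
        Shadowed M I π₀ ρ (evalAccuracy M I b ε θ ℓ') (fun _ _ => 0) π₀ l}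
    refine Prog.prob_bind_ge M π₀ (by positivity) (by positivity)
      ((ENNReal.ofReal_le_ofReal ?_).trans (h2.trans h3)) fun o ho => ?_
    · gcongr
    obtain ⟨ho1, V', ho2, ho3⟩ := ho
    cases o with
    | inl z =>
      obtain ⟨s, -, hz⟩ := ho2 z rfl
      have hlen : (C ++ [z]).length = C.length + 1 := by simp
      have hj' : ℓ + 1 - (C ++ [z]).length = j := by omega
      have := ih (hC.append hI.reg_pos hI.thr_eq hz) (by omega)
        (davCheck_append_eq_none I hI.reg_pos C ρ z hρ)
      rwa [hj'] at this
    | inr l =>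
      have hl : some l ∈ goodOutputs M I π₀ ρ (evalAccuracy M I b ε θ ℓ') :=
        ⟨l, rfl, ho3 l rfl, ho1 l rfl⟩
      exact prob_ret hl _ (by positivity)

/-- The initialization is deterministic, so it costs no probability, and it stops only when `ρ`
passes the check. -/
lemma WellPosed.prob_initCore_bind_ge (hI : WellPosed M I b ε θ) {ℓ : ℕ}
    (hℓ : ∀ C, CoreValid I C → C.length ≤ ℓ) {ℓ' : ℝ} (hℓ' : ℓ ≤ ℓ') {ρ : S} {T₀ : ℕ}
    (hT₀ : ℓ ≤ T₀) (T : ℕ) {C : List (CoreElt S d N)} (hC : CoreValid I C)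
    (hC1 : 1 ≤ C.length) (hT : ℓ + 1 ≤ T + C.length) :
    ENNReal.ofReal (1 - ℓ * (I.K * (ℓ * failProb M I θ))) ≤
      ((initCore I ρ T C).bind fun
        | none => Prog.ret none
        | some C => mainLoop I T₀ C).prob M π₀
          (goodOutputs M I π₀ ρ (evalAccuracy M I b ε θ ℓ')) := by
  have hp := failProb_nonneg M I θ
  induction T generalizing C with
  | zero => have := hℓ C hC; omega
  | succ T ih =>
    rw [initCore]
    unfold Prog.prob
    rw [Prog.expect_bind, Prog.expect_bind]
    simp only [Prog.exec, Prog.expect]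
    cases ho : (davCheck I C ρ).val with
    | some z =>
      have := ih (hC.append hI.reg_pos hI.thr_eq ho) (by simp) (by simp; omega)
      unfold Prog.prob at this
      rwa [Prog.expect_bind] at this
    | none =>
      refine le_trans (ENNReal.ofReal_le_ofReal ?_)
        (hI.prob_mainLoop_ge hℓ hℓ' T₀ hC (by omega) ho)
      have : ((ℓ + 1 - C.length : ℕ) : ℝ) ≤ ℓ := by exact_mod_cast (by omega)
      gcongr

lemma WellPosed.prob_confidentPolitex_ge (hI : WellPosed M I b ε θ) {ℓ : ℕ}
    (hℓ : ∀ C, CoreValid I C → C.length ≤ ℓ) {ℓ' : ℝ} (hℓ' : ℓ ≤ ℓ') (ρ : S) {T : ℕ}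
    (hT : ℓ ≤ T) :
    ENNReal.ofReal (1 - ℓ * (I.K * (ℓ * failProb M I θ))) ≤
      (confidentPolitex I ρ T).prob M π₀
        (goodOutputs M I π₀ ρ (evalAccuracy M I b ε θ ℓ')) := by
  unfold confidentPolitex
  rw [prob_exec_bind, jointFeature_val]
  exact hI.prob_initCore_bind_ge hℓ hℓ' hT T (coreValid_singleton I hI.reg_pos ρ I.abar)
    (by simp) (by simpa using hT)

end GoodRuns

/-! ### Estimates for the parameters -/

/-- Admissible parameters. -/
structure Admissible (m d : ℕ) (γ ε b : ℝ) : Prop where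
  m_pos : 0 < m
  d_pos : 0 < d
  γ_nonneg : 0 ≤ γ
  γ_lt_one : γ < 1
  ε_pos : 0 < ε
  b_pos : 0 < b

namespace Admissible

variable {m d : ℕ} {γ ε b : ℝ}

lemma one_le_m (h : Admissible m d γ ε b) : (1 : ℝ) ≤ m := by exact_mod_cast h.m_pos

lemma one_le_d (h : Admissible m d γ ε b) : (1 : ℝ) ≤ d := by exact_mod_cast h.d_pos

lemma one_le_zeta (h : Admissible m d γ ε b) : (1 : ℝ) ≤ 2 * m - 1 := by linarith [h.one_le_m]

lemma one_sub_pos (h : Admissible m d γ ε b) : 0 < 1 - γ := sub_pos.2 h.γ_lt_one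

lemma one_sub_le (h : Admissible m d γ ε b) : 1 - γ ≤ 1 := by linarith [h.γ_nonneg]

lemma one_le_logTerm (h : Admissible m d γ ε b) : 1 ≤ logTerm d ε b := by
  have := h.ε_pos
  have := h.one_le_d
  unfold logTerm
  have : 0 ≤ Real.log (1 + b ^ 2 / (ε ^ 2 * d)) := Real.log_nonneg (by
    have : 0 ≤ b ^ 2 / (ε ^ 2 * d) := by positivity
    linarith)
  linarith

lemma one_le_sqrt_logTerm (h : Admissible m d γ ε b) :
    1 ≤ √(logTerm d ε b) := Real.one_le_sqrt.2 h.one_le_logTerm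

lemma one_le_sqrt_d (h : Admissible m d γ ε b) : 1 ≤ √(d : ℝ) := Real.one_le_sqrt.2 h.one_le_d

lemma kappa_mul (h : Admissible m d γ ε b) :
    kappa m d γ ε b * (1 - γ) = 16 * ε * √d * (2 * m - 1) * √(logTerm d ε b) := by
  have := h.one_sub_pos
  unfold kappa
  field_simp

lemma sixteen_mul_le (h : Admissible m d γ ε b) : 16 * ε ≤ kappa m d γ ε b * (1 - γ) := by
  rw [h.kappa_mul]
  have h1 := h.ε_pos
  have h2 : 1 ≤ √(d : ℝ) * (2 * m - 1) * √(logTerm d ε b) :=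
    one_le_mul_of_one_le_of_one_le
      (one_le_mul_of_one_le_of_one_le h.one_le_sqrt_d h.one_le_zeta) h.one_le_sqrt_logTerm
  nlinarith

lemma kappa_mul_pos (h : Admissible m d γ ε b) : 0 < kappa m d γ ε b * (1 - γ) := by
  linarith [h.sixteen_mul_le, h.ε_pos]

lemma kappa_pos (h : Admissible m d γ ε b) : 0 < kappa m d γ ε b :=
  pos_of_mul_pos_left h.kappa_mul_pos h.one_sub_pos.le

lemma kappa_mul_sq (h : Admissible m d γ ε b) : (kappa m d γ ε b * (1 - γ)) ^ 2 =
    256 * ε ^ 2 * d * (2 * m - 1) ^ 2 * logTerm d ε b := by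
  rw [h.kappa_mul]
  have h1 : √(d : ℝ) ^ 2 = d := Real.sq_sqrt (by linarith [h.one_le_d])
  have h2 : √(logTerm d ε b) ^ 2 = logTerm d ε b := Real.sq_sqrt (by linarith [h.one_le_logTerm])
  calc _ = 256 * ε ^ 2 * √(d : ℝ) ^ 2 * (2 * m - 1) ^ 2 * √(logTerm d ε b) ^ 2 := by ring
    _ = _ := by rw [h1, h2]

/-- The factors `2m - 1` and `1 - γ` cancel, so `coreBound` depends on neither. -/
lemma regCoef_eq (h : Admissible m d γ ε b) :
    regCoef m d γ ε b = 4 / 9 * ε ^ 2 * d * logTerm d ε b / b ^ 2 := by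
  have := h.one_le_zeta
  have := h.b_pos
  have h3 : (2 * (m : ℝ) - 1) ≠ 0 := by linarith
  unfold regCoef
  rw [← mul_pow, h.kappa_mul_sq]
  field_simp
  ring

lemma regCoef_pos (h : Admissible m d γ ε b) : 0 < regCoef m d γ ε b := by
  rw [h.regCoef_eq]
  have := h.one_le_logTerm
  have := h.one_le_d
  have := h.b_pos
  have := h.ε_pos
  positivity

/-- The regularization is chosen so that the ridge bias takes exactly a share `1/24` of `κ(1-γ)`.
`theta_mul` and `pow_rolloutLength_le` give shares of the same size to the Monte Carlo and
truncation errors. -/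
lemma sqrt_regCoef (h : Admissible m d γ ε b) :
    b * √(regCoef m d γ ε b) * (2 * m - 1) = kappa m d γ ε b * (1 - γ) / 24 := by
  have h1 := h.one_le_zeta
  have h2 := h.b_pos
  have h3 := h.kappa_mul_pos
  have : regCoef m d γ ε b = (kappa m d γ ε b * (1 - γ) / (24 * b * (2 * m - 1))) ^ 2 := by
    unfold regCoef
    rw [← mul_pow, div_pow]
    congr 1
    ring
  rw [this, Real.sqrt_sq (by positivity)]
  field_simp

lemma coreBound_le (h : Admissible m d γ ε b) :
    coreBound m d γ ε b ≤ 4.8 * (d * logTerm d ε b) := by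
  have he := Real.exp_one_gt_d9
  have hl := Real.log_two_lt_d9
  have hl0 := Real.log_two_gt_d9
  have hL := h.one_le_logTerm
  have hd := h.one_le_d
  have hb := h.b_pos
  have hε := h.ε_pos
  -- Here `3.164` exceeds `2e/(e-1)` slightly; the two logarithms are at most `1.512` times
  -- `logTerm`, since `2 log 2 + 1/8 < 1.512`. The product is below `4.8`.
  have h1 : Real.exp 1 / (Real.exp 1 - 1) * ((1 + 1) / 1) ≤ 3.164 := by
    rw [div_mul_eq_mul_div, div_le_iff₀ (by linarith)]
    linarith
  set x := b ^ 2 / (ε ^ 2 * d) with hx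
  have hx0 : 0 ≤ x := by positivity
  have hLx : logTerm d ε b = 1 + Real.log (1 + x) := rfl
  have h2 : Real.log (1 + 1 / regCoef m d γ ε b) ≤ Real.log 2 + 0.125 + Real.log (1 + x) := by
    have e1 : 1 / regCoef m d γ ε b = 9 / 4 * x / logTerm d ε b := by
      rw [h.regCoef_eq, hx]
      field_simp
    have e2 : 1 + 1 / regCoef m d γ ε b ≤ 2 * 1.125 * (1 + x) := by
      rw [e1]
      have : 9 / 4 * x / logTerm d ε b ≤ 9 / 4 * x := div_le_self (by positivity) hL
      linarith
    have e3 : Real.log 1.125 ≤ 0.125 := by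
      have := Real.log_le_sub_one_of_pos (x := 1.125) (by norm_num)
      linarith
    have hpos := h.regCoef_pos
    calc _ ≤ Real.log (2 * 1.125 * (1 + x)) := Real.log_le_log (by positivity) e2
      _ = Real.log 2 + Real.log 1.125 + Real.log (1 + x) := by
        rw [Real.log_mul (by norm_num) (by positivity), Real.log_mul (by norm_num) (by norm_num)]
      _ ≤ _ := by linarith
  have h3 : Real.log (1 + 1 / 1) + Real.log (1 + 1 / regCoef m d γ ε b) ≤
      1.512 * logTerm d ε b := by
    have : Real.log (1 + 1 / 1) = Real.log 2 := by norm_num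
    rw [this]
    have : 0 ≤ Real.log (1 + x) := Real.log_nonneg (by linarith)
    rw [hLx]
    linarith
  have h4 : 0 ≤ Real.log (1 + 1 / 1) + Real.log (1 + 1 / regCoef m d γ ε b) := by
    have hpos := h.regCoef_pos
    have : 0 ≤ 1 / regCoef m d γ ε b := by positivity
    have := Real.log_nonneg (x := 1 + 1 / regCoef m d γ ε b) (by linarith)
    have := Real.log_nonneg (x := 1 + 1 / 1) (by norm_num)
    linarith
  have h5 : 0 < Real.exp 1 - 1 := by linarith
  unfold coreBound
  calc _ ≤ 3.164 * d * (1.512 * logTerm d ε b) := by gcongr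
    _ ≤ _ := by
      nlinarith [mul_pos (show (0:ℝ) < d by linarith) (show 0 < logTerm d ε b by linarith)]

lemma two_le_coreBound (h : Admissible m d γ ε b) : 2 ≤ coreBound m d γ ε b := by
  have he := Real.exp_one_gt_d9
  have he' := Real.exp_one_lt_d9
  have hl0 := Real.log_two_gt_d9
  have hd := h.one_le_d
  have hpos := h.regCoef_pos
  have h1 : 3 ≤ Real.exp 1 / (Real.exp 1 - 1) * ((1 + 1) / 1) := by
    rw [div_mul_eq_mul_div, le_div_iff₀ (by linarith)]
    linarith
  have h2 : 0.69 ≤ Real.log (1 + 1 / 1) + Real.log (1 + 1 / regCoef m d γ ε b) := by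
    have : 0 ≤ 1 / regCoef m d γ ε b := by positivity
    have := Real.log_nonneg (x := 1 + 1 / regCoef m d γ ε b) (by linarith)
    have : Real.log (1 + 1 / 1) = Real.log 2 := by norm_num
    linarith
  unfold coreBound
  calc (2 : ℝ) ≤ 3 * 1 * 0.69 := by norm_num
    _ ≤ _ := by gcongr

lemma sqrt_coreBound_pos (h : Admissible m d γ ε b) : 0 < √(coreBound m d γ ε b) :=
  Real.sqrt_pos.2 (by linarith [h.two_le_coreBound])

lemma sqrt_coreBound_le (h : Admissible m d γ ε b) :
    √(coreBound m d γ ε b) ≤ 2.2 * (√d * √(logTerm d ε b)) := by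
  have hL := h.one_le_logTerm
  have hd := h.one_le_d
  rw [← Real.sqrt_mul (by linarith)]
  apply Real.sqrt_le_iff.2
  refine ⟨by positivity, ?_⟩
  rw [mul_pow, Real.sq_sqrt (by positivity)]
  refine h.coreBound_le.trans ?_
  have : 0 ≤ (d : ℝ) * logTerm d ε b := by positivity
  linarith

lemma theta_pos (h : Admissible m d γ ε b) : 0 < theta m d γ ε b := by
  have := h.kappa_mul_pos
  have := h.one_le_zeta
  have := h.sqrt_coreBound_pos
  unfold theta
  positivity

lemma theta_mul (h : Admissible m d γ ε b) :
    theta m d γ ε b * √(coreBound m d γ ε b) * (2 * m - 1) =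
    kappa m d γ ε b * (1 - γ) / 24 := by
  have := h.one_le_zeta
  have := h.sqrt_coreBound_pos
  unfold theta
  field_simp

lemma log_rolloutLength (h : Admissible m d γ ε b) :
    Real.log (24 * √(coreBound m d γ ε b) * (2 * m - 1)) -
      Real.log (kappa m d γ ε b * (1 - γ) ^ 2) =
    Real.log (24 * √(coreBound m d γ ε b) * (2 * m - 1) / (kappa m d γ ε b * (1 - γ) ^ 2)) := by
  have := h.one_le_zeta
  have := h.sqrt_coreBound_pos
  have := h.kappa_pos
  have := h.one_sub_pos
  rw [Real.log_div (by positivity) (by positivity)]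

/-- From `γ ≤ exp (-(1-γ))` one gets `γ^(H+1) ≤ exp (-X)`, with `X` the logarithm of the required
reduction. Truncation of a negative `H` to 0 does no harm, as `Nat.le_ceil` holds for all reals. -/
lemma pow_rolloutLength_le (h : Admissible m d γ ε b) :
    γ ^ (rolloutLength m d γ ε b + 1) / (1 - γ) *
      √(coreBound m d γ ε b) * (2 * m - 1) ≤ kappa m d γ ε b * (1 - γ) / 24 := by
  have h1 := h.one_le_zeta
  have h2 := h.sqrt_coreBound_pos
  have h3 := h.kappa_pos
  have h4 := h.one_sub_pos
  set X := Real.log (24 * √(coreBound m d γ ε b) * (2 * m - 1)) -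
      Real.log (kappa m d γ ε b * (1 - γ) ^ 2) with hX
  have hH : X / (1 - γ) - 1 ≤ rolloutLength m d γ ε b := Nat.le_ceil _
  have h5 : X ≤ (1 - γ) * (rolloutLength m d γ ε b + 1 : ℕ) := by
    have : X / (1 - γ) ≤ (rolloutLength m d γ ε b + 1 : ℕ) := by push_cast; linarith
    rwa [div_le_iff₀' h4] at this
  have h6 : γ ^ (rolloutLength m d γ ε b + 1) ≤ Real.exp (-X) := by
    calc γ ^ (rolloutLength m d γ ε b + 1)
        ≤ Real.exp (-(1 - γ)) ^ (rolloutLength m d γ ε b + 1) := by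
          refine pow_le_pow_left₀ h.γ_nonneg ?_ _
          have := Real.add_one_le_exp (-(1 - γ))
          linarith
      _ = Real.exp (-((1 - γ) * (rolloutLength m d γ ε b + 1 : ℕ))) := by
          rw [← Real.exp_nat_mul]
          congr 1
          ring
      _ ≤ _ := Real.exp_le_exp.2 (by linarith)
  have h7 : Real.exp (-X) =
      kappa m d γ ε b * (1 - γ) ^ 2 / (24 * √(coreBound m d γ ε b) * (2 * m - 1)) := by
    rw [hX, h.log_rolloutLength, ← Real.log_inv, Real.exp_log (by positivity), inv_div]
  rw [h7] at h6
  calc _ ≤ kappa m d γ ε b * (1 - γ) ^ 2 / (24 * √(coreBound m d γ ε b) * (2 * m - 1)) /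
        (1 - γ) * √(coreBound m d γ ε b) * (2 * m - 1) := by gcongr
    _ = _ := by field_simp

/-- The shares add up: `3/24` for bias, truncation and Monte Carlo, `2.2/16` for the amplified
misspecification, `1/16` for the last `ε`. -/
lemma eta_le (h : Admissible m d γ ε b) : eta m d γ ε b ≤ 0.325 * (kappa m d γ ε b * (1 - γ)) := by
  have h1 := h.sqrt_regCoef
  have h2 := h.theta_mul
  have h3 := h.pow_rolloutLength_le
  have h4 := h.one_le_zeta
  have h5 := h.sixteen_mul_le
  have h6 : ε * √(coreBound m d γ ε b) * (2 * m - 1) ≤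
      2.2 / 16 * (kappa m d γ ε b * (1 - γ)) := by
    rw [h.kappa_mul]
    have := h.ε_pos
    calc _ ≤ ε * (2.2 * (√d * √(logTerm d ε b))) * (2 * m - 1) := by
          gcongr
          exact h.sqrt_coreBound_le
      _ = _ := by ring
  unfold eta
  nlinarith

lemma eta_nonneg (h : Admissible m d γ ε b) : 0 ≤ eta m d γ ε b := by
  have := h.b_pos
  have := h.ε_pos
  have := h.γ_nonneg
  have := h.one_sub_pos
  have := h.theta_pos
  have := h.one_le_zeta
  unfold eta
  positivity

end Admissible

/-! ### Numbers of iterations and rollouts, and the numerical regret estimate -/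

section Iterations

variable {m d : ℕ} {N : Fin m → ℕ} {γ ε b δ : ℝ}

lemma one_le_numIter : 1 ≤ numIter m d N γ ε b := le_max_left _ _

lemma logMaxAct_nonneg : 0 ≤ logMaxAct m N := Real.log_natCast_nonneg _

/-- The three terms in the definition of `numIter` form a perfect square. -/
lemma Admissible.le_numIter (h : Admissible m d γ ε b) :
    2 * m * logMaxAct m N * (2 * (1 / (kappa m d γ ε b * (1 - γ) ^ 2)) + 3 / 4) ^ 2 ≤
      numIter m d N γ ε b := by
  have h1 := h.kappa_pos
  have h2 := h.one_sub_pos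
  have e : (2 * (1 / (kappa m d γ ε b * (1 - γ) ^ 2)) + 3 / 4) ^ 2 =
      4 / (kappa m d γ ε b ^ 2 * (1 - γ) ^ 4) + 3 / (kappa m d γ ε b * (1 - γ) ^ 2) + 9 / 16 := by
    field_simp
    ring
  rw [e]
  exact (Nat.le_ceil _).trans (Nat.cast_le.2 (le_max_right _ _))

lemma Admissible.numIter_le (h : Admissible m d γ ε b) : (numIter m d N γ ε b : ℝ) ≤
    2 + 2 * m * logMaxAct m N * (2 * (1 / (kappa m d γ ε b * (1 - γ) ^ 2)) + 3 / 4) ^ 2 := by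
  have h1 := h.kappa_pos
  have h2 := h.one_sub_pos
  have h3 := h.one_le_m
  have h4 : 0 ≤ logMaxAct m N := logMaxAct_nonneg
  have e : (2 * (1 / (kappa m d γ ε b * (1 - γ) ^ 2)) + 3 / 4) ^ 2 =
      4 / (kappa m d γ ε b ^ 2 * (1 - γ) ^ 4) + 3 / (kappa m d γ ε b * (1 - γ) ^ 2) + 9 / 16 := by
    field_simp
    ring
  rw [e]
  set x := 2 * m * logMaxAct m N *
    (4 / (kappa m d γ ε b ^ 2 * (1 - γ) ^ 4) + 3 / (kappa m d γ ε b * (1 - γ) ^ 2) + 9 / 16)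
  have hx : 0 ≤ x := by positivity
  have h5 := (Nat.ceil_lt_add_one hx).le
  have h6 : (numIter m d N γ ε b : ℝ) = max 1 (⌈x⌉₊ : ℝ) := by
    unfold numIter
    push_cast
    rfl
  rw [h6]
  exact max_le (by linarith) (by linarith)

lemma log_prod_le_of_pos (hN : ∀ i, 0 < N i) :
    Real.log ((∏ i, N i : ℕ) : ℝ) ≤ m * logMaxAct m N := by
  have h0 : ∀ i ∈ Finset.univ, ((N i : ℕ) : ℝ) ≠ 0 := fun i _ => by
    exact_mod_cast (hN i).ne'
  push_cast
  rw [Real.log_prod h0]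
  calc ∑ i, Real.log (N i) ≤ ∑ _i : Fin m, logMaxAct m N := by
        refine Finset.sum_le_sum fun i _ => Real.log_le_log (by exact_mod_cast hN i) ?_
        exact_mod_cast Finset.le_sup (f := N) (Finset.mem_univ i)
    _ = _ := by simp

lemma Admissible.log_numRollouts_pos (h : Admissible m d γ ε b) (hδ : 0 < δ) (hδ1 : δ < 1) :
    0 < Real.log (4 * numIter m d N γ ε b * coreBound m d γ ε b ^ 2) - Real.log δ := by
  have h1 : (1 : ℝ) ≤ numIter m d N γ ε b := by exact_mod_cast one_le_numIter
  have h2 := h.two_le_coreBound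
  have h3 : 0 ≤ Real.log (4 * numIter m d N γ ε b * coreBound m d γ ε b ^ 2) :=
    Real.log_nonneg (by nlinarith)
  have h4 := Real.log_neg hδ hδ1
  linarith

lemma Admissible.numRollouts_pos (h : Admissible m d γ ε b) (hδ : 0 < δ) (hδ1 : δ < 1) :
    0 < numRollouts m d N γ ε b δ := by
  have h1 := h.log_numRollouts_pos (N := N) hδ hδ1
  have h2 := h.theta_pos
  have h3 := h.one_sub_pos
  exact Nat.ceil_pos.2 (by positivity)

/-- At most `C_max` passes, `K` iterations and `C_max` elements give `K C_max²` batches; `n` makes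
each fail with probability at most `δ/(K C_max²)`. -/
lemma Admissible.failure_le (h : Admissible m d γ ε b) (hδ : 0 < δ) {ℓ : ℕ}
    (hℓ : (ℓ : ℝ) ≤ coreBound m d γ ε b) :
    ℓ * (numIter m d N γ ε b * (ℓ * (4 * Real.exp (-(2 * numRollouts m d N γ ε b δ *
      theta m d γ ε b ^ 2 * (1 - γ) ^ 2))))) ≤ δ := by
  have h1 : (1 : ℝ) ≤ numIter m d N γ ε b := by exact_mod_cast one_le_numIter
  have h2 := h.two_le_coreBound
  have h3 := h.theta_pos
  have h4 := h.one_sub_pos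
  set K : ℝ := (numIter m d N γ ε b : ℝ)
  set C := coreBound m d γ ε b
  have h5 : (Real.log (4 * K * C ^ 2) - Real.log δ) / (2 * theta m d γ ε b ^ 2 * (1 - γ) ^ 2) ≤
      numRollouts m d N γ ε b δ := Nat.le_ceil _
  rw [div_le_iff₀ (by positivity), ← Real.log_div (by positivity) hδ.ne'] at h5
  have h6 : Real.exp (-(2 * numRollouts m d N γ ε b δ * theta m d γ ε b ^ 2 * (1 - γ) ^ 2)) ≤
      δ / (4 * K * C ^ 2) := by
    have : δ / (4 * K * C ^ 2) = Real.exp (-Real.log (4 * K * C ^ 2 / δ)) := by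
      rw [← Real.log_inv, Real.exp_log (by positivity), inv_div]
    rw [this]
    exact Real.exp_le_exp.2 (by linarith)
  calc _ ≤ C * (K * (C * (4 * (δ / (4 * K * C ^ 2))))) := by gcongr
    _ = δ := by field_simp

lemma regret_numeric {κ g R η Λ K D t : ℝ} (hg : 0 < g) (hg1 : g ≤ 1) (hκ : 0 < κ)
    (hsmall : 2 * κ < 1 / g) (hη : η ≤ 0.325 * (κ * g)) (hη0 : 0 ≤ η)
    (hR : R = 1 / g + 2 * η) (hD : D = 2 * (1 / (κ * g ^ 2)) + 3 / 4)
    (hΛ : 0.69 ≤ Λ) (hK : 2 * Λ * D ^ 2 ≤ K) (ht : t = √(2 * Λ / K)) :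
    (Λ / (1 / R * t) + K * (1 / R * t) * R ^ 2 / 8 + R + 2 * η * K) / g / K + 2 * η ≤ 2 * κ := by
  set k := κ * g with hk
  have hk0 : 0 < k := by positivity
  set U := 1 / (κ * g ^ 2) with hU
  have hUk : k * U = 1 / g := by rw [hU, hk]; field_simp
  have hgi : 1 ≤ 1 / g := by rw [le_div_iff₀ hg]; linarith
  have hk2 : 2 * k < 1 := by
    rw [lt_div_iff₀ hg] at hsmall
    linarith
  have hU2 : 2 < U := by
    have : 1 < U * (1 / 2) := by
      by_contra! hc
      have : k * U ≤ 1 := by nlinarith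
      have : k * U ≤ k * 2 := by nlinarith
      nlinarith
    linarith
  have hD0 : 4.75 ≤ D := by rw [hD]; linarith
  have hK0 : 0 < K := lt_of_lt_of_le (by positivity) hK
  have hR0 : 0 < R := by rw [hR]; positivity
  have ht2 : t ^ 2 = 2 * Λ / K := by rw [ht, Real.sq_sqrt (by positivity)]
  have ht0 : 0 < t := by rw [ht]; positivity
  have htD : t ≤ 1 / D := by
    rw [ht]
    apply Real.sqrt_le_iff.2
    refine ⟨by positivity, ?_⟩
    rw [div_le_iff₀ hK0, div_pow, one_pow, div_mul_eq_mul_div, one_mul,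
      le_div_iff₀ (by positivity)]
    exact hK
  have hRk : R ≤ k * (U + 0.65) := by
    rw [hR, mul_add, hUk]
    linarith
  -- The ratio `(U + 0.65)/(2U + 0.75)` decreases in `U` and is below `0.558` at `U = 2`.
  have hRD : R * (1 / D) ≤ 0.558 * k := by
    rw [mul_one_div, div_le_iff₀ (by linarith)]
    refine hRk.trans ?_
    have : U + 0.65 ≤ 0.558 * D := by rw [hD]; linarith
    nlinarith
  have hRt : R * t ≤ 0.558 * k := (mul_le_mul_of_nonneg_left htD hR0.le).trans hRD
  have hRK : R / K ≤ 0.09 * k := by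
    rw [div_le_iff₀ hK0]
    have h1 : 2 * 0.69 * D ^ 2 ≤ K := by nlinarith [sq_nonneg D]
    have h2 : R ≤ 0.558 * k * D := by
      have := mul_le_mul_of_nonneg_right hRD (by linarith : 0 ≤ D)
      rwa [mul_assoc, one_div_mul_cancel (by linarith), mul_one] at this
    have h3 : 0.09 * (2 * 0.69 * D ^ 2) ≥ 0.558 * D := by nlinarith
    nlinarith
  -- With temperature `t/R` and `Λ = t² K/2`, the two exponential-weights terms are `K R t/2` and `K
  -- R t/8`.
  have e : (Λ / (1 / R * t) + K * (1 / R * t) * R ^ 2 / 8 + R + 2 * η * K) / g / K + 2 * η =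
      (5 / 8 * (R * t) + R / K + 2 * η) / g + 2 * η := by
    have : Λ = t ^ 2 * K / 2 := by rw [ht2]; field_simp
    rw [this]
    field_simp
    ring
  rw [e]
  -- Numerically `5/8 · 0.558 + 0.09 + 0.65 < 1.1`; the remaining `2η ≤ 0.65 κ` keeps the total
  -- below `2κ`.
  have h4 : (5 / 8 * (R * t) + R / K + 2 * η) / g ≤ 1.1 * κ := by
    rw [div_le_iff₀ hg]
    nlinarith
  have h5 : k ≤ κ := by rw [hk]; nlinarith
  linarith

end Iterations

/-! ### Sub-optimality of the output -/

/-- Covers the case of one joint action, in which the temperature is 0 and the exponential-weights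
bound is not applicable. -/
lemma Policy.eq_of_subsingleton {S : Type u} [MeasurableSpace S] {A : Type v} [MeasurableSpace A]
    [Subsingleton A] (π π' : Policy S A) : π = π' := by
  have h : π.kernel = π'.kernel := by
    ext s B
    rcases B.eq_empty_or_nonempty with rfl | hB
    · simp
    · rw [Set.Nonempty.eq_univ hB, measure_univ, measure_univ]
  cases π
  cases π'
  cases h
  rfl

section Output

variable {S : Type u} [MeasurableSpace S] {m d : ℕ} {N : Fin m → ℕ}

lemma optValue_sub_le {A : Type v} [MeasurableSpace A] (M : MDP S A) (π₀ : Policy S A) {s : S}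
    {x y : ℝ} (h : ∀ π : Policy S A, M.value π s - x ≤ y) : M.optValue s - x ≤ y := by
  have : M.optValue s ≤ y + x := csSup_le ⟨_, π₀, rfl⟩ (by
    rintro _ ⟨π, rfl⟩
    linarith [h π])
  linarith

lemma sub_mixtureValue {A : Type v} [MeasurableSpace A] (M : MDP S A) {ι : Type*}
    (f : ι → Policy S A)
    {l : List ι} (hl : 0 < l.length) (s : S) (x : ℝ) :
    x - M.mixtureValue (l.map f) s =
      (∑ i : Fin l.length, (x - M.value (f l[i.1]) s)) / l.length := by
  have h : (l.length : ℝ) ≠ 0 := by exact_mod_cast hl.ne'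
  rw [MDP.mixtureValue_eq, List.map_map, List.length_map, Finset.sum_sub_distrib,
    ← Fin.sum_univ_fun_getElem]
  simp only [Finset.sum_const, Finset.card_univ, Fintype.card_fin, nsmul_eq_mul,
    Function.comp_apply]
  field_simp

/-- At `ρ` the virtual and actual policies have the same action law, and one estimate is `η`-close
to both action values, so replacing one by the other costs `2η` per policy. -/
lemma Shadowed.optValue_sub_mixtureValue_le {M : MDP S (Joint N)} {I : Input S d N}
    {π₀ : Policy S (Joint N)} {ρ : S} {η : ℝ} {l : List (Option (Fin d → ℝ))}
    (h : Shadowed M I π₀ ρ η (fun _ _ => 0) π₀ l) (hα : 0 < I.temp) (hη : 0 ≤ η)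
    (hl : 0 < l.length) :
    M.optValue ρ - M.mixtureValue (l.map (decode I π₀)) ρ ≤
      (Real.log (Fintype.card (Joint N)) / I.temp +
        l.length * I.temp * (1 / (1 - M.γ) + 2 * η) ^ 2 / 8 +
        (1 / (1 - M.γ) + 2 * η) + 2 * η * l.length) / (1 - M.γ) / l.length + 2 * η := by
  have : Nonempty (Joint N) := ⟨I.abar⟩
  obtain ⟨ν, q, -, hν, hq⟩ := h
  refine optValue_sub_le M π₀ fun π => ?_
  have h0 : (0 : ℝ) < l.length := by exact_mod_cast hl
  have h1 := politex_regret M hα hl ν q hη (fun k hk s => by simpa using hν k hk s)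
    (fun k hk => (hq k hk).1) π ρ
  have h2 : ∀ i : Fin l.length, M.value π ρ - M.value (decode I π₀ l[i.1]) ρ ≤
      (M.value π ρ - M.value (ν i) ρ) + 2 * η := by
    intro i
    obtain ⟨e1, e2, e3⟩ := hq i i.2
    have a1 := abs_le.1 (abs_integral_sub_le (μ := (ν i).kernel ρ) (e1 ρ))
    have a2 := abs_le.1 (abs_integral_sub_le (μ := (ν i).kernel ρ) e2)
    rw [← MDP.value_eq_integral_qvalue] at a1
    rw [e3, ← MDP.value_eq_integral_qvalue, ← e3] at a2
    linarith
  rw [sub_mixtureValue M (decode I π₀) hl, div_le_iff₀ h0, add_mul, div_mul_cancel₀ _ h0.ne']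
  refine (Finset.sum_le_sum fun i _ => h2 i).trans ?_
  rw [Finset.sum_range] at h1
  rw [Finset.sum_add_distrib]
  simp only [Finset.sum_const, Finset.card_univ, Fintype.card_fin, nsmul_eq_mul]
  linarith

lemma suboptimality_le_div (M : MDP S (Joint N)) {ι : Type*} (f : ι → Policy S (Joint N))
    {l : List ι} (hl : 0 < l.length) (s : S) :
    M.optValue s - M.mixtureValue (l.map f) s ≤ 1 / (1 - M.γ) := by
  have h0 : (0 : ℝ) < l.length := by exact_mod_cast hl
  refine optValue_sub_le M (f l[0]) fun π => ?_
  rw [sub_mixtureValue M f hl, div_le_iff₀ h0]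
  refine (Finset.sum_le_sum (g := fun _ => 1 / (1 - M.γ)) fun i _ => ?_).trans (le_of_eq ?_)
  · linarith [(M.value_mem π s).2, (M.value_mem (f l[i.1]) s).1]
  · simp [mul_comm]

lemma suboptimality_le_zero_of_subsingleton [Subsingleton (Joint N)] (M : MDP S (Joint N))
    {ι : Type*} (f : ι → Policy S (Joint N)) {l : List ι} (hl : 0 < l.length) (s : S) :
    M.optValue s - M.mixtureValue (l.map f) s ≤ 0 := by
  refine optValue_sub_le M (f l[0]) fun π => ?_
  rw [sub_mixtureValue M f hl]
  refine (div_eq_zero_iff.2 (Or.inl (Finset.sum_eq_zero fun i _ => ?_))).le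
  rw [π.eq_of_subsingleton (f l[i.1]), sub_self]

lemma two_kappa_le {γ ε b : ℝ} (h : Admissible m d γ ε b) :
    2 * kappa m d γ ε b ≤ 64 * ε * m * √d / (1 - γ) *
      (1 + Real.log (1 + b ^ 2 * ε⁻¹ ^ 2 * (d : ℝ)⁻¹)) ^ (1 / 2 : ℝ) := by
  have h1 := h.ε_pos
  have h2 := h.one_sub_pos
  have h3 := h.one_le_d
  have e : 1 + Real.log (1 + b ^ 2 * ε⁻¹ ^ 2 * (d : ℝ)⁻¹) = logTerm d ε b := by
    unfold logTerm
    congr 3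
    field_simp
  rw [e, ← Real.sqrt_eq_rpow]
  have e2 : 2 * kappa m d γ ε b =
      32 * ε * √d / (1 - γ) * √(logTerm d ε b) * (2 * m - 1) := by
    unfold kappa
    ring
  have e3 : 64 * ε * m * √d / (1 - γ) * √(logTerm d ε b) =
      32 * ε * √d / (1 - γ) * √(logTerm d ε b) * (2 * m) := by
    ring
  rw [e2, e3]
  gcongr
  linarith

lemma suboptimality_le_of_shadowed {M : MDP S (Joint N)} {F : Features S d N} {ε b δ : ℝ}
    (h : Admissible m d M.γ ε b) {abar : Joint N} {π₀ : Policy S (Joint N)} {ρ : S}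
    {l : List (Option (Fin d → ℝ))} (hl : l.length = numIter m d N M.γ ε b)
    (hs : Shadowed M (tunedInput M.γ ε b δ F abar) π₀ ρ (eta m d M.γ ε b) (fun _ _ => 0) π₀ l) :
    M.optValue ρ - M.mixtureValue (l.map (decode (tunedInput M.γ ε b δ F abar) π₀)) ρ ≤
      2 * kappa m d M.γ ε b := by
  have hl0 : 0 < l.length := hl ▸ one_le_numIter
  have hκ := h.kappa_pos
  have hg := h.one_sub_pos
  rcases subsingleton_or_nontrivial (Joint N) with hN | hN
  · exact (suboptimality_le_zero_of_subsingleton M _ hl0 ρ).trans (by linarith)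
  -- If the target is at least `1/(1-γ)`, the range of values already gives the claim; otherwise
  -- `regret_numeric` has its smallness hypothesis.
  rcases le_or_gt (1 / (1 - M.γ)) (2 * kappa m d M.γ ε b) with hc | hc
  · exact (suboptimality_le_div M _ hl0 ρ).trans hc
  have hNpos : ∀ i, 0 < N i := fun i => (abar i).pos
  have hcard : Fintype.card (Joint N) = ∏ i, N i := by simp
  have h2 : 2 ≤ ∏ i, N i := hcard ▸ Fintype.one_lt_card
  have hΛ : 0.69 ≤ Real.log ((∏ i, N i : ℕ) : ℝ) := by
    have h3 : Real.log 2 ≤ Real.log ((∏ i, N i : ℕ) : ℝ) :=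
      Real.log_le_log (by norm_num) (by exact_mod_cast h2)
    linarith [Real.log_two_gt_d9]
  have hK0 : (0 : ℝ) < numIter m d N M.γ ε b := by exact_mod_cast one_le_numIter
  have hη := h.eta_nonneg
  have hα : 0 < temperature m d N M.γ ε b := by
    have : 0 < Real.log ((∏ i, N i : ℕ) : ℝ) := by linarith
    unfold temperature
    positivity
  have hr := hs.optValue_sub_mixtureValue_le hα hη hl0
  rw [hl, hcard] at hr
  refine hr.trans ?_
  refine regret_numeric hg h.one_sub_le hκ hc h.eta_le hη rfl rfl hΛ ?_ rfl
  refine le_trans ?_ h.le_numIter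
  have := log_prod_le_of_pos hNpos
  rw [mul_assoc 2 (m : ℝ)]
  gcongr

end Output

/-! ### Query complexity -/

namespace Admissible

variable {m d : ℕ} {N : Fin m → ℕ} {γ ε b δ : ℝ}

lemma logTerm_le (h : Admissible m d γ ε b) :
    logTerm d ε b ≤ 1 + 2 * Real.log (1 + b) + 2 * Real.log (1 + 1 / ε) := by
  have h1 := h.ε_pos
  have h2 := h.b_pos
  have h3 := h.one_le_d
  have e : 2 * Real.log (1 + b) + 2 * Real.log (1 + 1 / ε) =
      Real.log (((1 + b) * (1 + 1 / ε)) ^ 2) := by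
    rw [Real.log_pow, Real.log_mul (by positivity) (by positivity)]
    push_cast
    ring
  have h4 : 1 + b ^ 2 / (ε ^ 2 * d) ≤ ((1 + b) * (1 + 1 / ε)) ^ 2 := by
    have h5 : b ^ 2 / (ε ^ 2 * d) ≤ (b * (1 / ε)) ^ 2 := by
      rw [mul_pow, one_div, inv_pow, ← div_eq_mul_inv]
      gcongr
      exact le_mul_of_one_le_right (by positivity) h3
    have h6 : 0 ≤ b * (1 / ε) := by positivity
    have h7 : 1 + b * (1 / ε) ≤ (1 + b) * (1 + 1 / ε) := by
      have : 0 ≤ 1 / ε := by positivity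
      nlinarith
    calc _ ≤ (1 + b * (1 / ε)) ^ 2 := by nlinarith
      _ ≤ _ := by gcongr
  rw [add_assoc, e]
  exact add_le_add_right (Real.log_le_log (by positivity) h4) 1

/-- In `θ²` the factor `d · logTerm` of `κ²` cancels against `coreBound`, and `2m - 1` cancels too.
The constants give `ε² ≤ 10.8 θ²`, as `576 · 4.8/256 = 10.8`. -/
lemma inv_theta_sq_le (h : Admissible m d γ ε b) :
    1 / (2 * theta m d γ ε b ^ 2 * (1 - γ) ^ 2) ≤ 5.4 / (ε ^ 2 * (1 - γ) ^ 2) := by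
  have h1 := h.ε_pos
  have h2 := h.one_sub_pos
  have h3 := h.one_le_d
  have h4 := h.one_le_zeta
  have h5 := h.one_le_logTerm
  have h6 := h.two_le_coreBound
  have h7 := h.theta_pos
  have e : theta m d γ ε b ^ 2 * (576 * coreBound m d γ ε b) =
      256 * ε ^ 2 * d * logTerm d ε b := by
    unfold theta
    rw [div_pow, h.kappa_mul_sq, mul_pow, Real.sq_sqrt (by linarith)]
    field_simp
    ring
  have h8 : ε ^ 2 ≤ 10.8 * theta m d γ ε b ^ 2 := by
    have hp : 0 < d * logTerm d ε b := by positivity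
    have := mul_le_mul_of_nonneg_left h.coreBound_le (sq_nonneg (theta m d γ ε b))
    have h9 : ε ^ 2 * (d * logTerm d ε b) ≤ 10.8 * theta m d γ ε b ^ 2 * (d * logTerm d ε b) := by
      nlinarith
    exact le_of_mul_le_mul_right h9 hp
  rw [div_le_div_iff₀ (by positivity) (by positivity)]
  have := mul_le_mul_of_nonneg_right h8 (sq_nonneg (1 - γ))
  nlinarith

lemma numRollouts_le (h : Admissible m d γ ε b) (hδ : 0 < δ) (hδ1 : δ < 1) :
    (numRollouts m d N γ ε b δ : ℝ) ≤
      (Real.log (4 * numIter m d N γ ε b * coreBound m d γ ε b ^ 2) + Real.log (1 / δ)) *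
        (5.4 / (ε ^ 2 * (1 - γ) ^ 2)) + 1 := by
  have h1 := h.log_numRollouts_pos (N := N) hδ hδ1
  have h2 := h.theta_pos
  have h3 := h.one_sub_pos
  have h4 : (numRollouts m d N γ ε b δ : ℝ) ≤ _ :=
    (Nat.ceil_lt_add_one (by positivity : 0 ≤
      (Real.log (4 * numIter m d N γ ε b * coreBound m d γ ε b ^ 2) - Real.log δ) /
        (2 * theta m d γ ε b ^ 2 * (1 - γ) ^ 2))).le
  refine h4.trans ?_
  rw [one_div δ, Real.log_inv, ← sub_eq_add_neg, div_eq_mul_one_div]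
  exact add_le_add_left (mul_le_mul_of_nonneg_left h.inv_theta_sq_le h1.le) 1

/-- Inside the logarithm `m`, `d` and `logTerm` cancel, leaving `24 · 2.2/16 = 3.3`; one more
`1/(1-γ)` pays for the additional step. -/
lemma rolloutLength_add_one_le (h : Admissible m d γ ε b) :
    (rolloutLength m d γ ε b + 1 : ℝ) ≤
      (2.3 + Real.log (1 + 1 / ε) + Real.log (1 / (1 - γ))) / (1 - γ) := by
  have h1 := h.ε_pos
  have h2 := h.one_sub_pos
  have h3 := h.one_le_d
  have h4 := h.one_le_zeta
  have h5 := h.one_le_logTerm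
  have h6 := h.sqrt_coreBound_pos
  have h7 := h.kappa_pos
  have hl1 : 0 ≤ Real.log (1 + 1 / ε) := Real.log_nonneg (by
    have : 0 ≤ 1 / ε := by positivity
    linarith)
  have hl2 : 0 ≤ Real.log (1 / (1 - γ)) := Real.log_nonneg (by
    rw [le_div_iff₀ h2]
    linarith [h.one_sub_le])
  have h8 : 24 * √(coreBound m d γ ε b) * (2 * m - 1) / (kappa m d γ ε b * (1 - γ) ^ 2) ≤
      3.3 * (1 + 1 / ε) * (1 / (1 - γ)) := by
    have e : kappa m d γ ε b * (1 - γ) ^ 2 =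
        16 * ε * √d * (2 * m - 1) * √(logTerm d ε b) * (1 - γ) := by
      rw [← h.kappa_mul]
      ring
    have hs := h.one_le_sqrt_logTerm
    have hd := h.one_le_sqrt_d
    calc _ ≤ 24 * (2.2 * (√d * √(logTerm d ε b))) * (2 * m - 1) /
          (kappa m d γ ε b * (1 - γ) ^ 2) := by
          gcongr
          exact h.sqrt_coreBound_le
      _ = 3.3 * (1 / ε) * (1 / (1 - γ)) := by
          rw [e]
          have : (2 * (m : ℝ) - 1) ≠ 0 := by linarith
          field_simp
          ring
      _ ≤ _ := by
          gcongr
          linarith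
  have h9 : Real.log 3.3 ≤ 1.3 := by
    have := Real.log_le_sub_one_of_pos (x := 3.3 / Real.exp 1) (by positivity)
    rw [Real.log_div (by norm_num) (by positivity), Real.log_exp] at this
    have h10 : 3.3 / Real.exp 1 ≤ 1.3 := by
      rw [div_le_iff₀ (by positivity)]
      linarith [Real.exp_one_gt_d9]
    linarith
  have h11 := Real.log_le_log (by positivity) h8
  rw [Real.log_mul (by positivity) (by positivity), Real.log_mul (by norm_num) (by positivity),
    ← h.log_rolloutLength] at h11
  have h12 : 1 ≤ 1 / (1 - γ) := by
    rw [le_div_iff₀ h2]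
    linarith [h.one_sub_le]
  have h13 : (2.3 + Real.log (1 + 1 / ε) + Real.log (1 / (1 - γ))) / (1 - γ) =
      (1.3 + Real.log (1 + 1 / ε) + Real.log (1 / (1 - γ))) / (1 - γ) + 1 / (1 - γ) := by
    ring
  have h14 : 0 ≤ (1.3 + Real.log (1 + 1 / ε) + Real.log (1 / (1 - γ))) / (1 - γ) := by
    positivity
  have h15 : (Real.log (24 * √(coreBound m d γ ε b) * (2 * m - 1)) -
      Real.log (kappa m d γ ε b * (1 - γ) ^ 2)) / (1 - γ) ≤
      (1.3 + Real.log (1 + 1 / ε) + Real.log (1 / (1 - γ))) / (1 - γ) := by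
    gcongr
    linarith
  have h16 : (rolloutLength m d γ ε b : ℝ) ≤
      (1.3 + Real.log (1 + 1 / ε) + Real.log (1 / (1 - γ))) / (1 - γ) := by
    unfold rolloutLength
    rcases le_total 0 ((Real.log (24 * √(coreBound m d γ ε b) * (2 * m - 1)) -
      Real.log (kappa m d γ ε b * (1 - γ) ^ 2)) / (1 - γ) - 1) with hx | hx
    · linarith [Nat.ceil_lt_add_one hx]
    · rw [Nat.ceil_eq_zero.2 hx]
      exact_mod_cast h14
  linarith

lemma logs_nonneg (h : Admissible m d γ ε b) (hδ : 0 < δ) (hδ1 : δ < 1) :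
    0 ≤ Real.log (1 + m) ∧ 0 ≤ Real.log (1 + d) ∧ 0 ≤ logMaxAct m N ∧
      0 ≤ Real.log (1 / (1 - γ)) ∧ 0 ≤ Real.log (1 + 1 / ε) ∧ 0 ≤ Real.log (1 / δ) ∧
      0 ≤ Real.log (1 + b) := by
  have h1 := h.one_le_m
  have h2 := h.one_le_d
  have h3 := h.b_pos
  have h4 := h.one_sub_pos
  have h5 : 0 < 1 / ε := one_div_pos.2 h.ε_pos
  refine ⟨Real.log_nonneg (by linarith), Real.log_nonneg (by linarith), logMaxAct_nonneg,
    Real.log_nonneg ?_, Real.log_nonneg (by linarith), Real.log_nonneg ?_,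
    Real.log_nonneg (by linarith)⟩
  · rw [le_div_iff₀ h4]
    linarith [h.one_sub_le]
  · rw [le_div_iff₀ hδ]
    linarith

lemma one_le_logFactor (h : Admissible m d γ ε b) (hδ : 0 < δ) (hδ1 : δ < 1) :
    1 ≤ logFactor m d N γ ε b δ := by
  obtain ⟨h1, h2, h3, h4, h5, h6, h7⟩ := h.logs_nonneg (N := N) hδ hδ1
  unfold logFactor
  linarith

/-- The condition on `κ` makes `u ≥ 1`, so the quadratic term dominates the lower-order terms and
the rounding. -/
lemma numIter_le_of_kappa_le (h : Admissible m d γ ε b) (hδ : 0 < δ) (hδ1 : δ < 1)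
    (hκ : kappa m d γ ε b ≤ 1 / (1 - γ)) :
    (numIter m d N γ ε b : ℝ) ≤ 18 * m * logFactor m d N γ ε b δ /
      (256 * ε ^ 2 * d * (2 * m - 1) ^ 2 * logTerm d ε b * (1 - γ) ^ 2) := by
  have hg := h.one_sub_pos
  have hk := h.kappa_pos
  have hm := h.one_le_m
  obtain ⟨h1, h2, h3, h4, h5, h6, h7⟩ := h.logs_nonneg (N := N) hδ hδ1
  set u := 1 / (kappa m d γ ε b * (1 - γ) ^ 2) with hu
  have hu1 : 1 ≤ u := by
    rw [hu, le_div_iff₀ (by positivity)]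
    rw [le_div_iff₀ hg] at hκ
    nlinarith [h.one_sub_le]
  have e : 18 * m * logFactor m d N γ ε b δ /
      (256 * ε ^ 2 * d * (2 * m - 1) ^ 2 * logTerm d ε b * (1 - γ) ^ 2) =
      18 * m * logFactor m d N γ ε b δ * u ^ 2 := by
    rw [← h.kappa_mul_sq, hu]
    field_simp
  rw [e]
  refine h.numIter_le.trans ?_
  have hu2 : (2 * u + 3 / 4) ^ 2 ≤ 8 * u ^ 2 := by nlinarith
  have hu3 : 1 ≤ u ^ 2 := one_le_pow₀ hu1
  have hlog : 1 + logMaxAct m N ≤ logFactor m d N γ ε b δ := by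
    unfold logFactor
    linarith
  calc 2 + 2 * m * logMaxAct m N * (2 * u + 3 / 4) ^ 2
      ≤ 18 * m * 1 * 1 + 2 * m * logMaxAct m N * (8 * u ^ 2) := by
        gcongr
        linarith
    _ ≤ 18 * m * 1 * u ^ 2 + 2 * m * logMaxAct m N * (8 * u ^ 2) := by gcongr
    _ ≤ 18 * m * (1 + logMaxAct m N) * u ^ 2 := by
        have : 0 ≤ m * logMaxAct m N * u ^ 2 := by positivity
        nlinarith
    _ ≤ _ := by gcongr

lemma numRollouts_le_of_kappa_le (h : Admissible m d γ ε b) (hδ : 0 < δ) (hδ1 : δ < 1)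
    (hκ : kappa m d γ ε b ≤ 1 / (1 - γ)) :
    (numRollouts m d N γ ε b δ : ℝ) ≤
      23 * logFactor m d N γ ε b δ / (ε ^ 2 * (1 - γ) ^ 2) := by
  have hg := h.one_sub_pos
  have hg1 := h.one_sub_le
  have hε := h.ε_pos
  have hm := h.one_le_m
  have hd := h.one_le_d
  have hζ := h.one_le_zeta
  have hL := h.one_le_logTerm
  have hC := h.two_le_coreBound
  have hK : (1 : ℝ) ≤ numIter m d N γ ε b := by exact_mod_cast one_le_numIter
  have hΛ := h.one_le_logFactor (N := N) hδ hδ1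
  obtain ⟨h1, h2, h3, h4, h5, h6, h7⟩ := h.logs_nonneg (N := N) hδ hδ1
  set Λ := logFactor m d N γ ε b δ with hΛdef
  have hLΛ : logTerm d ε b ≤ 2 * Λ := by
    refine h.logTerm_le.trans ?_
    rw [hΛdef]
    unfold logFactor
    linarith
  have hbound : 4 * numIter m d N γ ε b * coreBound m d γ ε b ^ 2 ≤
      16 * (1 + m) * (1 + d) * Λ ^ 2 * (1 + 1 / ε) ^ 2 * (1 / (1 - γ)) ^ 2 := by
    calc _ ≤ 4 * (18 * m * Λ /
          (256 * ε ^ 2 * d * (2 * m - 1) ^ 2 * logTerm d ε b * (1 - γ) ^ 2)) *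
          (4.8 * (d * logTerm d ε b)) ^ 2 := by
          gcongr
          · exact h.numIter_le_of_kappa_le hδ hδ1 hκ
          · exact h.coreBound_le
      _ = 6.48 * m * d * Λ * logTerm d ε b * (1 / ε) ^ 2 * (1 / (1 - γ)) ^ 2 /
          (2 * m - 1) ^ 2 := by
          have : (2 * (m : ℝ) - 1) ≠ 0 := by linarith
          field_simp
          ring
      _ ≤ 6.48 * m * d * Λ * logTerm d ε b * (1 / ε) ^ 2 * (1 / (1 - γ)) ^ 2 :=
          div_le_self (by positivity) (one_le_pow₀ hζ)
      _ ≤ 8 * (1 + m) * (1 + d) * Λ * (2 * Λ) * (1 + 1 / ε) ^ 2 * (1 / (1 - γ)) ^ 2 := by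
          gcongr <;> linarith
      _ = _ := by ring
  have hlog : Real.log (4 * numIter m d N γ ε b * coreBound m d γ ε b ^ 2) ≤
      4 * Real.log 2 + Real.log (1 + m) + Real.log (1 + d) + 2 * Real.log Λ +
        2 * Real.log (1 + 1 / ε) + 2 * Real.log (1 / (1 - γ)) := by
    refine (Real.log_le_log (by positivity) hbound).trans (le_of_eq ?_)
    rw [Real.log_mul (by positivity) (by positivity), Real.log_mul (by positivity) (by positivity),
      Real.log_mul (by positivity) (by positivity), Real.log_mul (by positivity) (by positivity),
      Real.log_mul (by positivity) (by positivity), Real.log_pow, Real.log_pow, Real.log_pow,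
      show (16 : ℝ) = 2 ^ 4 by norm_num, Real.log_pow]
    push_cast
    ring
  -- `n` involves `log K`, and the bound on `K` contains `Λ`; this inequality closes the circle at
  -- the cost of a constant.
  have hlogΛ : Real.log Λ ≤ Λ - 1 := Real.log_le_sub_one_of_pos (by linarith)
  have hY : Real.log (4 * numIter m d N γ ε b * coreBound m d γ ε b ^ 2) + Real.log (1 / δ) ≤
      4 * Λ := by
    have : Λ = 1 + Real.log (1 + m) + Real.log (1 + d) + logMaxAct m N + Real.log (1 / (1 - γ)) +
      Real.log (1 + 1 / ε) + Real.log (1 / δ) + Real.log (1 + b) := rfl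
    linarith [Real.log_two_lt_d9]
  -- Used to absorb the `+ 1` of the ceiling into the main term.
  have hε1 : ε ≤ 1 := by
    have := h.sixteen_mul_le
    rw [le_div_iff₀ hg] at hκ
    linarith
  refine (h.numRollouts_le hδ hδ1).trans ?_
  have hp : 0 < ε ^ 2 * (1 - γ) ^ 2 := by positivity
  have hone : ε ^ 2 * (1 - γ) ^ 2 ≤ 1 :=
    mul_le_one₀ (pow_le_one₀ hε.le hε1) (by positivity) (pow_le_one₀ hg.le hg1)
  rw [le_div_iff₀ hp, add_mul, mul_assoc, div_mul_cancel₀ _ hp.ne']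
  linarith

/-- Of the factors `d²` and `logTerm²` in `coreBound²`, one `d` and one `logTerm` cancel against
`κ²` in `K`. The other `logTerm` is at most `2Λ` and gives the fourth power of the logarithmic
factor. -/
lemma queries_le_of_kappa_le (h : Admissible m d γ ε b) (hδ : 0 < δ) (hδ1 : δ < 1)
    (hκ : kappa m d γ ε b ≤ 1 / (1 - γ)) :
    coreBound m d γ ε b ^ 2 * numIter m d N γ ε b * numRollouts m d N γ ε b δ *
        (rolloutLength m d γ ε b + 1) ≤
      200 * logFactor m d N γ ε b δ ^ 4 * (m * d / (ε ^ 4 * (1 - γ) ^ 5)) := by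
  have hg := h.one_sub_pos
  have hε := h.ε_pos
  have hm := h.one_le_m
  have hd := h.one_le_d
  have hζ := h.one_le_zeta
  have hL := h.one_le_logTerm
  have hC := h.two_le_coreBound
  have hΛ := h.one_le_logFactor (N := N) hδ hδ1
  obtain ⟨h1, h2, h3, h4, h5, h6, h7⟩ := h.logs_nonneg (N := N) hδ hδ1
  set Λ := logFactor m d N γ ε b δ with hΛdef
  have hΛeq : Λ = 1 + Real.log (1 + m) + Real.log (1 + d) + logMaxAct m N +
    Real.log (1 / (1 - γ)) + Real.log (1 + 1 / ε) + Real.log (1 / δ) + Real.log (1 + b) := rfl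
  have hLΛ : logTerm d ε b ≤ 2 * Λ := h.logTerm_le.trans (by linarith)
  have hH : (rolloutLength m d γ ε b + 1 : ℝ) ≤ 2.3 * Λ / (1 - γ) :=
    h.rolloutLength_add_one_le.trans (by gcongr; linarith)
  calc _ ≤ (4.8 * (d * logTerm d ε b)) ^ 2 * (18 * m * Λ /
        (256 * ε ^ 2 * d * (2 * m - 1) ^ 2 * logTerm d ε b * (1 - γ) ^ 2)) *
        (23 * Λ / (ε ^ 2 * (1 - γ) ^ 2)) * (2.3 * Λ / (1 - γ)) := by
        gcongr
        · exact h.coreBound_le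
        · exact h.numIter_le_of_kappa_le hδ hδ1 hκ
        · exact h.numRollouts_le_of_kappa_le hδ hδ1 hκ
    _ = 85.698 * m * d * Λ ^ 3 * logTerm d ε b / (ε ^ 4 * (1 - γ) ^ 5) / (2 * m - 1) ^ 2 := by
        have : (2 * (m : ℝ) - 1) ≠ 0 := by linarith
        field_simp
        ring
    _ ≤ 85.698 * m * d * Λ ^ 3 * logTerm d ε b / (ε ^ 4 * (1 - γ) ^ 5) :=
        div_le_self (by positivity) (one_le_pow₀ hζ)
    _ ≤ 100 * m * d * Λ ^ 3 * (2 * Λ) / (ε ^ 4 * (1 - γ) ^ 5) := by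
        gcongr
        norm_num
    _ = _ := by ring

end Admissible

/-! ### Computation complexity -/

section RunCost

variable {S : Type u} [MeasurableSpace S] {m d : ℕ} {N : Fin m → ℕ} {y : ℝ}

lemma sampleCost_eq : sampleCost d N = (∑ i, N i) * (3 * d + 3) + m := by
  simp [sampleCost, Finset.sum_add_distrib, Finset.sum_mul]

lemma davCost_le_pow {A ℓ : ℕ} (hy : 1 ≤ y) (hd : (d : ℝ) ≤ y) (hm : (m : ℝ) ≤ y)
    (hA : (A : ℝ) ≤ y) (hℓ : (ℓ : ℝ) ≤ y) : (davCost d m A ℓ : ℝ) ≤ 17 * y ^ 3 := by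
  have h1 : y ^ 2 ≤ y ^ 3 := pow_le_pow_right₀ hy (by norm_num)
  have h2 : y ^ 1 ≤ y ^ 3 := pow_le_pow_right₀ hy (by norm_num)
  unfold davCost
  push_cast
  calc _ ≤ y * y + y * (5 * y * y + 2 * y + 1) + y * (y + 2 * y * y + 2 * y * y + 2 * y + 1) := by
        gcongr
    _ = 9 * y ^ 3 + 6 * y ^ 2 + 2 * y ^ 1 := by ring
    _ ≤ _ := by linarith

lemma sampleCost_le_pow (hy : 1 ≤ y) (hd : (d : ℝ) ≤ y) (hm : (m : ℝ) ≤ y)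
    (hA : ((∑ i, N i : ℕ) : ℝ) ≤ y) : (sampleCost d N : ℝ) ≤ 7 * y ^ 2 := by
  have h2 : y ^ 1 ≤ y ^ 2 := pow_le_pow_right₀ hy (by norm_num)
  rw [sampleCost_eq, Nat.cast_add, Nat.cast_mul]
  push_cast at hA ⊢
  calc _ ≤ y * (3 * y + 3) + y := by gcongr
    _ = 3 * y ^ 2 + 4 * y ^ 1 := by ring
    _ ≤ _ := by linarith

lemma stepCost_le_pow {ℓ : ℕ} (hy : 1 ≤ y) (hd : (d : ℝ) ≤ y) (hm : (m : ℝ) ≤ y)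
    (hA : ((∑ i, N i : ℕ) : ℝ) ≤ y) (hℓ : (ℓ : ℝ) ≤ y) : (stepCost d N ℓ : ℝ) ≤ 29 * y ^ 3 := by
  have h1 : y ^ 2 ≤ y ^ 3 := pow_le_pow_right₀ hy (by norm_num)
  have h2 : 1 ≤ y ^ 3 := one_le_pow₀ hy
  have h3 := davCost_le_pow hy hd hm hA hℓ
  have h4 := sampleCost_le_pow hy hd hm hA
  unfold stepCost
  rw [Nat.cast_add, Nat.cast_add]
  push_cast at h3 ⊢
  linarith

lemma rolloutCost_le_pow {I : Input S d N} {ℓ : ℕ} (hy : 1 ≤ y) (hd : (d : ℝ) ≤ y)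
    (hm : (m : ℝ) ≤ y) (hA : ((∑ i, N i : ℕ) : ℝ) ≤ y) (hℓ : (ℓ : ℝ) ≤ y) (hn : (I.n : ℝ) ≤ y)
    (hH : (I.H : ℝ) ≤ y) : (rolloutCost I ℓ : ℝ) ≤ 32 * y ^ 5 := by
  have h1 : y ^ 1 ≤ y ^ 5 := pow_le_pow_right₀ hy (by norm_num)
  have h2 : 1 ≤ y ^ 5 := one_le_pow₀ hy
  have h3 := stepCost_le_pow hy hd hm hA hℓ
  unfold rolloutCost
  push_cast
  calc _ ≤ y * (y * (29 * y ^ 3) + 2) + 1 := by gcongr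
    _ = 29 * y ^ 5 + 2 * y ^ 1 + 1 := by ring
    _ ≤ _ := by linarith

lemma iterationCost_le_pow {I : Input S d N} {ℓ : ℕ} (hy : 1 ≤ y) (hd : (d : ℝ) ≤ y)
    (hm : (m : ℝ) ≤ y) (hA : ((∑ i, N i : ℕ) : ℝ) ≤ y) (hℓ : (ℓ : ℝ) ≤ y) (hn : (I.n : ℝ) ≤ y)
    (hH : (I.H : ℝ) ≤ y) : (iterationCost I ℓ : ℝ) ≤ 47 * y ^ 6 := by
  have h1 : y ^ 1 ≤ y ^ 6 := pow_le_pow_right₀ hy (by norm_num)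
  have h2 : y ^ 2 ≤ y ^ 6 := pow_le_pow_right₀ hy (by norm_num)
  have h3 : y ^ 3 ≤ y ^ 6 := pow_le_pow_right₀ hy (by norm_num)
  have h4 := rolloutCost_le_pow (I := I) hy hd hm hA hℓ hn hH
  unfold iterationCost
  push_cast
  calc _ ≤ y * (32 * y ^ 5) +
        (y * y + y * (5 * y * y + 2 * y + 1) + (y + y * (2 * y) + 2 * y * y)) + y := by gcongr
    _ = 32 * y ^ 6 + 5 * y ^ 3 + 7 * y ^ 2 + 3 * y ^ 1 := by ring
    _ ≤ _ := by linarith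

lemma runCost_le_pow {I : Input S d N} {ℓ : ℕ} (hy : 1 ≤ y) (hd : (d : ℝ) ≤ y)
    (hm : (m : ℝ) ≤ y) (hA : ((∑ i, N i : ℕ) : ℝ) ≤ y) (hℓ : (ℓ : ℝ) ≤ y) (hn : (I.n : ℝ) ≤ y)
    (hH : (I.H : ℝ) ≤ y) (hK : (I.K : ℝ) ≤ y) : (runCost I ℓ : ℝ) ≤ 66 * y ^ 8 := by
  have h1 : y ^ 2 ≤ y ^ 8 := pow_le_pow_right₀ hy (by norm_num)
  have h2 : y ^ 4 ≤ y ^ 8 := pow_le_pow_right₀ hy (by norm_num)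
  have h3 := davCost_le_pow hy hd hm hA hℓ
  have h4 := iterationCost_le_pow (I := I) hy hd hm hA hℓ hn hH
  unfold runCost
  rw [Nat.cast_add, Nat.cast_add, Nat.cast_mul, Nat.cast_mul, Nat.cast_mul, Nat.cast_mul,
    Nat.cast_mul]
  calc _ ≤ 2 * y * y + (y * (17 * y ^ 3) + y * (y * (47 * y ^ 6))) := by
        gcongr
        norm_num
    _ = 47 * y ^ 8 + 17 * y ^ 4 + 2 * y ^ 2 := by ring
    _ ≤ _ := by linarith

end RunCost

/-- The polynomial that bounds the computation time. -/
def timePoly : MvPolynomial (Fin 6) ℝ :=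
  MvPolynomial.C 66 * (MvPolynomial.C (10 ^ 4) * (1 + ∑ i, MvPolynomial.X i) ^ 14) ^ 8

lemma eval_timePoly (x : Fin 6 → ℝ) :
    MvPolynomial.eval x timePoly = 66 * (10 ^ 4 * (1 + ∑ i, x i) ^ 14) ^ 8 := by
  simp [timePoly]

namespace Admissible

variable {m d : ℕ} {N : Fin m → ℕ} {γ ε b δ x : ℝ}

lemma coreBound_le_pow (h : Admissible m d γ ε b) (hx : 1 ≤ x) (hd : (d : ℝ) ≤ x)
    (hb : 1 + Real.log (1 + b) + 1 / ε ≤ x) : coreBound m d γ ε b ≤ 9.6 * x ^ 2 := by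
  have h1 := h.logTerm_le
  have h2 : 0 < 1 / ε := one_div_pos.2 h.ε_pos
  have h3 : Real.log (1 + 1 / ε) ≤ 1 / ε := by
    linarith [Real.log_le_sub_one_of_pos (x := 1 + 1 / ε) (by linarith)]
  have h4 : logTerm d ε b ≤ 2 * x := by linarith
  have h5 := h.one_le_logTerm
  calc _ ≤ 4.8 * (d * logTerm d ε b) := h.coreBound_le
    _ ≤ 4.8 * (x * (2 * x)) := by gcongr
    _ = _ := by ring

lemma numIter_le_pow (h : Admissible m d γ ε b) (hx : 1 ≤ x) (hm : (m : ℝ) ≤ x)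
    (hN : ((∑ i, N i : ℕ) : ℝ) ≤ x) (hε : 1 / ε ≤ x) (hγ : 1 / (1 - γ) ≤ x) :
    (numIter m d N γ ε b : ℝ) ≤ 4 * x ^ 6 := by
  have h1 := h.ε_pos
  have h2 := h.one_sub_pos
  have h3 := h.sixteen_mul_le
  have h4 := h.kappa_pos
  have hA0 : 0 ≤ logMaxAct m N := logMaxAct_nonneg
  have hA : logMaxAct m N ≤ x := by
    refine (Real.log_le_self (Nat.cast_nonneg _)).trans (le_trans ?_ hN)
    exact_mod_cast Finset.sup_le fun i hi =>
      Finset.single_le_sum (f := N) (fun j _ => Nat.zero_le _) hi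
  have hu : 1 / (kappa m d γ ε b * (1 - γ) ^ 2) ≤ x ^ 2 / 16 := by
    calc _ ≤ 1 / (16 * ε * (1 - γ)) := by
          refine one_div_le_one_div_of_le (by positivity) ?_
          have := mul_le_mul_of_nonneg_right h3 h2.le
          nlinarith
      _ = (1 / ε) * (1 / (1 - γ)) / 16 := by field_simp
      _ ≤ x * x / 16 := by gcongr
      _ = _ := by ring
  have hx2 : 1 ≤ x ^ 2 := one_le_pow₀ hx
  have hx6 : 1 ≤ x ^ 6 := one_le_pow₀ hx
  calc _ ≤ _ := h.numIter_le
    _ ≤ 2 + 2 * x * x * (x ^ 2) ^ 2 := by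
        gcongr
        linarith
    _ = 2 + 2 * x ^ 6 := by ring
    _ ≤ _ := by linarith

lemma numRollouts_le_pow (h : Admissible m d γ ε b) (hδ : 0 < δ) (hδ1 : δ < 1) (hx : 1 ≤ x)
    (hC : coreBound m d γ ε b ≤ 9.6 * x ^ 2) (hK : (numIter m d N γ ε b : ℝ) ≤ 4 * x ^ 6)
    (hε : 1 / ε ≤ x) (hγ : 1 / (1 - γ) ≤ x) (hδx : Real.log (1 / δ) ≤ x) :
    (numRollouts m d N γ ε b δ : ℝ) ≤ 8000 * x ^ 14 := by
  have h1 := h.ε_pos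
  have h2 := h.one_sub_pos
  have h3 := h.two_le_coreBound
  have hx10 : x ^ 1 ≤ x ^ 10 := pow_le_pow_right₀ hx (by norm_num)
  have hx14 : 1 ≤ x ^ 14 := one_le_pow₀ hx
  have h4 : Real.log (4 * numIter m d N γ ε b * coreBound m d γ ε b ^ 2) ≤ 1475 * x ^ 10 := by
    calc _ ≤ 4 * numIter m d N γ ε b * coreBound m d γ ε b ^ 2 := Real.log_le_self (by positivity)
      _ ≤ 4 * (4 * x ^ 6) * (9.6 * x ^ 2) ^ 2 := by gcongr
      _ = 1474.56 * x ^ 10 := by ring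
      _ ≤ _ := by
        gcongr
        norm_num
  calc _ ≤ _ := h.numRollouts_le hδ hδ1
    _ = (Real.log (4 * numIter m d N γ ε b * coreBound m d γ ε b ^ 2) + Real.log (1 / δ)) *
        (5.4 * ((1 / ε) ^ 2 * (1 / (1 - γ)) ^ 2)) + 1 := by
        field_simp
    _ ≤ (1475 * x ^ 10 + x ^ 10) * (5.4 * (x ^ 2 * x ^ 2)) + 1 := by
        have : Real.log (1 / δ) ≤ x ^ 10 := by linarith
        gcongr
    _ = 7970.4 * x ^ 14 + 1 := by ring
    _ ≤ _ := by linarith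

lemma rolloutLength_le_pow (h : Admissible m d γ ε b) (hx : 1 ≤ x)
    (hεγ : 1 / ε + 1 / (1 - γ) ≤ x) : (rolloutLength m d γ ε b : ℝ) ≤ 4 * x ^ 2 := by
  have h2 : 0 < 1 / ε := one_div_pos.2 h.ε_pos
  have h3 : 0 < 1 / (1 - γ) := one_div_pos.2 h.one_sub_pos
  have h4 : Real.log (1 + 1 / ε) ≤ 1 / ε := by
    linarith [Real.log_le_sub_one_of_pos (x := 1 + 1 / ε) (by linarith)]
  have h5 : Real.log (1 / (1 - γ)) ≤ 1 / (1 - γ) := Real.log_le_self h3.le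
  have h6 := h.rolloutLength_add_one_le
  have h7 : x ^ 1 ≤ x ^ 2 := pow_le_pow_right₀ hx (by norm_num)
  have h8 : (2.3 + Real.log (1 + 1 / ε) + Real.log (1 / (1 - γ))) / (1 - γ) ≤ (2.3 + x) * x := by
    rw [div_eq_mul_one_div]
    exact mul_le_mul (by linarith) (by linarith) h3.le (by linarith)
  nlinarith

lemma runCost_le (h : Admissible m d γ ε b) (hδ : 0 < δ) (hδ1 : δ < 1) (hN : ∀ i, 0 < N i)
    {S : Type u} [MeasurableSpace S] (F : Features S d N) (abar : Joint N) {ℓ : ℕ}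
    (hℓ : (ℓ : ℝ) ≤ coreBound m d γ ε b) :
    (runCost (tunedInput γ ε b δ F abar) ℓ : ℝ) ≤ MvPolynomial.eval
      ![∑ i, (N i : ℝ), (d : ℝ), 1 / (1 - γ), 1 / ε, Real.log (1 / δ), Real.log (1 + b)]
      timePoly := by
  obtain ⟨-, -, -, -, -, l1, l2⟩ := h.logs_nonneg (N := N) hδ hδ1
  have h1 : 0 < 1 / ε := one_div_pos.2 h.ε_pos
  have h2 : 0 < 1 / (1 - γ) := one_div_pos.2 h.one_sub_pos
  have h3 := h.one_le_d
  have hmN : (m : ℝ) ≤ ((∑ i, N i : ℕ) : ℝ) := by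
    have : ∑ _i : Fin m, 1 ≤ ∑ i, N i := Finset.sum_le_sum fun i _ => hN i
    exact_mod_cast (by simpa using this)
  have hm := h.one_le_m
  rw [eval_timePoly]
  set x : ℝ := 1 + ∑ i, ![∑ i, (N i : ℝ), (d : ℝ), 1 / (1 - γ), 1 / ε, Real.log (1 / δ),
    Real.log (1 + b)] i with hxdef
  have hx : x = 1 + ((∑ i, N i : ℕ) : ℝ) + d + 1 / (1 - γ) + 1 / ε + Real.log (1 / δ) +
      Real.log (1 + b) := by
    rw [hxdef, Fin.sum_univ_six]
    push_cast
    ring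
  clear_value x
  have hx1 : 1 ≤ x := by linarith
  have hpow : ∀ k ≤ 14, x ^ k ≤ x ^ 14 := fun k hk => pow_le_pow_right₀ hx1 hk
  have e1 := hpow 1 (by norm_num)
  have e2 := hpow 2 (by norm_num)
  have e6 := hpow 6 (by norm_num)
  rw [pow_one] at e1
  have hC := h.coreBound_le_pow hx1 (by linarith) (by linarith)
  have hK := h.numIter_le_pow (N := N) hx1 (by linarith) (by linarith) (by linarith) (by linarith)
  have hn := h.numRollouts_le_pow hδ hδ1 hx1 hC hK (by linarith) (by linarith) (by linarith)
  have hH := h.rolloutLength_le_pow hx1 (by linarith)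
  have hK' : ((tunedInput γ ε b δ F abar).K : ℝ) = numIter m d N γ ε b := rfl
  have hn' : ((tunedInput γ ε b δ F abar).n : ℝ) = numRollouts m d N γ ε b δ := rfl
  have hH' : ((tunedInput γ ε b δ F abar).H : ℝ) = rolloutLength m d γ ε b := rfl
  -- All sizes (`d`, `m`, the actions, `ℓ`, `n`, `H`, `K`) are below the common value `10^4 x^14`;
  -- the exponent 14 comes from `n`.
  apply runCost_le_pow <;> linarith

end Admissible

/-! ### Assembling the theorem -/

section Main

variable {S : Type u} [MeasurableSpace S] {m d : ℕ} {N : Fin m → ℕ}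

lemma Prog.prob_mono {Act : Type v} {α : Type w} [MeasurableSpace Act] (M : MDP S Act)
    (π₀ : Policy S Act)
    (p : Prog S Act α) {E E' : Set α} (h : E ⊆ E') : p.prob M π₀ E ≤ p.prob M π₀ E' :=
  Prog.expect_mono M π₀ p fun x =>
    Set.indicator_le_indicator_of_subset h (fun _ => zero_le) x

lemma prob_sampleSoftmax_singleton (M : MDP S (Joint N)) (π₀ : Policy S (Joint N))
    (I : Input S d N) (W : Fin d → ℝ) (s : S) (a : Joint N) :
    (sampleSoftmax I W s).prob M π₀ {a} = ENNReal.ofReal (I.feat.softmaxProb I.temp W s a) := by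
  rw [Prog.prob, expect_sampleSoftmax, Finset.sum_eq_single a]
  · simp
  · intro a' _ h
    simp [h]
  · simp

lemma sampleCost_le (hd : 0 < d) (hN : ∀ i, 0 < N i) :
    (sampleCost d N : ℝ) ≤ 7 * d * ∑ i, (N i : ℝ) := by
  rw [Finset.mul_sum, sampleCost]
  push_cast
  refine Finset.sum_le_sum fun i _ => ?_
  have h1 : (1 : ℝ) ≤ d := by exact_mod_cast hd
  have h2 : (1 : ℝ) ≤ N i := by exact_mod_cast hN i
  nlinarith

variable {M : MDP S (Joint N)} {F : Features S d N} {ε b δ : ℝ}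

lemma Admissible.wellPosed (h : Admissible m d M.γ ε b) (hδ : 0 < δ) (hδ1 : δ < 1)
    (hF : AdditiveRealizable M F b ε) (abar : Joint N) :
    WellPosed M (tunedInput M.γ ε b δ F abar) b ε (theta m d M.γ ε b) where
  comp_pos := h.m_pos
  reg_pos := h.regCoef_pos
  thr_eq := rfl
  disc_eq := rfl
  n_pos := h.numRollouts_pos hδ hδ1
  eps_nonneg := h.ε_pos.le
  theta_nonneg := h.theta_pos.le
  realizable := hF

lemma Admissible.length_le_floor (h : Admissible m d M.γ ε b) (hF : F.Bounded) (abar : Joint N)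
    {C : List (CoreElt S d N)} (hC : CoreValid (tunedInput M.γ ε b δ F abar) C) :
    C.length ≤ ⌊coreBound m d M.γ ε b⌋₊ :=
  Nat.le_floor (hC.length_le h.regCoef_pos h.d_pos hF)

lemma Admissible.prob_suboptimality_ge (h : Admissible m d M.γ ε b) (hδ : 0 < δ) (hδ1 : δ < 1)
    (hB : F.Bounded) (hF : AdditiveRealizable M F b ε) (abar : Joint N) (π₀ : Policy S (Joint N))
    (ρ : S) {T : ℕ} (hT : ⌊coreBound m d M.γ ε b⌋₊ ≤ T) :
    1 - ENNReal.ofReal δ ≤ (confidentPolitex (tunedInput M.γ ε b δ F abar) ρ T).prob M π₀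
      {out | ∃ l, out = some l ∧
        M.optValue ρ - M.mixtureValue (l.map (decode (tunedInput M.γ ε b δ F abar) π₀)) ρ ≤
          2 * kappa m d M.γ ε b} := by
  have hfloor : (⌊coreBound m d M.γ ε b⌋₊ : ℝ) ≤ coreBound m d M.γ ε b :=
    Nat.floor_le (by linarith [h.two_le_coreBound])
  have h1 := (h.wellPosed hδ hδ1 hF abar).prob_confidentPolitex_ge (π₀ := π₀)
    (fun C hC => h.length_le_floor hB abar hC) hfloor ρ hT
  have h2 : ((1 : ℝ≥0∞) - ENNReal.ofReal δ) ≤ ENNReal.ofReal (1 - ⌊coreBound m d M.γ ε b⌋₊ *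
      ((tunedInput M.γ ε b δ F abar).K * (⌊coreBound m d M.γ ε b⌋₊ *
        failProb M (tunedInput M.γ ε b δ F abar) (theta m d M.γ ε b)))) := by
    rw [← ENNReal.ofReal_one, ← ENNReal.ofReal_sub _ hδ.le]
    exact ENNReal.ofReal_le_ofReal (sub_le_sub_left (h.failure_le hδ hfloor) 1)
  refine h2.trans (h1.trans (Prog.prob_mono _ _ _ ?_))
  rintro _ ⟨l, rfl, hl, hs⟩
  exact ⟨l, rfl, suboptimality_le_of_shadowed h hl hs⟩

end Main

end

end ConfidentPolitex

theorem theorem4 :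
    ∃ (c : ℝ) (poly : MvPolynomial (Fin 6) ℝ),
      ∀ (S : Type*) [MeasurableSpace S] (m d : ℕ) (N : Fin m → ℕ)
        (M : MDP S (Joint N)) (F : Features S d N) (ε b δ : ℝ)
        (ρ : S) (abar : Joint N) (π₀ : Policy S (Joint N)),
        0 < m → 0 < d → 0 < ε → 0 < b → 0 < δ → δ < 1 →
        F.Bounded → AdditiveRealizable M F b ε →
        -- sampling from a softmax policy, one component at a time
        (∀ (W : Fin d → ℝ) (s : S),
          (∀ a, (sampleSoftmax (tunedInput M.γ ε b δ F abar) W s).prob M π₀ {a} =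
            ENNReal.ofReal
              (Real.exp (temperature m d N M.γ ε b * (W ⬝ᵥ F.joint s a)) /
                ∑ a₁ : Joint N,
                  Real.exp (temperature m d N M.γ ε b * (W ⬝ᵥ F.joint s a₁)))) ∧
          ∀ a q t, (sampleSoftmax (tunedInput M.γ ε b δ F abar) W s).Run M a q t →
            q = 0 ∧ (t : ℝ) ≤ c * d * ∑ i, (N i : ℝ)) ∧
        ∀ T : ℕ, coreBound m d M.γ ε b ≤ T →
          -- the sub-optimality of the output mixture policy
          1 - ENNReal.ofReal δ ≤
            (confidentPolitex (tunedInput M.γ ε b δ F abar) ρ T).prob M π₀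
              {out | ∃ l, out = some l ∧
                M.optValue ρ -
                    M.mixtureValue (l.map (decode (tunedInput M.γ ε b δ F abar) π₀)) ρ ≤
                  64 * ε * m * √d / (1 - M.γ) *
                    (1 + Real.log (1 + b ^ 2 * ε⁻¹ ^ 2 * (d : ℝ)⁻¹)) ^ (1 / 2 : ℝ)} ∧
          -- only local access to the simulator is used
          (confidentPolitex (tunedInput M.γ ε b δ F abar) ρ T).LocalAccess {ρ} ∧
          -- every run terminates properly, with the stated query and computation complexity
          ∀ out q t,
            (confidentPolitex (tunedInput M.γ ε b δ F abar) ρ T).Run M out q t →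
              (∃ l, out = some l ∧ l.length = numIter m d N M.γ ε b) ∧
              (q : ℝ) ≤ coreBound m d M.γ ε b ^ 2 * numIter m d N M.γ ε b *
                numRollouts m d N M.γ ε b δ * (rolloutLength m d M.γ ε b + 1) ∧
              (kappa m d M.γ ε b ≤ 1 / (1 - M.γ) →
                (q : ℝ) ≤ c * logFactor m d N M.γ ε b δ ^ 4 *
                  (m * d / (ε ^ 4 * (1 - M.γ) ^ 5))) ∧
              (t : ℝ) ≤ MvPolynomial.eval
                ![∑ i, (N i : ℝ), (d : ℝ), 1 / (1 - M.γ), 1 / ε, Real.log (1 / δ),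
                  Real.log (1 + b)] poly := by

  -- The constant 200 comes from the query bound; sampling would need only 7.
  refine ⟨200, timePoly, ?_⟩
  intro S _ m d N M F ε b δ ρ abar π₀ hm hd hε hb hδ hδ1 hB hF
  have h : Admissible m d M.γ ε b := ⟨hm, hd, M.γ_nonneg, M.γ_lt_one, hε, hb⟩
  -- The default action witnesses that no component action set is empty.
  have hN : ∀ i, 0 < N i := fun i => (abar i).pos
  refine ⟨fun W s => ⟨fun a => ?_, fun a q t hr => ?_⟩, fun T hT => ?_⟩
  · exact prob_sampleSoftmax_singleton M π₀ (tunedInput M.γ ε b δ F abar) W s a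
  · obtain ⟨hq, ht, -⟩ := (spec_sampleSoftmax W s ∅).run hr
    refine ⟨Nat.le_zero.1 hq, (Nat.cast_le.2 ht).trans ((sampleCost_le hd hN).trans ?_)⟩
    gcongr
    norm_num
  · have hfloor : (⌊coreBound m d M.γ ε b⌋₊ : ℝ) ≤ coreBound m d M.γ ε b :=
      Nat.floor_le (by linarith [h.two_le_coreBound])
    have hT' : ⌊coreBound m d M.γ ε b⌋₊ ≤ T := by exact_mod_cast hfloor.trans hT
    have hspec := spec_confidentPolitex (I := tunedInput M.γ ε b δ F abar) h.regCoef_pos rfl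
      (fun C hC => h.length_le_floor hB abar hC) ρ hT'
    refine ⟨?_, hspec.localAccess, fun out q t hr => ?_⟩
    · refine (h.prob_suboptimality_ge hδ hδ1 hB hF abar π₀ ρ hT').trans
        (Prog.prob_mono _ _ _ ?_)
      rintro _ ⟨l, rfl, hl⟩
      exact ⟨l, rfl, hl.trans (two_kappa_le h)⟩
    · obtain ⟨hq, ht, V, hout⟩ := hspec.run hr
      have hq' : (q : ℝ) ≤ coreBound m d M.γ ε b ^ 2 * numIter m d N M.γ ε b *
          numRollouts m d N M.γ ε b δ * (rolloutLength m d M.γ ε b + 1) := by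
        refine (Nat.cast_le.2 hq).trans ?_
        push_cast
        have h0 : (0 : ℝ) ≤ coreBound m d M.γ ε b := by linarith [h.two_le_coreBound]
        calc _ ≤ coreBound m d M.γ ε b * (numIter m d N M.γ ε b * (coreBound m d M.γ ε b *
              (numRollouts m d N M.γ ε b δ * (rolloutLength m d M.γ ε b + 1)))) := by
              gcongr <;> exact le_rfl
          _ = _ := by ring
      exact ⟨hout, hq', fun hκ => hq'.trans (h.queries_le_of_kappa_le hδ hδ1 hκ),
        (Nat.cast_le.2 ht).trans (h.runCost_le hδ hδ1 hN F abar hfloor)⟩
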